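/- Let $k\ge 1$ be an integer, $R=1/\sqrt{2k}$, and consider the $\mathbb Z_2$ orbifold ($X\mapsto -X$) of the free boson on the circle of radius $R$. For $\beta>0$ put $q=e^{-2\pi\beta}$, $\tilde q=e^{-2\pi/\beta}$, $\eta(q)=q^{1/24}\prod_{n\ge1}(1-q^n)$ and $$\chi_s=\sum_{n\in\mathbb Z}\frac{q^{k(n+s/2k)^2}}{\eta},\quad \chi_c=\sum_{n\in\mathbb Z}\frac{(-1)^nq^{n^2}}{\eta},\quad \chi^*_\pm=\tfrac12(\chi_0\pm\chi_c),\quad \chi_k^*=\tfrac12\chi_k,\quad \chi_+=\sum_{n\in\mathbb Z}\frac{q^{4(n+1/8)^2}}{\eta},\quad \chi_-=\sum_{n\in\mathbb Z}\frac{q^{4(n+3/8)^2}}{\eta}.$$ The extended characters are $\chi^*_\pm$, $\chi_m$ ($1\le m\le k-1$), $\chi^*_k$ (for two primary fields), $\chi_+$ and $\chi_-$ (for two primary fields each). *Ishibashi states.* In the untwisted sector let $|m,n\rangle$ be the state of momentum $m/R$ and winding $nR$, with left and right zero modes $m/2R\pm nR$, and put $$|i^{UN}_{nR}\rangle=e^{-\sum_{l\ge1}a_{-l}\bar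 a_{-l}/l}\,\tfrac12(|0,n\rangle+|0,-n\rangle),\qquad |i^{UD}_{n/2R}\rangle=e^{\sum_{l\ge1}a_{-l}\bar a_{-l}/l}\,\tfrac12(|n,0\rangle+|-n,0\rangle).$$ In the twisted sector let $|\sigma_0\rangle,|\sigma_{\pi R}\rangle$ be the orthonormal ground states of weight $(1/16,1/16)$ at the two fixed points, and put $$|i^{TD}_{x}\rangle=e^{\sum_{r}a_{-r}\bar a_{-r}/r}|\sigma_x\rangle\ (x=0,\pi R),\quad |i^{TN}_{0}\rangle=e^{-\sum_r a_{-r}\bar a_{-r}/r}\tfrac{1}{\sqrt2}(|\sigma_0\rangle+|\sigma_{\pi R}\rangle),\quad |i^{TN}_{\pi/2R}\rangle=e^{-\sum_r a_{-r}\bar a_{-r}/r}\tfrac{1}{\sqrt2}(|\sigma_0\rangle-|\sigma_{\pi R}\rangle),$$ with $r\in\{\tfrac12,\tfrac32,\dots\}$. The boundary states are the formal states $$|X_0^{N\pm}\rangle=\tfrac{1}{\sqrt2\,\sqrt[4]{2k}}\sum_{n\in\mathbb Z}|i^{UN}_{nR}\rangle\pm\tfrac1{\sqrt[4]2}|i^{TN}_0\rangle,\qquad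 |X_k^{N\pm}\rangle=\tfrac{1}{\sqrt2\,\sqrt[4]{2k}}\sum_{n\in\mathbb Z}(-1)^n|i^{UN}_{nR}\rangle\pm\tfrac1{\sqrt[4]2}|i^{TN}_{\pi/2R}\rangle,$$ $$|X_m^{N}\rangle=\tfrac{\sqrt2}{\sqrt[4]{2k}}\sum_{l=0}^{2k-1}e^{2\pi ilm/2k}\sum_{n\in\mathbb Z}|i^{UN}_{\sqrt{2k}(n+l/2k)}\rangle\quad(1\le m\le k-1),$$ $$|X_0^{D\pm}\rangle=\tfrac1{\sqrt2}\sqrt[4]{\tfrac k2}\sum_{n\in\mathbb Z}|i^{UD}_{n\sqrt{k/2}}\rangle\pm\tfrac1{\sqrt[4]2}|i^{TD}_0\rangle,\qquad |X_k^{D\pm}\rangle=\tfrac1{\sqrt2}\sqrt[4]{\tfrac k2}\sum_{n\in\mathbb Z}(-1)^n|i^{UD}_{n\sqrt{k/2}}\rangle\pm\tfrac1{\sqrt[4]2}|i^{TD}_{\pi R}\rangle,$$ labelled by the $k+7$ labels $0N\pm$, $mN$, $kN\pm$, $0D\pm$, $kD\pm$. The label $a$ also stands for the primary field with character $\chi_a=\chi^*_\pm,\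 \chi_m,\ \chi^*_k,\ \chi_\pm,\ \chi_\pm$ respectively; the vacuum label is $0=0N+$. The cylinder amplitudes are $Z_{ab}(q)=\langle X_a|\tilde q^{\frac12(L_0+\bar L_0-\frac1{12})}|X_b\rangle$. *Theorem.* 1. Each $|X_a\rangle$ is $\mathbb Z_2$-invariant and satisfies $(L_n-\bar L_{-n})|X_a\rangle=0$ for all $n\in\mathbb Z$. The $k+7$ states are linearly independent. All the sums $Z_{ab}$ converge absolutely. 2. $Z_{00}=\chi^*_+$, and $Z_{0a}=\chi_a$ for every label $a$. 3. $Z_{ab}=Z_{ba}$, and for signs $\epsilon,\epsilon'\in\{\pm1\}$ and $1\le m,m'\le k-1$ (writing $\chi^*_{\epsilon},\chi_{\epsilon}$ for the characters with sign $\epsilon$): - $Z^{N\epsilon,N\epsilon'}_{00}=Z^{N\epsilon,N\epsilon'}_{kk}=\chi^*_{\epsilon\epsilon'}$, $Z^{N\epsilon,N}_{0m}=\chi_m$, $Z^{N\epsilon,N\epsilon'}_{0k}=\chi_k^*$, $Z^{N,N\epsilon}_{mk}=\chi_{k-m}$; - $Z^{N,N}_{mm'}=\chi_{m-m'}+\chi_{m+m'}$;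 - $Z^{N\epsilon,D\epsilon'}_{00}=Z^{N\epsilon,D\epsilon'}_{0k}=Z^{N\epsilon,D\epsilon'}_{k0}=\chi_{\epsilon\epsilon'}$, $Z^{N\epsilon,D\epsilon'}_{kk}=\chi_{-\epsilon\epsilon'}$, $Z^{N,D\epsilon}_{m0}=Z^{N,D\epsilon}_{mk}=\chi_++\chi_-$; - $Z^{D\epsilon,D\epsilon'}_{00}=Z^{D\epsilon,D\epsilon'}_{kk}=\chi^*_{\epsilon\epsilon'}+\sum_{0<s<k,\ s\text{ even}}\chi_s+[k\text{ even}]\,\chi_k^*$, and $Z^{D\epsilon,D\epsilon'}_{0k}=\sum_{0<s<k,\ s\text{ odd}}\chi_s+[k\text{ odd}]\,\chi_k^*$. 4. Let $S$ be the symmetric matrix, indexed by the labels, that is $\frac1{\sqrt{8k}}$ times the following (with $\sigma_{0}=1$, $\sigma_{k}=-1$, and $x,y\in\{0,k\}$): $(0N\epsilon,0N\epsilon')\mapsto1$; $(0N\epsilon,mN)\mapsto2$; $(0N\epsilon,kN\epsilon')\mapsto1$; $(0N\epsilon,xD\epsilon')\mapsto\epsilon\sqrt k$; $(mN,m'N)\mapsto4\cos(\pi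 mm'/k)$; $(mN,kN\epsilon)\mapsto2(-1)^m$; $(mN,xD\epsilon)\mapsto0$; $(kN\epsilon,kN\epsilon')\mapsto(-1)^k$; $(kN\epsilon,xD\epsilon')\mapsto\epsilon\,\sigma_x(-i)^k\sqrt k$; $(xD\epsilon,yD\epsilon')\mapsto\epsilon\epsilon'\sqrt{k/2}\,(1+\sigma_x\sigma_y(-i)^k)$. Then $S$ is unitary, $S_{0a}>0$, $\chi_a(\tilde q)=\sum_bS_{ab}\chi_b(q)$, and $S^2$ is the permutation matrix of the involution $a\mapsto a^\vee$ that is trivial for even $k$ and for odd $k$ exchanges $kN+\leftrightarrow kN-$ and $0D\epsilon\leftrightarrow kD\epsilon$. 5. The numbers $N_{ab}^c=\sum_jS_{aj}S_{bj}\overline{S_{cj}}/S_{0j}$ given by the Verlinde formula are nonnegative integers, $N_{0b}^c=\delta_b^c$, and $Z_{ab}(q)=\sum_cN_{a^\vee b}^c\,\chi_c(q)$ for all $a,b$. So every amplitude is a nonnegative integer combination of extended characters and the amplitudes reproduce the fusion rules. The Cardy condition $\sum_cS_{cj}N_{a^\vee b}^c=\overline{\psi_a^j}\,\psi_b^j$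 with $\psi_a^j=S_{aj}/\sqrt{S_{0j}}$ holds. 6. There are $\mathbb Z_2$-invariant formal states $|j\rangle$, one for each label, that satisfy $(L_n-\bar L_{-n})|j\rangle=0$ for all $n$ and $\langle i|\tilde q^{\frac12(L_0+\bar L_0-\frac1{12})}|j\rangle=\delta_{ij}\chi_j(\tilde q)$ (absolutely convergent), with $|X_a\rangle=\sum_j\frac{S_{aj}}{\sqrt{S_{0j}}}|j\rangle$ for every $a$. -/

import Mathlib

namespace OrbifoldBoundary

/-! ## Characters -/

/-- The Dedekind eta function `q^(1/24) ∏_{n ≥ 1} (1 - q^n)`. -/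
noncomputable def eta (q : ℝ) : ℝ := q ^ (1 / 24 : ℝ) * ∏' n : ℕ, (1 - q ^ (n + 1))

/-- The circle character `χ_s(q) = ∑_{n ∈ ℤ} q^(k (n + s/2k)²) / η(q)`. -/
noncomputable def circleChar (k : ℕ) (s : ℤ) (q : ℝ) : ℝ :=
  ∑' n : ℤ, q ^ ((k : ℝ) * ((n : ℝ) + (s : ℝ) / (2 * k)) ^ 2) / eta q

/-- `χ_c(q) = ∑_{n ∈ ℤ} (-1)^n q^(n²) / η(q)`. -/
noncomputable def chiC (q : ℝ) : ℝ :=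
  ∑' n : ℤ, (((-1 : ℤˣ) ^ n : ℤˣ) : ℝ) * q ^ ((n : ℝ) ^ 2) / eta q

/-- `χ*_±(q) = (χ_0(q) ± χ_c(q)) / 2`. -/
noncomputable def vacChar (k : ℕ) (e : ℤˣ) (q : ℝ) : ℝ :=
  (circleChar k 0 q + (e : ℝ) * chiC q) / 2

/-- `χ*_k(q) = χ_k(q) / 2`. -/
noncomputable def midChar (k : ℕ) (q : ℝ) : ℝ := circleChar k k q / 2

/-- The twisted characters `χ_+(q) = ∑ q^(4 (n + 1/8)²) / η(q)` and
`χ_-(q) = ∑ q^(4 (n + 3/8)²) / η(q)`. -/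
noncomputable def twChar (e : ℤˣ) (q : ℝ) : ℝ :=
  if e = 1 then ∑' n : ℤ, q ^ (4 * ((n : ℝ) + 1 / 8) ^ 2) / eta q
  else ∑' n : ℤ, q ^ (4 * ((n : ℝ) + 3 / 8) ^ 2) / eta q

/-- The `k + 7` labels, used both for the extended characters and for the boundary states.
The sign is an element of `ℤˣ = {1, -1}`. -/
inductive Label (k : ℕ) : Type
  | N0 (e : ℤˣ)
  | N (m : Finset.Ioo 0 k)
  | Nk (e : ℤˣ)
  | D0 (e : ℤˣ)
  | Dk (e : ℤˣ)
  deriving DecidableEq, Fintype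

/-- The vacuum label. -/
def vac (k : ℕ) : Label k := Label.N0 1

/-- The extended character with a given label: `χ*_±`, `χ_m`, `χ*_k` (two labels), and
`χ_±` (two labels each). -/
noncomputable def extChar (k : ℕ) : Label k → ℝ → ℝ
  | .N0 e => vacChar k e
  | .N m => circleChar k (m : ℕ)
  | .Nk _ => midChar k
  | .D0 e => twChar e
  | .Dk e => twChar e

/-! ## Fock space

Orthonormal basis of the space of states of the untwisted and of the twisted sector, before the
projection on `ℤ/2`-invariant states. The oscillator `j : ℕ` has energy `j + 1` in the untwisted
and `j + 1/2` in the twisted sector; `K` and `L` are the occupation numbers of the left and right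
movers, and the basis vector is `∏_j α_{-ω j}^{K j} / √(ω j ^ K j (K j)!)`, times the same for
the right movers, applied to the ground state. -/

/-- Occupation numbers of the oscillators of one chirality. -/
abbrev Occ : Type := ℕ →₀ ℕ

/-- Basis vectors. Left summand (untwisted sector): momentum number `m`, winding number `w`,
occupation numbers. Right summand (twisted sector): the fixed point (`false` is `0`, `true` is
`πR`), occupation numbers. -/
abbrev BasisVec : Type := (ℤ × ℤ × Occ × Occ) ⊕ (Bool × Occ × Occ)

/-- Formal (not necessarily normalizable) states: arbitrary coefficients in the basis. -/
abbrev State : Type := BasisVec → ℂ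

/-- Oscillator energies in the untwisted sector. -/
noncomputable def omU (j : ℕ) : ℝ := (j : ℝ) + 1

/-- Oscillator energies in the twisted sector. -/
noncomputable def omT (j : ℕ) : ℝ := (j : ℝ) + 1 / 2

/-- The radius, `R = 1 / √(2k)`. -/
noncomputable def radius (k : ℕ) : ℝ := 1 / √(2 * k)

/-- Eigenvalue of `α_0` on `|m, w⟩`. -/
noncomputable def pL (k : ℕ) (m w : ℤ) : ℝ := m / (2 * radius k) + w * radius k

/-- Eigenvalue of `\bar α_0` on `|m, w⟩`. -/
noncomputable def pR (k : ℕ) (m w : ℤ) : ℝ := m / (2 * radius k) - w * radius k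

/-- The annihilation operator `α_{ω j}` of the oscillator `j`. -/
noncomputable def annih (om : ℕ → ℝ) (j : ℕ) (f : Occ → ℂ) : Occ → ℂ := fun K =>
  (√(om j * (K j + 1)) : ℝ) * f (K + Finsupp.single j 1)

/-- The creation operator `α_{-ω j}` of the oscillator `j`. -/
noncomputable def creat (om : ℕ → ℝ) (j : ℕ) (f : Occ → ℂ) : Occ → ℂ := fun K =>
  (√(om j * K j) : ℝ) * f (K - Finsupp.single j 1)

/-- The untwisted mode `α_n`, `n ∈ ℤ`, at zero-mode eigenvalue `p`. -/
noncomputable def modeU (p : ℝ) : ℤ → (Occ → ℂ) → Occ → ℂ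
  | Int.ofNat 0, f => fun K => (p : ℂ) * f K
  | Int.ofNat (j + 1), f => annih omU j f
  | Int.negSucc j, f => creat omU j f

/-- The twisted mode `α_{n + 1/2}`, `n ∈ ℤ`. -/
noncomputable def modeT : ℤ → (Occ → ℂ) → Occ → ℂ
  | Int.ofNat j, f => annih omT j f
  | Int.negSucc j, f => creat omT j f

/-- The normal ordered product of the modes `a` and `b`: the larger mode acts first. -/
noncomputable def normalOrd (mode : ℤ → (Occ → ℂ) → Occ → ℂ) (a b : ℤ) (f : Occ → ℂ) : Occ → ℂ :=
  if a ≤ b then mode a (mode b f) else mode b (mode a f)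

/-- One chirality of the untwisted Virasoro generator: `L_n = (1/2) ∑_{m ∈ ℤ} :α_{n-m} α_m:`.
At each `K` only finitely many terms are nonzero. -/
noncomputable def virU (p : ℝ) (n : ℤ) (f : Occ → ℂ) : Occ → ℂ := fun K =>
  (1 / 2) * ∑ᶠ m : ℤ, normalOrd (modeU p) (n - m) m f K

/-- One chirality of the twisted Virasoro generator:
`L_n = (1/2) ∑_{r ∈ ℤ + 1/2} :α_{n-r} α_r: + δ_{n,0} / 16`, with `r = m + 1/2`. -/
noncomputable def virT (n : ℤ) (f : Occ → ℂ) : Occ → ℂ := fun K =>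
  (1 / 2) * (∑ᶠ m : ℤ, normalOrd modeT (n - m - 1) m f K) + (if n = 0 then f K / 16 else 0)

/-- The Virasoro generator `L_n` on formal states. -/
noncomputable def virL (k : ℕ) (n : ℤ) (x : State) : State
  | .inl (m, w, K, L) => virU (pL k m w) n (fun J => x (.inl (m, w, J, L))) K
  | .inr (b, K, L) => virT n (fun J => x (.inr (b, J, L))) K

/-- The Virasoro generator `\bar L_n` on formal states. -/
noncomputable def virR (k : ℕ) (n : ℤ) (x : State) : State
  | .inl (m, w, K, L) => virU (pR k m w) n (fun J => x (.inl (m, w, K, J))) L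
  | .inr (b, K, L) => virT n (fun J => x (.inr (b, K, J))) L

/-- The Virasoro Ishibashi condition `(L_n - \bar L_{-n}) |B⟩ = 0` for all `n`. -/
def IsIshibashi (k : ℕ) (x : State) : Prop := ∀ n : ℤ, virL k n x - virR k (-n) x = 0

/-- The total number of oscillators. -/
noncomputable def occCount (K : Occ) : ℕ := K.sum fun _ c => c

/-- The action of `g : X ↦ -X` on states: all modes, momentum and winding change sign. -/
noncomputable def reflect (x : State) : State
  | .inl (m, w, K, L) => (-1) ^ (occCount K + occCount L) * x (.inl (-m, -w, K, L))
  | .inr (b, K, L) => (-1) ^ (occCount K + occCount L) * x (.inr (b, K, L))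

/-- The eigenvalue of `L_0 + \bar L_0`. -/
noncomputable def weight (k : ℕ) : BasisVec → ℝ
  | .inl (m, w, K, L) => (pL k m w ^ 2 / 2 + K.sum fun j c => omU j * c)
      + (pR k m w ^ 2 / 2 + L.sum fun j c => omU j * c)
  | .inr (_, K, L) => (1 / 16 + K.sum fun j c => omT j * c)
      + (1 / 16 + L.sum fun j c => omT j * c)

/-- `q = exp(-2πβ)`. -/
noncomputable def qOpen (β : ℝ) : ℝ := Real.exp (-2 * Real.pi * β)

/-- `\tilde q = exp(-2π/β)`. -/
noncomputable def qClosed (β : ℝ) : ℝ := Real.exp (-2 * Real.pi / β)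

/-- The terms of the expansion of the cylinder amplitude in the orthonormal basis. -/
noncomputable def cylTerm (k : ℕ) (β : ℝ) (x y : State) (v : BasisVec) : ℂ :=
  starRingEnd ℂ (x v) * y v * ((qClosed β ^ ((weight k v - 1 / 12) / 2) : ℝ) : ℂ)

/-- The cylinder amplitude `⟨x| e^{-H_β / 2} |y⟩ = ⟨x| \tilde q^{(L_0 + \bar L_0 - 1/12)/2} |y⟩`. -/
noncomputable def cylinder (k : ℕ) (β : ℝ) (x y : State) : ℂ := ∑' v : BasisVec, cylTerm k β x y v

/-! ## Virasoro Ishibashi states -/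

/-- The coefficients of `exp(ε ∑_j α_{-ω j} \bar α_{-ω j} / ω j)`, applied to a ground state, in the
orthonormal basis: `∏_j (ε / ω j)^{K j} / (K j)!` times the norms `√(ω j ^ K j (K j)!)` of the
left and of the right vector. -/
noncomputable def expCoeff (om : ℕ → ℝ) (ε : ℂ) (K L : Occ) : ℂ :=
  if K = L then
    K.prod fun j c => (ε / (om j : ℂ)) ^ c / (c.factorial : ℂ) *
      ((om j : ℂ) ^ c * (c.factorial : ℂ))
  else 0

/-- `exp(-∑ α_{-n} \bar α_{-n} / n) |0, n⟩`. -/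
noncomputable def circleN (n : ℤ) : State
  | .inl (m, w, K, L) => if m = 0 ∧ w = n then expCoeff omU (-1) K L else 0
  | .inr _ => 0

/-- `exp(∑ α_{-n} \bar α_{-n} / n) |n, 0⟩`. -/
noncomputable def circleD (n : ℤ) : State
  | .inl (m, w, K, L) => if m = n ∧ w = 0 then expCoeff omU 1 K L else 0
  | .inr _ => 0

/-- The invariant untwisted Neumann Ishibashi state `|i^{UN}_{nR}⟩`, with `|i^{UN}_0⟩` of unit
ground-state component. -/
noncomputable def ishUN (n : ℤ) : State := (1 / 2 : ℂ) • (circleN n + circleN (-n))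

/-- The invariant untwisted Dirichlet Ishibashi state `|i^{UD}_{n/2R}⟩`. -/
noncomputable def ishUD (n : ℤ) : State := (1 / 2 : ℂ) • (circleD n + circleD (-n))

/-- `exp(ε ∑_{r ∈ ℕ + 1/2} α_{-r} \bar α_{-r} / r) |1/16, 1/16⟩_b`. -/
noncomputable def twistExp (ε : ℂ) (b : Bool) : State
  | .inl _ => 0
  | .inr (b₁, K, L) => if b₁ = b then expCoeff omT ε K L else 0

/-- The twisted Dirichlet states `|i^{TD}_0⟩` (`false`) and `|i^{TD}_{πR}⟩` (`true`). -/
noncomputable def ishTD (b : Bool) : State := twistExp 1 b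

/-- The twisted Neumann state `|i^{TN}_0⟩`. -/
noncomputable def ishTN0 : State :=
  ((1 / √2 : ℝ) : ℂ) • (twistExp (-1) false + twistExp (-1) true)

/-- The twisted Neumann state `|i^{TN}_{π/2R}⟩`. -/
noncomputable def ishTNpi : State :=
  ((1 / √2 : ℝ) : ℂ) • (twistExp (-1) false - twistExp (-1) true)

/-- The formal sum `∑_{n ∈ ℤ} c n |x n⟩`, coefficient by coefficient; it is used only where each
coefficient receives finitely many nonzero contributions. -/
noncomputable def formalSum (c : ℤ → ℂ) (x : ℤ → State) : State := fun v => ∑ᶠ n : ℤ, c n * x n v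

/-! ## Boundary states -/

/-- `(-1)^n` for an integer `n`. -/
def altSign (n : ℤ) : ℂ := ((((-1 : ℤˣ) ^ n : ℤˣ) : ℤ) : ℂ)

/-- `1 / (√2 (2k)^{1/4})`. -/
noncomputable def cN (k : ℕ) : ℂ := ((1 / (√2 * (2 * (k : ℝ)) ^ (1 / 4 : ℝ)) : ℝ) : ℂ)

/-- `√2 / (2k)^{1/4}`. -/
noncomputable def cM (k : ℕ) : ℂ := ((√2 / (2 * (k : ℝ)) ^ (1 / 4 : ℝ) : ℝ) : ℂ)

/-- `(1 / √2) (k/2)^{1/4}`. -/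
noncomputable def cD (k : ℕ) : ℂ := ((1 / √2 * ((k : ℝ) / 2) ^ (1 / 4 : ℝ) : ℝ) : ℂ)

/-- `± 1 / 2^{1/4}`. -/
noncomputable def cT (e : ℤˣ) : ℂ := (((e : ℝ) / (2 : ℝ) ^ (1 / 4 : ℝ) : ℝ) : ℂ)

/-- The boundary states `|X_0^{N±}⟩`, `|X_m^N⟩`, `|X_k^{N±}⟩`, `|X_0^{D±}⟩`, `|X_k^{D±}⟩`. -/
noncomputable def boundaryState (k : ℕ) : Label k → State
  | .N0 e => cN k • formalSum (fun _ => 1) ishUN + cT e • ishTN0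
  | .N m => cM k • ∑ l ∈ Finset.range (2 * k),
      Complex.exp (2 * Real.pi * Complex.I * l * (m : ℕ) / (2 * k)) •
        formalSum (fun _ => 1) (fun n => ishUN (2 * k * n + l))
  | .Nk e => cN k • formalSum altSign ishUN + cT e • ishTNpi
  | .D0 e => cD k • formalSum (fun _ => 1) ishUD + cT e • ishTD false
  | .Dk e => cD k • formalSum altSign ishUD + cT e • ishTD true

/-- The cylinder amplitude between two of the boundary states. -/
noncomputable def Z (k : ℕ) (β : ℝ) (a b : Label k) : ℂ :=
  cylinder k β (boundaryState k a) (boundaryState k b)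

/-! ## Modular matrix and fusion rules -/

/-- The entries of the modular matrix, up to the factor `1 / √(8k)`. -/
noncomputable def sEntry (k : ℕ) : Label k → Label k → ℂ
  | .N0 _, .N0 _ => 1
  | .N0 _, .N _ => 2
  | .N0 _, .Nk _ => 1
  | .N0 e, .D0 _ => (e : ℤ) * (√k : ℝ)
  | .N0 e, .Dk _ => (e : ℤ) * (√k : ℝ)
  | .N _, .N0 _ => 2
  | .N m, .N n => 4 * (Real.cos (Real.pi * (m : ℕ) * (n : ℕ) / k) : ℝ)
  | .N m, .Nk _ => 2 * (-1) ^ (m : ℕ)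
  | .N _, .D0 _ => 0
  | .N _, .Dk _ => 0
  | .Nk _, .N0 _ => 1
  | .Nk _, .N m => 2 * (-1) ^ (m : ℕ)
  | .Nk _, .Nk _ => (-1) ^ k
  | .Nk e, .D0 _ => (e : ℤ) * (-Complex.I) ^ k * (√k : ℝ)
  | .Nk e, .Dk _ => -((e : ℤ) * (-Complex.I) ^ k * (√k : ℝ))
  | .D0 _, .N0 e => (e : ℤ) * (√k : ℝ)
  | .D0 _, .N _ => 0
  | .D0 _, .Nk e => (e : ℤ) * (-Complex.I) ^ k * (√k : ℝ)
  | .D0 d, .D0 e => (d : ℤ) * (e : ℤ) * (√(k / 2) : ℝ) * (1 + (-Complex.I) ^ k)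
  | .D0 d, .Dk e => (d : ℤ) * (e : ℤ) * (√(k / 2) : ℝ) * (1 - (-Complex.I) ^ k)
  | .Dk _, .N0 e => (e : ℤ) * (√k : ℝ)
  | .Dk _, .N _ => 0
  | .Dk _, .Nk e => -((e : ℤ) * (-Complex.I) ^ k * (√k : ℝ))
  | .Dk d, .D0 e => (d : ℤ) * (e : ℤ) * (√(k / 2) : ℝ) * (1 - (-Complex.I) ^ k)
  | .Dk d, .Dk e => (d : ℤ) * (e : ℤ) * (√(k / 2) : ℝ) * (1 + (-Complex.I) ^ k)

/-- The modular matrix `S` of the `ℤ/2` orbifold at `R² = 1/2k`, indexed by its `k + 7` primary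
fields. -/
noncomputable def modularS (k : ℕ) : Matrix (Label k) (Label k) ℂ :=
  Matrix.of fun a b => sEntry k a b / ((√(8 * k) : ℝ) : ℂ)

/-- Charge conjugation `a ↦ a^∨`: trivial for even `k`; for odd `k` it exchanges the two fields
with character `χ*_k`, and the two fields with character `χ_+`, and those with `χ_-`. -/
def dual (k : ℕ) : Label k → Label k
  | .N0 e => .N0 e
  | .N m => .N m
  | .Nk e => if Even k then .Nk e else .Nk (-e)
  | .D0 e => if Even k then .D0 e else .Dk e
  | .Dk e => if Even k then .Dk e else .D0 e

/-- The fusion rules by the Verlinde formula, `N_{ab}^c = ∑_j S_{aj} S_{bj} \bar S_{cj} / S_{0j}`. -/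
noncomputable def fusion (k : ℕ) (a b c : Label k) : ℂ :=
  ∑ j, modularS k a j * modularS k b j * starRingEnd ℂ (modularS k c j) / modularS k (vac k) j

/-- The coefficients `S_a^j / (S_0^j)^{1/2}` of Cardy's boundary states. -/
noncomputable def cardyCoeff (k : ℕ) (a j : Label k) : ℂ :=
  modularS k a j / ((√(modularS k (vac k) j).re : ℝ) : ℂ)

end OrbifoldBoundary

open OrbifoldBoundary

namespace OrbifoldBoundary

/-! ## The Jacobi triple product -/

open Filter Topology

/-! Every boundary state has the same shape. In the orthonormal Fock basis `exp(ε ∑ α_{-ω} \bar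
α_{-ω} / ω)` has the coefficients `ε ^ |K|` on equal left and right occupation numbers `K`, with `ε
= -1` for Neumann and `ε = 1` for Dirichlet. So a boundary state is a `glued` state: a sign `ε`, a
function on the lattice of momenta and windings, and a function on the two fixed points
(`boundaryState_eq`). Symmetrizing under `X ↦ -X` turns all phases on the lattice into cosines.

Such a state satisfies `α_a = ε \bar α_{-a}` mode by mode, and for the zero mode this is the
condition that selects pure winding or pure momentum. The Virasoro generators are quadratic in the
modes, the signs multiply to `ε² = 1`, and the reflection of the modes exchanges `L_n` and `\bar
L_{-n}`. This is the Ishibashi condition (`isIshibashi_glued`).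

The cylinder sum of two glued states factorizes in each sector (`hasSum_cylTerm_glued`) into a
finite or theta-like sum over ground states and the oscillator product `∏ (1 - εε' q^ω)⁻¹`. The
Jacobi triple product identifies the oscillator products: for equal signs `1/η` and `χ_+ + χ_-`, for
opposite signs `χ_c` and `χ_+ - χ_-`. All of `η`, `χ_c`, `χ_±` are thereby combinations of theta
functions of level 6 or 4, so that Poisson summation, in the finite form `theta_inv`, transforms
them as well as the lattice sums. The result is the table of amplitudes.

The modular matrix is studied through its rows, which are affine in the sign labels and given by a
cosine on the labels `N m`. The orthogonality of cosines gives `S Sᵀ`, and complex conjugation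
permutes the rows by `dual`; together they give unitarity. For the Verlinde formula the products of
fields are written down explicitly as multisets (`fusionFields`). For each `j` the quotient `a ↦
S_{aj} / S_{0j}` is multiplicative for this product (`sEntry_eq_mul_quot`), and unitarity then
identifies the multiplicities with the Verlinde numbers. They are natural numbers by construction,
and comparison with the table gives the amplitudes as fusion rules.

Finally, the extended Ishibashi states need no separate construction: they are obtained from the
boundary states by inverting Cardy's relation with the unitary matrix `S`. Their orthogonality
follows from the amplitudes in the closed channel, and with the positivity of the characters it also
gives the linear independence. -/

lemma hasSum_congr' {ι M : Type*} [AddCommMonoid M] [TopologicalSpace M] {f g : ι → M} {a b : M}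
    (h : HasSum f a) (hf : ∀ i, g i = f i) (hb : b = a) : HasSum g b := by
  rw [funext hf, hb]; exact h

/-! ## The Jacobi triple product -/

lemma multipliable_one_add_mul_pow {x : ℝ} (h0 : 0 ≤ x) (h1 : x < 1) (c : ℝ) {a : ℕ} (ha : 0 < a)
    (b : ℕ) : Multipliable fun n : ℕ => 1 + c * x ^ (a * n + b) := by
  apply multipliable_one_add_of_summable
  have hs : Summable fun n : ℕ => |c| * x ^ b * (x ^ a) ^ n :=
    (summable_geometric_of_lt_one (pow_nonneg h0 a) (pow_lt_one₀ h0 h1 ha.ne')).mul_left _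
  refine hs.congr fun n => ?_
  rw [Real.norm_eq_abs, abs_mul, abs_of_nonneg (pow_nonneg h0 _), pow_add, pow_mul]
  ring

lemma multipliable_one_sub_pow_real {x : ℝ} (h0 : 0 ≤ x) (h1 : x < 1) :
    Multipliable fun n : ℕ => 1 - x ^ (n + 1) := by
  refine (multipliable_one_add_mul_pow h0 h1 (-1) one_pos 1).congr fun n => ?_
  ring

/-- The finite product `∏_{i ≤ n} (1 - x^i)`. -/
noncomputable def qPoch (x : ℝ) (n : ℕ) : ℝ := ∏ i ∈ Finset.range n, (1 - x ^ (i + 1))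

lemma qPoch_succ (x : ℝ) (n : ℕ) : qPoch x (n + 1) = qPoch x n * (1 - x ^ (n + 1)) :=
  Finset.prod_range_succ _ _

lemma qPoch_pos {x : ℝ} (h0 : 0 ≤ x) (h1 : x < 1) (n : ℕ) : 0 < qPoch x n :=
  Finset.prod_pos fun i _ => sub_pos.mpr (pow_lt_one₀ h0 h1 i.succ_ne_zero)

lemma qPoch_antitone {x : ℝ} (h0 : 0 ≤ x) (h1 : x < 1) : Antitone (qPoch x) := by
  refine antitone_nat_of_succ_le fun n => ?_
  rw [qPoch_succ]
  exact mul_le_of_le_one_right (qPoch_pos h0 h1 n).le (by linarith [pow_nonneg h0 (n + 1)])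

lemma tendsto_qPoch {x : ℝ} (h0 : 0 ≤ x) (h1 : x < 1) :
    Tendsto (qPoch x) atTop (𝓝 (∏' n : ℕ, (1 - x ^ (n + 1)))) :=
  (multipliable_one_sub_pow_real h0 h1).hasProd.tendsto_prod_nat

lemma tprod_one_sub_le_qPoch {x : ℝ} (h0 : 0 ≤ x) (h1 : x < 1) (n : ℕ) :
    ∏' n : ℕ, (1 - x ^ (n + 1)) ≤ qPoch x n :=
  (qPoch_antitone h0 h1).le_of_tendsto (tendsto_qPoch h0 h1) n

lemma tprod_one_sub_pos {x : ℝ} (h0 : 0 ≤ x) (h1 : x < 1) :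
    0 < ∏' n : ℕ, (1 - x ^ (n + 1)) := by
  refine lt_of_le_of_ne (ge_of_tendsto' (tendsto_qPoch h0 h1) fun n => (qPoch_pos h0 h1 n).le)
    (Ne.symm ?_)
  have := tprod_one_add_ne_zero_of_summable (f := fun n : ℕ => -x ^ (n + 1)) ?_ ?_
  · simpa [sub_eq_add_neg] using this
  · intro n
    have := pow_lt_one₀ h0 h1 n.succ_ne_zero
    intro h
    simp only [Nat.succ_eq_add_one] at this
    linarith
  · simpa [abs_of_nonneg h0] using
      (summable_nat_add_iff 1).mpr (summable_geometric_of_lt_one h0 h1)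

/-- The reciprocal of `qPoch`, extended by `0` to negative integers. -/
noncomputable def qRecip (x : ℝ) (m : ℤ) : ℝ := if m < 0 then 0 else (qPoch x m.toNat)⁻¹

/-- Because of the value `0` at negative integers the recursion has no exceptions: at `m = 0` the
factor `1 - x ^ 0` vanishes. The Pascal rule for the triple product therefore needs no boundary
cases. -/
lemma qRecip_sub_one {x : ℝ} (h0 : 0 < x) (h1 : x < 1) (m : ℤ) :
    qRecip x (m - 1) = (1 - x ^ m) * qRecip x m := by
  rcases lt_trichotomy m 0 with h | rfl | h
  · simp [qRecip, h, show m - 1 < 0 by omega]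
  · simp [qRecip]
  · obtain ⟨n, rfl⟩ : ∃ n : ℕ, m = n + 1 := ⟨(m - 1).toNat, by omega⟩
    have e1 : ¬ ((n : ℤ) + 1 - 1 < 0) := by omega
    have e2 : ¬ ((n : ℤ) + 1 < 0) := by omega
    have e3 : ((n : ℤ) + 1 - 1).toNat = n := by omega
    have e4 : ((n : ℤ) + 1).toNat = n + 1 := by omega
    have hp := qPoch_pos h0.le h1 n
    have hx : 0 < 1 - x ^ (n + 1) := sub_pos.mpr (pow_lt_one₀ h0.le h1 n.succ_ne_zero)
    simp only [qRecip, e1, e2, e3, e4, if_false, qPoch_succ]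
    rw [show x ^ ((n : ℤ) + 1) = x ^ (n + 1) by exact_mod_cast zpow_natCast x (n + 1)]
    field_simp

lemma qRecip_nonneg {x : ℝ} (h0 : 0 ≤ x) (h1 : x < 1) (m : ℤ) : 0 ≤ qRecip x m := by
  unfold qRecip
  split_ifs
  · rfl
  · exact (inv_pos.mpr (qPoch_pos h0 h1 _)).le

lemma qRecip_le {x : ℝ} (h0 : 0 ≤ x) (h1 : x < 1) (m : ℤ) :
    qRecip x m ≤ (∏' n : ℕ, (1 - x ^ (n + 1)))⁻¹ := by
  unfold qRecip
  split_ifs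
  · exact (inv_pos.mpr (tprod_one_sub_pos h0 h1)).le
  · exact inv_anti₀ (tprod_one_sub_pos h0 h1) (tprod_one_sub_le_qPoch h0 h1 _)

lemma tendsto_qRecip {x : ℝ} (h0 : 0 ≤ x) (h1 : x < 1) {u : ℕ → ℤ} (hu : Tendsto u atTop atTop) :
    Tendsto (fun N => qRecip x (u N)) atTop (𝓝 (∏' n : ℕ, (1 - x ^ (n + 1)))⁻¹) := by
  have h := ((tendsto_qPoch h0 h1).inv₀ (tprod_one_sub_pos h0 h1).ne').comp
    ((tendsto_natCast_atTop_iff (R := ℤ) (f := fun N => (u N).toNat)).mp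
      (tendsto_atTop_mono (fun N => Int.self_le_toNat (u N)) hu))
  refine h.congr' ?_
  filter_upwards [hu.eventually_ge_atTop 0] with N hN
  simp [qRecip, not_lt.mpr hN]

/-- The coefficients of the finite form of the triple product. -/
noncomputable def jtpCoeff (q : ℝ) (N : ℕ) (n : ℤ) : ℝ :=
  qPoch (q ^ 2) (2 * N) * (qRecip (q ^ 2) (N + n) * qRecip (q ^ 2) (N - n)) * q ^ (n ^ 2)

/-- The Pascal rule for the `q²`-binomial coefficients times `q ^ (n²)`. It expresses multiplication
by `(1 + z q^(2N+1)) (1 + z⁻¹ q^(2N+1)) = 1 + q^(2(2N+1)) + q^(2N+1) (z + z⁻¹)`. -/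
lemma jtpCoeff_succ {q : ℝ} (h0 : 0 < q) (h1 : q < 1) (N : ℕ) (n : ℤ) :
    jtpCoeff q (N + 1) n = (1 + q ^ (2 * (2 * N + 1))) * jtpCoeff q N n
      + q ^ (2 * N + 1) * (jtpCoeff q N (n - 1) + jtpCoeff q N (n + 1)) := by
  have hx0 : 0 < q ^ 2 := by positivity
  have hx1 : q ^ 2 < 1 := pow_lt_one₀ h0.le h1 two_ne_zero
  have hr := qRecip_sub_one hx0 hx1
  have a1 : qRecip (q ^ 2) (N + n) = (1 - (q ^ 2) ^ ((N : ℤ) + n + 1)) *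
      qRecip (q ^ 2) (N + n + 1) := by
    rw [← hr]; congr 1; ring
  have a2 : qRecip (q ^ 2) (N + n - 1) = (1 - (q ^ 2) ^ ((N : ℤ) + n)) *
      qRecip (q ^ 2) (N + n) := hr _
  have a3 : qRecip (q ^ 2) (N - n) = (1 - (q ^ 2) ^ ((N : ℤ) - n + 1)) *
      qRecip (q ^ 2) (N - n + 1) := by
    rw [← hr]; congr 1; ring
  have a4 : qRecip (q ^ 2) (N - n - 1) = (1 - (q ^ 2) ^ ((N : ℤ) - n)) *
      qRecip (q ^ 2) (N - n) := hr _
  have z : ∀ m : ℤ, (q ^ 2) ^ m = q ^ m * q ^ m := fun m => by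
    rw [← zpow_natCast, ← zpow_mul, ← zpow_add₀ h0.ne']; congr 1; push_cast; ring
  have e1 : q ^ ((n - 1) ^ 2) = q ^ (n ^ 2) * q * (q ^ n)⁻¹ * (q ^ n)⁻¹ := by
    rw [← zpow_neg, ← zpow_add_one₀ h0.ne', ← zpow_add₀ h0.ne', ← zpow_add₀ h0.ne']
    congr 1; ring
  have e2 : q ^ ((n + 1) ^ 2) = q ^ (n ^ 2) * q * q ^ n * q ^ n := by
    rw [← zpow_add_one₀ h0.ne', ← zpow_add₀ h0.ne', ← zpow_add₀ h0.ne']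
    congr 1; ring
  have hp : qPoch (q ^ 2) (2 * (N + 1)) = qPoch (q ^ 2) (2 * N) * (1 - (q ^ 2) ^ (2 * N + 1)) *
      (1 - (q ^ 2) ^ (2 * N + 2)) := by
    rw [show 2 * (N + 1) = 2 * N + 1 + 1 by ring, qPoch_succ, qPoch_succ]
  have i1 : ((N + 1 : ℕ) : ℤ) + n = N + n + 1 := by push_cast; ring
  have i2 : ((N + 1 : ℕ) : ℤ) - n = N - n + 1 := by push_cast; ring
  have i3 : (N : ℤ) + (n - 1) = N + n - 1 := by ring
  have i4 : (N : ℤ) - (n - 1) = N - n + 1 := by ring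
  have i5 : (N : ℤ) + (n + 1) = N + n + 1 := by ring
  have i6 : (N : ℤ) - (n + 1) = N - n - 1 := by ring
  simp only [jtpCoeff, i1, i2, i3, i4, i5, i6, hp, e1, e2]
  -- All reciprocals are reduced to those at `N + n + 1` and `N - n + 1`, which leaves a rational
  -- identity in `q`, `q ^ N` and `q ^ n`.
  rw [a2, a4, a1, a3]
  simp only [z, zpow_add₀ h0.ne', zpow_sub₀ h0.ne', zpow_natCast, zpow_one]
  have hY : q ^ n ≠ 0 := (zpow_pos h0 n).ne'
  field_simp
  ring

/-- The finite form of the Jacobi triple product. -/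
lemma hasSum_jtpCoeff {q : ℝ} (h0 : 0 < q) (h1 : q < 1) {z : ℝ} (hz : z ≠ 0) (N : ℕ) :
    HasSum (fun n : ℤ => jtpCoeff q N n * z ^ n)
      (∏ i ∈ Finset.range N, ((1 + z * q ^ (2 * i + 1)) * (1 + z⁻¹ * q ^ (2 * i + 1)))) := by
  induction N with
  | zero =>
    have : ∀ n : ℤ, n ≠ 0 → jtpCoeff q 0 n * z ^ n = 0 := by
      intro n hn
      rcases lt_or_gt_of_ne hn with h | h
      · simp [jtpCoeff, qRecip, h]
      · simp [jtpCoeff, qRecip, h]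
    convert hasSum_single (0 : ℤ) this using 1
    simp [jtpCoeff, qRecip, qPoch]
  | succ N ih =>
    have s1 : HasSum (fun n : ℤ => jtpCoeff q N (n - 1) * z ^ n)
        (z * ∏ i ∈ Finset.range N, ((1 + z * q ^ (2 * i + 1)) * (1 + z⁻¹ * q ^ (2 * i + 1)))) := by
      have := ((Equiv.subRight (1 : ℤ)).hasSum_iff.mpr ih).mul_left z
      refine this.congr_fun fun n => ?_
      simp only [Function.comp, Equiv.subRight_apply]
      rw [zpow_sub_one₀ hz]; field_simp
    have s2 : HasSum (fun n : ℤ => jtpCoeff q N (n + 1) * z ^ n)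
        (z⁻¹ * ∏ i ∈ Finset.range N,
          ((1 + z * q ^ (2 * i + 1)) * (1 + z⁻¹ * q ^ (2 * i + 1)))) := by
      have := ((Equiv.addRight (1 : ℤ)).hasSum_iff.mpr ih).mul_left z⁻¹
      refine this.congr_fun fun n => ?_
      simp only [Function.comp, Equiv.coe_addRight]
      rw [zpow_add_one₀ hz]; field_simp
    have := (ih.mul_left (1 + q ^ (2 * (2 * N + 1)))).add ((s1.add s2).mul_left (q ^ (2 * N + 1)))
    refine hasSum_congr' this (fun n => ?_) ?_
    · rw [jtpCoeff_succ h0 h1]; ring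
    · rw [Finset.prod_range_succ]
      have : z⁻¹ * z = 1 := inv_mul_cancel₀ hz
      linear_combination (q ^ (2 * (2 * N + 1)) * ∏ i ∈ Finset.range N,
        ((1 + z * q ^ (2 * i + 1)) * (1 + z⁻¹ * q ^ (2 * i + 1)))) * this

/-- The Jacobi triple product identity. -/
lemma tendsto_jacobi_triple {q : ℝ} (h0 : 0 < q) (h1 : q < 1) {z : ℝ} (hz : z ≠ 0)
    (hs : Summable fun n : ℤ => q ^ (n ^ 2) * |z| ^ n) :
    Tendsto (fun N => ∏ i ∈ Finset.range N, ((1 - q ^ (2 * (i + 1))) *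
      ((1 + z * q ^ (2 * i + 1)) * (1 + z⁻¹ * q ^ (2 * i + 1))))) atTop
      (𝓝 (∑' n : ℤ, q ^ (n ^ 2) * z ^ n)) := by
  have hx0 : 0 < q ^ 2 := by positivity
  have hx1 : q ^ 2 < 1 := pow_lt_one₀ h0.le h1 two_ne_zero
  set P := ∏' n : ℕ, (1 - (q ^ 2) ^ (n + 1)) with hP
  have hPpos : 0 < P := tprod_one_sub_pos hx0.le hx1
  -- Dominated convergence: the coefficients tend to `P * P⁻¹ * P⁻¹ * q ^ (n²)` and are bounded by
  -- `P⁻¹ * P⁻¹ * q ^ (n²)`.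
  have key : Tendsto (fun N => ∑' n : ℤ, jtpCoeff q N n * z ^ n) atTop
      (𝓝 (∑' n : ℤ, P⁻¹ * (q ^ (n ^ 2) * z ^ n))) := by
    refine tendsto_tsum_of_dominated_convergence (hs.mul_left (P⁻¹ * P⁻¹)) (fun n => ?_)
      (Eventually.of_forall fun N n => ?_)
    · have t1 : Tendsto (fun N : ℕ => (N : ℤ) + n) atTop atTop :=
        tendsto_atTop_add_const_right _ _ tendsto_natCast_atTop_atTop
      have t2 : Tendsto (fun N : ℕ => (N : ℤ) - n) atTop atTop :=
        tendsto_atTop_add_const_right _ (-n) tendsto_natCast_atTop_atTop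
      have t3 : Tendsto (fun N : ℕ => qPoch (q ^ 2) (2 * N)) atTop (𝓝 P) :=
        (tendsto_qPoch hx0.le hx1).comp
          (tendsto_id.const_mul_atTop' (show 0 < 2 by norm_num))
      have := ((t3.mul ((tendsto_qRecip hx0.le hx1 t1).mul
        (tendsto_qRecip hx0.le hx1 t2))).mul_const (q ^ (n ^ 2))).mul_const (z ^ n)
      rw [← hP] at this
      rw [show P⁻¹ * (q ^ (n ^ 2) * z ^ n) = P * (P⁻¹ * P⁻¹) * q ^ (n ^ 2) * z ^ n by
        rw [mul_inv_cancel_left₀ hPpos.ne', mul_assoc]]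
      exact this
    · rw [norm_mul, norm_zpow, Real.norm_eq_abs, Real.norm_eq_abs, jtpCoeff, abs_mul, abs_mul,
        abs_mul, abs_of_pos (qPoch_pos hx0.le hx1 _), abs_of_nonneg (qRecip_nonneg hx0.le hx1 _),
        abs_of_nonneg (qRecip_nonneg hx0.le hx1 _), abs_of_pos (zpow_pos h0 _), ← mul_assoc]
      have b1 : qPoch (q ^ 2) (2 * N) ≤ 1 := by
        simpa [qPoch] using qPoch_antitone hx0.le hx1 (Nat.zero_le (2 * N))
      have b2 := qRecip_le hx0.le hx1 (N + n)
      have b3 := qRecip_le hx0.le hx1 (N - n)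
      have b4 := qRecip_nonneg hx0.le hx1 (N + n)
      have b5 := qRecip_nonneg hx0.le hx1 (N - n)
      have hz' : 0 < |z| := abs_pos.mpr hz
      rw [mul_assoc]
      refine mul_le_mul_of_nonneg_right ?_ (by positivity)
      calc _ ≤ 1 * P⁻¹ * P⁻¹ := mul_le_mul (mul_le_mul b1 b2 b4 zero_le_one) b3 b5 (by positivity)
        _ = _ := by rw [one_mul]
  have k2 : Tendsto (fun N => ∏ i ∈ Finset.range N, (1 - q ^ (2 * (i + 1)))) atTop (𝓝 P) := by
    refine (tendsto_qPoch hx0.le hx1).congr fun N => ?_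
    simp only [qPoch, pow_mul]
  have := k2.mul key
  rw [tsum_mul_left, mul_inv_cancel_left₀ hPpos.ne'] at this
  refine this.congr fun N => ?_
  rw [(hasSum_jtpCoeff h0 h1 hz N).tsum_eq, ← Finset.prod_mul_distrib]

end OrbifoldBoundary

namespace OrbifoldBoundary

/-! ## Theta functions and their modular transformation -/

open Filter Topology
open HurwitzZeta (evenKernel cosKernel)

/-! ## Sums over residue classes -/

/-- The function is the finite sum of its restrictions to the residue classes, extended by zero. -/
lemma hasSum_int_of_residues {N : ℕ} (hN : 0 < N) {f : ℤ → ℝ} {a : ℕ → ℝ}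
    (h : ∀ t < N, HasSum (fun n : ℤ => f (N * n + t)) (a t)) :
    HasSum f (∑ t ∈ Finset.range N, a t) := by
  have hN' : (0 : ℤ) < N := by exact_mod_cast hN
  have h1 : ∀ t ∈ Finset.range N, HasSum (fun n : ℤ => if n % N = t then f n else 0) (a t) := by
    intro t ht
    rw [Finset.mem_range] at ht
    have ht' : (t : ℤ) < N := by exact_mod_cast ht
    have hinj : Function.Injective fun n : ℤ => (N : ℤ) * n + t := fun a b hab => by
      simpa [hN.ne'] using hab
    refine (hinj.hasSum_iff fun n hn => ?_).mp (hasSum_congr' (h t ht) (fun n => ?_) rfl)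
    · refine if_neg fun e => hn ⟨n / N, ?_⟩
      change (N : ℤ) * (n / N) + t = n
      rw [← e]; exact Int.mul_ediv_add_emod n N
    · have : ((N : ℤ) * n + t) % N = t := by
        rw [Int.mul_add_emod_self_left, Int.emod_eq_of_lt (by positivity) ht']
      simp [this]
  refine hasSum_congr' (hasSum_sum h1) (fun n => ?_) rfl
  have h0 := Int.emod_nonneg n hN'.ne'
  have hlt := Int.emod_lt_of_pos n hN'
  rw [Finset.sum_eq_single (n % N).toNat]
  · rw [if_pos (by omega)]
  · intro b _ hb
    rw [if_neg (by omega)]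
  · intro hb
    rw [Finset.mem_range] at hb
    omega

lemma sum_range_succ_eq_Ioo {M : Type*} [AddCommMonoid M] (k : ℕ) (g : ℤ → M) :
    ∑ t ∈ Finset.range k, g ((t + 1 : ℕ) : ℤ) = ∑ s ∈ Finset.Ioo 0 (k + 1), g s := by
  have : Finset.Ioo 0 (k + 1) = Finset.Ico (0 + 1) (k + 1) := by ext; simp; omega
  rw [this, ← Finset.sum_Ico_add' (fun t : ℕ => g t), Finset.range_eq_Ico]

/-- A sum of an even function over the residues modulo `2k`. -/
lemma sum_range_two_mul_of_even {M : Type*} [AddCommMonoid M] {k : ℕ} (hk : 1 ≤ k) {g : ℤ → M}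
    (hneg : ∀ s, g (-s) = g s) (hper : ∀ s, g (s + 2 * k) = g s) :
    ∑ t ∈ Finset.range (2 * k), g t = g 0 + g k + 2 • ∑ s ∈ Finset.Ioo 0 k, g s := by
  obtain ⟨k, rfl⟩ : ∃ l, k = l + 1 := ⟨k - 1, by omega⟩
  rw [two_mul, Finset.sum_range_add, ← Finset.sum_range_reflect (fun t : ℕ => g ((k + 1 + t : ℕ)))]
  -- With `k` now standing for the old `k - 1`, the upper half of the residues is read backwards;
  -- evenness and periodicity send it to `1, ..., k + 1`.
  have h1 : ∀ t ∈ Finset.range (k + 1),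
      g ((k + 1 + (k + 1 - 1 - t) : ℕ)) = g ((t + 1 : ℕ)) := by
    intro t ht
    rw [Finset.mem_range] at ht
    rw [← hneg, ← hper]
    congr 1
    omega
  rw [Finset.sum_congr rfl h1, Finset.sum_range_succ' (fun t : ℕ => g t),
    Finset.sum_range_succ (fun t : ℕ => g ((t + 1 : ℕ))), sum_range_succ_eq_Ioo, two_nsmul]
  push_cast
  abel

lemma sum_range_even_add {M : Type*} [AddCommMonoid M] (k r : ℕ) (hr : r < 2) (g : ℤ → M) :
    ∑ t ∈ Finset.range k, g (2 * t + r) =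
      ∑ t ∈ Finset.range (2 * k), if t % 2 = r then g t else 0 := by
  induction k with
  | zero => simp
  | succ k ih =>
    rw [Finset.sum_range_succ, ih, show 2 * (k + 1) = 2 * k + 1 + 1 by ring, Finset.sum_range_succ,
      Finset.sum_range_succ, add_assoc]
    congr 1
    interval_cases r
    · simp
    · have : (2 * k + 1) % 2 = 1 := by omega
      simp [this]

/-! ## Theta functions -/

lemma qOpen_rpow (β x : ℝ) : qOpen β ^ x = Real.exp (-2 * Real.pi * β * x) := by
  rw [qOpen, ← Real.exp_mul]

lemma qOpen_pos (β : ℝ) : 0 < qOpen β := Real.exp_pos _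

lemma qOpen_lt_one {β : ℝ} (hβ : 0 < β) : qOpen β < 1 := by
  rw [qOpen, Real.exp_lt_one_iff]
  have := mul_pos Real.pi_pos hβ
  linarith

lemma qClosed_eq (β : ℝ) : qClosed β = qOpen (1 / β) := by
  rw [qClosed, qOpen]; ring_nf

/-- The theta function `∑_n q^(k (n + s/2k)²)` at `q = exp(-2πβ)`. -/
noncomputable def theta (k : ℕ) (s : ℤ) (β : ℝ) : ℝ :=
  ∑' n : ℤ, qOpen β ^ ((k : ℝ) * ((n : ℝ) + (s : ℝ) / (2 * k)) ^ 2)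

/-- The even Hurwitz kernel is `∑ exp(-π (n + a)² t)`, here at `a = s/2k` and `t = 2kβ`. Evenness
and periodicity in `s`, and Poisson summation, are inherited from it. -/
lemma hasSum_theta {k : ℕ} (hk : 1 ≤ k) (s : ℤ) {β : ℝ} (hβ : 0 < β) :
    HasSum (fun n : ℤ => qOpen β ^ ((k : ℝ) * ((n : ℝ) + (s : ℝ) / (2 * k)) ^ 2))
      (evenKernel ((s / (2 * k) : ℝ)) (2 * k * β)) := by
  have hk' : (0 : ℝ) < k := by exact_mod_cast hk
  refine hasSum_congr' (HurwitzZeta.hasSum_int_evenKernel (s / (2 * k) : ℝ)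
    (show 0 < 2 * k * β by positivity)) (fun n => ?_) rfl
  rw [qOpen_rpow]
  ring_nf

lemma theta_eq {k : ℕ} (hk : 1 ≤ k) (s : ℤ) {β : ℝ} (hβ : 0 < β) :
    theta k s β = evenKernel ((s / (2 * k) : ℝ)) (2 * k * β) := (hasSum_theta hk s hβ).tsum_eq

lemma theta_neg {k : ℕ} (hk : 1 ≤ k) (s : ℤ) {β : ℝ} (hβ : 0 < β) :
    theta k (-s) β = theta k s β := by
  rw [theta_eq hk _ hβ, theta_eq hk _ hβ, ← HurwitzZeta.evenKernel_neg]
  push_cast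
  rw [neg_div, AddCircle.coe_neg, neg_neg]

lemma theta_add {k : ℕ} (hk : 1 ≤ k) (s : ℤ) {β : ℝ} (hβ : 0 < β) :
    theta k (s + 2 * k) β = theta k s β := by
  have hk' : (0 : ℝ) < k := by exact_mod_cast hk
  rw [theta_eq hk _ hβ, theta_eq hk _ hβ]
  push_cast
  rw [add_div, div_self (by positivity), AddCircle.coe_add, AddCircle.coe_period, add_zero]

lemma theta_pos {k : ℕ} (hk : 1 ≤ k) (s : ℤ) {β : ℝ} (hβ : 0 < β) : 0 < theta k s β := by
  exact (hasSum_theta hk s hβ).summable.tsum_pos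
    (fun n => (Real.rpow_pos_of_pos (qOpen_pos β) _).le) 0 (Real.rpow_pos_of_pos (qOpen_pos β) _)

lemma hasSum_cosKernel (a : ℝ) {t : ℝ} (ht : 0 < t) :
    HasSum (fun n : ℤ => Real.cos (2 * Real.pi * a * n) * Real.exp (-Real.pi * n ^ 2 * t))
      (1 / √t * evenKernel a (1 / t)) := by
  have h := Complex.hasSum_re (HurwitzZeta.hasSum_int_cosKernel a ht)
  refine hasSum_congr' h (fun n => ?_) ?_
  · rw [Complex.re_mul_ofReal]
    congr 1
    rw [show 2 * (Real.pi : ℂ) * Complex.I * a * n = ((2 * Real.pi * a * n : ℝ) : ℂ) * Complex.I by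
      push_cast; ring, Complex.exp_ofReal_mul_I_re]
  · rw [Complex.ofReal_re, HurwitzZeta.evenKernel_functional_equation, one_div_one_div,
      ← Real.sqrt_eq_rpow, Real.sqrt_div zero_le_one, Real.sqrt_one]
    have := Real.sqrt_pos.mpr ht
    field_simp

/-- Poisson summation for the theta functions. -/
lemma hasSum_theta_dual {k : ℕ} (hk : 1 ≤ k) (s : ℤ) {β : ℝ} (hβ : 0 < β) :
    HasSum (fun n : ℤ => Real.cos (Real.pi * s * n / k) * qClosed β ^ ((n : ℝ) ^ 2 / (4 * k)))
      (√(2 * k * β) * theta k s β) := by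
  have hk' : (0 : ℝ) < k := by exact_mod_cast hk
  refine hasSum_congr' (hasSum_cosKernel (s / (2 * k) : ℝ)
    (show 0 < 1 / (2 * k * β) by positivity)) (fun n => ?_) ?_
  · rw [qClosed_eq, qOpen_rpow]
    congr 2
    · field_simp
    · field_simp
      ring
  · rw [theta_eq hk s hβ, one_div_one_div, Real.sqrt_div zero_le_one, Real.sqrt_one, one_div_one_div]

/-- The modular transformation of the theta functions. -/
lemma theta_inv {k : ℕ} (hk : 1 ≤ k) (s : ℤ) {β : ℝ} (hβ : 0 < β) :
    theta k s (1 / β) = √β / √(2 * k) *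
      ∑ t ∈ Finset.range (2 * k), Real.cos (Real.pi * s * t / k) * theta k t β := by
  have hk' : (0 : ℝ) < k := by exact_mod_cast hk
  have h1 := hasSum_theta_dual hk s (one_div_pos.mpr hβ)
  -- The cosine depends only on `n` modulo `2k`, and `(2kn + t)² / 4k = k (n + t/2k)²`, so each
  -- residue class is again a theta function.
  have h2 : HasSum (fun n : ℤ => Real.cos (Real.pi * s * n / k) *
      qClosed (1 / β) ^ ((n : ℝ) ^ 2 / (4 * k)))
      (∑ t ∈ Finset.range (2 * k), Real.cos (Real.pi * s * t / k) * theta k t β) := by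
    refine hasSum_int_of_residues (by omega) fun t _ => ?_
    rw [theta_eq hk _ hβ]
    refine hasSum_congr' ((hasSum_theta hk t hβ).mul_left _) (fun n => ?_) rfl
    rw [qClosed_eq, one_div_one_div]
    congr 1
    · push_cast
      rw [show Real.pi * s * (2 * k * n + t) / k =
        Real.pi * s * t / k + ((s * n : ℤ) : ℝ) * (2 * Real.pi) by push_cast; field_simp; ring,
        Real.cos_add_int_mul_two_pi]
    · congr 1
      push_cast
      field_simp
      ring
  have h3 := h1.unique h2
  rw [← h3, mul_one_div, Real.sqrt_div (by positivity)]
  have a1 : 0 < √β := Real.sqrt_pos.mpr hβ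
  have a2 : 0 < √(2 * (k : ℝ)) := Real.sqrt_pos.mpr (by positivity)
  field_simp

/-- This is the momentum sum of the Dirichlet states. Poisson summation gives `∑ exp(-π (n + r/2)²
2β/k)`, and its terms with `n` in a fixed class `t` modulo `k` form the theta function of charge `2t
+ r`. -/
lemma hasSum_theta_dirichlet {k : ℕ} (hk : 1 ≤ k) (r : ℕ) {β : ℝ} (hβ : 0 < β) :
    HasSum (fun n : ℤ => Real.cos (Real.pi * r * n) * qClosed β ^ ((k : ℝ) * (n : ℝ) ^ 2 / 4))
      (√(2 * β / k) * ∑ t ∈ Finset.range k, theta k (2 * t + r) β) := by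
  have hk' : (0 : ℝ) < k := by exact_mod_cast hk
  have h2 : HasSum (fun n : ℤ => Real.exp (-Real.pi * (n + (r / 2 : ℝ)) ^ 2 * (2 * β / k)))
      (∑ t ∈ Finset.range k, theta k (2 * t + r) β) := by
    refine hasSum_int_of_residues (by omega) fun t _ => ?_
    rw [theta_eq hk _ hβ]
    refine hasSum_congr' (hasSum_theta hk _ hβ) (fun n => ?_) rfl
    rw [qOpen_rpow]
    congr 1
    push_cast
    field_simp
    ring
  have h3 := (HurwitzZeta.hasSum_int_evenKernel (r / 2 : ℝ)
    (show 0 < 2 * β / k by positivity)).unique h2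
  refine hasSum_congr' (hasSum_cosKernel (r / 2 : ℝ)
    (show 0 < 1 / (2 * β / k) by positivity)) (fun n => ?_) ?_
  · rw [qClosed_eq, qOpen_rpow]
    congr 2
    · ring
    · field_simp
      ring
  · rw [← h3, one_div_one_div, Real.sqrt_div zero_le_one, Real.sqrt_one, one_div_one_div]

end OrbifoldBoundary

namespace OrbifoldBoundary

/-! ## Product formulas for the characters -/

open Filter Topology
open HurwitzZeta (evenKernel cosKernel)

/-! ## Product formulas -/

lemma unit_zpow_two_mul (ε : ℤˣ) (n : ℤ) : ((ε : ℤ) : ℝ) ^ (2 * n) = 1 := by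
  rcases Int.units_eq_one_or ε with rfl | rfl <;> simp [zpow_mul]

lemma unit_abs (ε : ℤˣ) : |((ε : ℤ) : ℝ)| = 1 := by
  rcases Int.units_eq_one_or ε with rfl | rfl <;> simp

lemma unit_ne_zero (ε : ℤˣ) : ((ε : ℤ) : ℝ) ≠ 0 := by
  rcases Int.units_eq_one_or ε with rfl | rfl <;> simp

lemma unit_inv (ε : ℤˣ) : ((ε : ℤ) : ℝ)⁻¹ = ((ε : ℤ) : ℝ) := by
  rcases Int.units_eq_one_or ε with rfl | rfl <;> simp

lemma unit_mul_self (ε : ℤˣ) : ((ε : ℤ) : ℝ) * ((ε : ℤ) : ℝ) = 1 := by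
  rcases Int.units_eq_one_or ε with rfl | rfl <;> simp

/-- The triple product at `q = exp(-πt)`, `z = ε q^(2c)`, with `ε = ±1`. -/
lemma tendsto_triple_evenKernel {t : ℝ} (ht : 0 < t) (c : ℝ) (ε : ℤˣ) {q z : ℝ}
    (hq : q = Real.exp (-Real.pi * t)) (hz : z = Real.exp (-Real.pi * t * (2 * c))) :
    Tendsto (fun N => ∏ i ∈ Finset.range N, ((1 - q ^ (2 * (i + 1))) *
      ((1 + (ε : ℤ) * z * q ^ (2 * i + 1)) * (1 + (ε : ℤ) * z⁻¹ * q ^ (2 * i + 1))))) atTop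
      (𝓝 (Real.exp (Real.pi * t * c ^ 2) * (evenKernel ((c / 2 : ℝ)) (4 * t) +
        (ε : ℤ) * evenKernel (((c + 1) / 2 : ℝ)) (4 * t)))) := by
  have h0 : 0 < q := hq ▸ Real.exp_pos _
  have hz0 : 0 < z := hz ▸ Real.exp_pos _
  have h1 : q < 1 := by
    rw [hq, Real.exp_lt_one_iff]
    have := mul_pos Real.pi_pos ht
    linarith
  -- Completing the square, `n² + 2cn = (n + c)² - c²`.
  have e : ∀ n : ℤ, q ^ (n ^ 2) * z ^ n =
      Real.exp (Real.pi * t * c ^ 2) * Real.exp (-Real.pi * (n + c) ^ 2 * t) := fun n => by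
    rw [hq, hz, ← Real.rpow_intCast, ← Real.rpow_intCast, ← Real.exp_mul, ← Real.exp_mul, ← Real.exp_add, ← Real.exp_add]
    congr 1
    push_cast
    ring
  have habs : |((ε : ℤ) : ℝ) * z| = z := by rw [abs_mul, unit_abs, one_mul, abs_of_pos hz0]
  have h := tendsto_jacobi_triple h0 h1 (z := (ε : ℤ) * z)
    (mul_ne_zero (unit_ne_zero ε) hz0.ne') (by
      rw [habs]
      exact ((HurwitzZeta.hasSum_int_evenKernel c ht).summable.mul_left _).congr fun n => (e n).symm)
  rw [mul_inv, unit_inv] at h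
  convert h using 2
  refine (HasSum.tsum_eq ?_).symm
  -- The sign `ε ^ n` depends only on the parity of `n`, and `(2n + i + c)² t = 4t (n + (c +
  -- i)/2)²`.
  have hsum : Real.exp (Real.pi * t * c ^ 2) * (evenKernel ((c / 2 : ℝ)) (4 * t) +
      (ε : ℤ) * evenKernel (((c + 1) / 2 : ℝ)) (4 * t)) = ∑ i ∈ Finset.range 2,
      (Real.exp (Real.pi * t * c ^ 2) * ((ε : ℤ) : ℝ) ^ i) *
        evenKernel (((c + i) / 2 : ℝ)) (4 * t) := by
    simp [Finset.sum_range_succ]; ring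
  rw [hsum]
  refine hasSum_int_of_residues two_pos fun i _ => ?_
  refine hasSum_congr' ((HurwitzZeta.hasSum_int_evenKernel ((c + i) / 2 : ℝ)
    (show 0 < 4 * t by positivity)).mul_left _) (fun n => ?_) rfl
  rw [mul_zpow, zpow_add₀ (unit_ne_zero ε)]
  push_cast
  rw [unit_zpow_two_mul, zpow_natCast, one_mul, mul_left_comm, e, mul_left_comm, ← mul_assoc]
  congr 2
  push_cast
  ring

/-- `η = ∑_n (-1)^n q^((6n+1)²/24)`. -/
lemma eta_eq_theta {β : ℝ} (hβ : 0 < β) : eta (qOpen β) = theta 6 1 β - theta 6 5 β := by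
  have hq0 := qOpen_pos β
  have hq1 := qOpen_lt_one hβ
  obtain ⟨y, hy⟩ : ∃ y, y = Real.exp (-Real.pi * β) := ⟨_, rfl⟩
  have hy0 : y ≠ 0 := hy ▸ Real.exp_ne_zero _
  have hyq : qOpen β = y ^ 2 := by
    rw [hy, ← Real.exp_nat_mul, qOpen]; push_cast; ring_nf
  -- Euler's pentagonal number theorem: with base `y³` and `z = -y` the three factors are `1 -
  -- q^(3i+3)`, `1 - q^(3i+2)` and `1 - q^(3i+1)`, where `q = y²`.
  have h := tendsto_triple_evenKernel (show 0 < 3 * β by positivity) (1 / 6) (-1)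
    (q := y ^ 3) (z := y) (by rw [hy, ← Real.exp_nat_mul]; push_cast; ring_nf) (by rw [hy]; ring_nf)
  have h2 : Tendsto (fun N => qPoch (qOpen β) (3 * N)) atTop
      (𝓝 (∏' n : ℕ, (1 - qOpen β ^ (n + 1)))) :=
    (tendsto_qPoch hq0.le hq1).comp (tendsto_id.const_mul_atTop' (show 0 < 3 by norm_num))
  have h3 := tendsto_nhds_unique (h2.congr fun N => ?_) h
  -- The second kernel sits at `(1/6 + 1)/2 = 7/12`, that is, at charge `7 = -5 + 12`.
  · have h7 : theta 6 7 β = theta 6 5 β := by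
      rw [← theta_neg (by norm_num) 5 hβ, ← theta_add (by norm_num) (-5) hβ]; norm_num
    rw [← h7, eta, h3, theta_eq (by norm_num) _ hβ, theta_eq (by norm_num) _ hβ, qOpen_rpow,
      ← mul_assoc, ← Real.exp_add]
    ring_nf
    simp [sub_eq_add_neg]
  · induction N with
    | zero => simp [qPoch]
    | succ N ih =>
      rw [Finset.prod_range_succ, ← ih, show 3 * (N + 1) = 3 * N + 1 + 1 + 1 by ring,
        qPoch_succ, qPoch_succ, qPoch_succ, hyq]
      simp only [Units.val_neg, Units.val_one, Int.cast_neg, Int.cast_one]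
      field_simp
      ring

lemma eta_pos {q : ℝ} (h0 : 0 < q) (h1 : q < 1) : 0 < eta q :=
  mul_pos (Real.rpow_pos_of_pos h0 _) (tprod_one_sub_pos h0.le h1)

/-- Since `cos(5πt/6) = (-1)^t cos(πt/6)`, the difference of the level 6 theta functions of charges
1 and 5 receives only odd `t`. At `t = 3` the cosine vanishes, and at `t = 1, 5` it is `±√3/2`, so
the difference reproduces itself. -/
lemma eta_qClosed {β : ℝ} (hβ : 0 < β) : eta (qClosed β) = √β * eta (qOpen β) := by
  rw [qClosed_eq, eta_eq_theta (one_div_pos.mpr hβ), eta_eq_theta hβ,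
    theta_inv (by norm_num) _ hβ, theta_inv (by norm_num) _ hβ, ← mul_sub, ← Finset.sum_sub_distrib]
  have c0 : ∀ t : ℕ, Real.cos (Real.pi * (1 : ℤ) * t / (6 : ℕ)) * theta 6 t β -
      Real.cos (Real.pi * (5 : ℤ) * t / (6 : ℕ)) * theta 6 t β =
      (1 - (-1) ^ (t : ℤ)) * Real.cos (Real.pi * (t : ℤ) / 6) * theta 6 (t : ℤ) β := fun t => by
    rw [← Real.cos_int_mul_pi, show Real.pi * (5 : ℤ) * t / (6 : ℕ) =
      ((t : ℤ) : ℝ) * Real.pi - Real.pi * (t : ℤ) / 6 by push_cast; ring, Real.cos_sub,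
      Real.sin_int_mul_pi]
    push_cast
    ring_nf
  rw [Finset.sum_congr rfl fun t _ => c0 t, sum_range_two_mul_of_even (k := 6) (by norm_num)
    (g := fun s : ℤ => (1 - (-1) ^ s) * Real.cos (Real.pi * s / 6) * theta 6 s β)
    (fun s => ?_) (fun s => ?_)]
  · rw [show Finset.Ioo 0 6 = {1, 2, 3, 4, 5} by decide]
    have c5 : Real.cos (Real.pi * 5 / 6) = - (√3 / 2) := by
      rw [show Real.pi * 5 / 6 = Real.pi - Real.pi / 6 by ring, Real.cos_pi_sub, Real.cos_pi_div_six]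
    have c3 : Real.cos (Real.pi * 3 / 6) = 0 := by
      rw [show Real.pi * 3 / 6 = Real.pi / 2 by ring, Real.cos_pi_div_two]
    have e12 : √(2 * (6 : ℕ)) = 2 * √3 := by
      rw [show (2 * (6 : ℕ) : ℝ) = 2 ^ 2 * 3 by norm_num, Real.sqrt_mul (by norm_num),
        Real.sqrt_sq (by norm_num)]
    have hs3 : 0 < √(3 : ℝ) := by positivity
    have n6 : (-1 : ℝ) ^ (6 : ℤ) = 1 := by norm_num
    rw [e12]
    simp [c3, c5, n6, Real.cos_pi_div_six]
    field_simp
    ring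
  · rw [theta_neg (by norm_num) _ hβ, Int.cast_neg, mul_neg, neg_div, Real.cos_neg, zpow_neg,
      ← inv_zpow, inv_neg, inv_one]
  · rw [theta_add (by norm_num) _ hβ, zpow_add₀ (by norm_num),
      show Real.pi * ((s + 2 * (6 : ℕ) : ℤ) : ℝ) / 6 = Real.pi * s / 6 + (1 : ℤ) * (2 * Real.pi) by
        push_cast; ring, Real.cos_add_int_mul_two_pi, zpow_mul]
    norm_num

lemma one_le_tprod_one_add {x : ℝ} (h0 : 0 ≤ x) (h1 : x < 1) :
    1 ≤ ∏' n : ℕ, (1 + x ^ (n + 1)) := by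
  have h := (multipliable_one_add_mul_pow h0 h1 1 one_pos 1).hasProd.tendsto_prod_nat
  simp only [one_mul] at h
  refine ge_of_tendsto' h fun n => Finset.one_le_prod fun i => ?_
  simp [pow_nonneg h0]

lemma tprod_one_add_pos {x : ℝ} (h0 : 0 ≤ x) (h1 : x < 1) :
    0 < ∏' n : ℕ, (1 + x ^ (n + 1)) := one_pos.trans_le (one_le_tprod_one_add h0 h1)

/-- Euler: `∏ (1 - x^(2i+1)) ∏ (1 + x^i) = 1`. -/
lemma tendsto_prod_odd {x : ℝ} (h0 : 0 < x) (h1 : x < 1) :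
    Tendsto (fun N => ∏ i ∈ Finset.range N, (1 - x ^ (2 * i + 1))) atTop
      (𝓝 (∏' n : ℕ, (1 + x ^ (n + 1)))⁻¹) := by
  have hD := (multipliable_one_add_mul_pow h0.le h1 1 one_pos 1).hasProd.tendsto_prod_nat
  simp only [one_mul] at hD
  have hE := tendsto_qPoch h0.le h1
  have hE2 : Tendsto (fun N => qPoch x (2 * N)) atTop (𝓝 (∏' n : ℕ, (1 - x ^ (n + 1)))) :=
    hE.comp (tendsto_id.const_mul_atTop' (show 0 < 2 by norm_num))
  have hEpos := tprod_one_sub_pos h0.le h1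
  -- The factors `1 - x^i`, `i ≤ 2N`, are the odd ones and `1 - x^(2i) = (1 - x^i)(1 + x^i)`, `i ≤
  -- N`; hence the odd product is this quotient already at finite `N`.
  have h := hE2.div (hE.mul hD) (mul_pos hEpos (tprod_one_add_pos h0.le h1)).ne'
  rw [div_mul_eq_div_div, div_self hEpos.ne', one_div] at h
  refine h.congr fun N => ?_
  have hN : 0 < qPoch x N := qPoch_pos h0.le h1 N
  have hDN : 0 < ∏ i ∈ Finset.range N, (1 + x ^ (i + 1)) := Finset.prod_pos fun i _ => by positivity
  simp only [Pi.div_apply]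
  rw [div_eq_iff (mul_pos hN hDN).ne']
  clear hN hDN
  induction N with
  | zero => simp [qPoch]
  | succ N ih =>
    rw [show 2 * (N + 1) = 2 * N + 1 + 1 by ring, qPoch_succ, qPoch_succ, ih, qPoch_succ,
      Finset.prod_range_succ, Finset.prod_range_succ]
    ring

/-- `∑_n (-1)^n q^(n²) = ∏_n (1 - q^n) / (1 + q^n)`. -/
lemma theta_four_zero_sub {β : ℝ} (hβ : 0 < β) :
    theta 4 0 β - theta 4 4 β =
      (∏' n : ℕ, (1 - qOpen β ^ (n + 1))) * (∏' n : ℕ, (1 + qOpen β ^ (n + 1)))⁻¹ := by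
  have hq0 := qOpen_pos β
  have hq1 := qOpen_lt_one hβ
  -- At `z = -1` the odd factor occurs squared: one copy completes the full product `∏ (1 - q^i)`,
  -- and Euler's identity evaluates the other.
  have h := tendsto_triple_evenKernel (show 0 < 2 * β by positivity) 0 (-1)
    (q := qOpen β) (z := 1) (by rw [qOpen]; ring_nf) (by simp)
  have hE2 : Tendsto (fun N => qPoch (qOpen β) (2 * N)) atTop
      (𝓝 (∏' n : ℕ, (1 - qOpen β ^ (n + 1)))) :=
    (tendsto_qPoch hq0.le hq1).comp (tendsto_id.const_mul_atTop' (show 0 < 2 by norm_num))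
  rw [tendsto_nhds_unique ((hE2.mul (tendsto_prod_odd hq0 hq1)).congr fun N => ?_) h,
    theta_eq (by norm_num) _ hβ, theta_eq (by norm_num) _ hβ]
  · norm_num [sub_eq_add_neg, ← mul_assoc]
  · induction N with
    | zero => simp [qPoch]
    | succ N ih =>
      rw [Finset.prod_range_succ _ N, Finset.prod_range_succ _ N, ← ih,
        show 2 * (N + 1) = 2 * N + 1 + 1 by ring, qPoch_succ, qPoch_succ]
      simp only [Units.val_neg, Units.val_one, Int.cast_neg, Int.cast_one, inv_one]
      ring

lemma tendsto_prod_half_odd {y : ℝ} (h0 : 0 < y) (h1 : y < 1) (ε : ℤˣ) :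
    Tendsto (fun N => ∏ i ∈ Finset.range N, (1 - (ε : ℤ) * y ^ (2 * i + 1))) atTop
      (𝓝 (∏' n : ℕ, (1 - (ε : ℤ) * y ^ (2 * n + 1)))) := by
  have h := (multipliable_one_add_mul_pow h0.le h1 (-(ε : ℤ)) two_pos 1).hasProd.tendsto_prod_nat
  simpa only [neg_mul, ← sub_eq_add_neg] using h

lemma tprod_half_odd_ne_zero {y : ℝ} (h0 : 0 < y) (h1 : y < 1) (ε : ℤˣ) :
    ∏' n : ℕ, (1 - (ε : ℤ) * y ^ (2 * n + 1)) ≠ 0 := by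
  have := tprod_one_add_ne_zero_of_summable (f := fun n : ℕ => -((ε : ℤ) * y ^ (2 * n + 1))) ?_ ?_
  · simpa only [← sub_eq_add_neg] using this
  · intro n h
    have h2 : ((ε : ℤ) : ℝ) * y ^ (2 * n + 1) = 1 := by linarith
    have h3 := congrArg abs h2
    rw [abs_mul, unit_abs, one_mul, abs_of_pos (pow_pos h0 _), abs_one] at h3
    exact (pow_lt_one₀ h0.le h1 (by omega)).ne h3
  · simp only [norm_neg, norm_mul, Real.norm_eq_abs, unit_abs, one_mul, abs_pow, abs_of_pos h0]
    refine ((summable_geometric_of_lt_one (sq_nonneg y)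
      (pow_lt_one₀ h0.le h1 two_ne_zero)).mul_left y).congr fun n => ?_
    rw [← pow_mul, pow_succ']

/-- `∑_n ε^n q^((4n+1)²/16) = q^(1/16) ∏_n (1 - q^n) / (1 - ε q^(n - 1/2))`. -/
lemma theta_four_one_add {β y : ℝ} (hβ : 0 < β) (hy : y = Real.exp (-Real.pi * β)) (ε : ℤˣ) :
    theta 4 1 β + (ε : ℤ) * theta 4 3 β = qOpen β ^ (1 / 16 : ℝ) *
      ((∏' n : ℕ, (1 - qOpen β ^ (n + 1))) * (∏' n : ℕ, (1 - (ε : ℤ) * y ^ (2 * n + 1)))⁻¹) := by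
  have hq0 := qOpen_pos β
  have hq1 := qOpen_lt_one hβ
  have hy0 : 0 < y := hy ▸ Real.exp_pos _
  have hyq : qOpen β = y ^ 2 := by
    rw [hy, ← Real.exp_nat_mul, qOpen]; push_cast; ring_nf
  have hy1 : y < 1 := by
    rw [hy, Real.exp_lt_one_iff]
    have := mul_pos Real.pi_pos hβ
    linarith
  -- With `z = εy` and `q = y²` the last two factors have the exponents `4i + 3` and `4i + 1` of
  -- `y`. Together they form `∏ (1 + ε y^(2i+1))` over `i < 2N`, which is `∏ (1 - q^(2i+1)) / ∏ (1 -
  -- ε y^(2i+1))`.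
  have h := tendsto_triple_evenKernel (show 0 < 2 * β by positivity) (1 / 4) ε
    (q := qOpen β) (z := y) (by rw [qOpen]; ring_nf) (by rw [hy]; ring_nf)
  have h2 : Tendsto (fun N : ℕ => 2 * N) atTop atTop :=
    tendsto_id.const_mul_atTop' (show 0 < 2 by norm_num)
  have hE2 := (tendsto_qPoch hq0.le hq1).comp h2
  have hB := tendsto_prod_odd hq0 hq1
  have hC := (tendsto_prod_half_odd hy0 hy1 ε).comp h2
  have hBpos := inv_pos.mpr (tprod_one_add_pos hq0.le hq1)
  -- The odd factor already present in `qPoch` runs over `i < N` and the new one over `i < 2N`;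
  -- their quotient tends to `1`.
  have key := (hE2.mul (((hB.comp h2).div hB hBpos.ne').div hC
    (tprod_half_odd_ne_zero hy0 hy1 ε)))
  rw [div_self hBpos.ne', one_div] at key
  rw [tendsto_nhds_unique (key.congr fun N => ?_) h, theta_eq (by norm_num) _ hβ,
    theta_eq (by norm_num) _ hβ]
  -- The second kernel sits at `(1/4 + 1)/2 = 5/8`, equivalent to `3/8` by reflection and period.
  · have h5 : evenKernel (((1 / 4 + 1) / 2 : ℝ)) (4 * (2 * β)) =
        evenKernel ((((3 : ℤ) : ℝ) / (2 * (4 : ℕ)) : ℝ)) (2 * (4 : ℕ) * β) := by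
      rw [← HurwitzZeta.evenKernel_neg, show ((1 / 4 + 1) / 2 : ℝ) = -(3 / 8) + 1 by norm_num,
        AddCircle.coe_add, AddCircle.coe_period, add_zero, AddCircle.coe_neg, neg_neg]
      norm_num [← mul_assoc]
    rw [h5, qOpen_rpow, ← mul_assoc, ← Real.exp_add]
    norm_num [← mul_assoc]
    ring_nf
    simp
  · have b0 : ∀ M, ∏ i ∈ Finset.range M, (1 - qOpen β ^ (2 * i + 1)) =
        (∏ i ∈ Finset.range M, (1 - (ε : ℤ) * y ^ (2 * i + 1))) *
        ∏ i ∈ Finset.range M, (1 + (ε : ℤ) * y ^ (2 * i + 1)) := fun M => by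
      rw [← Finset.prod_mul_distrib]
      refine Finset.prod_congr rfl fun i _ => ?_
      rw [hyq]
      linear_combination (y ^ (2 * i + 1)) ^ 2 * unit_mul_self ε
    have b1 : qPoch (qOpen β) (2 * N) = (∏ i ∈ Finset.range N, (1 - qOpen β ^ (2 * (i + 1)))) *
        ∏ i ∈ Finset.range N, (1 - qOpen β ^ (2 * i + 1)) := by
      induction N with
      | zero => simp [qPoch]
      | succ N ih =>
        rw [Finset.prod_range_succ _ N, Finset.prod_range_succ _ N,
          show 2 * (N + 1) = 2 * N + 1 + 1 by ring, qPoch_succ, qPoch_succ, ih]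
        ring
    have b2 : ∏ i ∈ Finset.range (2 * N), (1 + (ε : ℤ) * y ^ (2 * i + 1)) =
        ∏ i ∈ Finset.range N, ((1 + (ε : ℤ) * y * qOpen β ^ (2 * i + 1)) *
          (1 + (ε : ℤ) * y⁻¹ * qOpen β ^ (2 * i + 1))) := by
      clear b1
      induction N with
      | zero => simp
      | succ N ih =>
        rw [Finset.prod_range_succ _ N, show 2 * (N + 1) = 2 * N + 1 + 1 by ring,
          Finset.prod_range_succ, Finset.prod_range_succ, ih, hyq]
        field_simp
        ring
    have p1 : ∏ i ∈ Finset.range N, (1 - qOpen β ^ (2 * i + 1)) ≠ 0 :=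
      (Finset.prod_pos fun i _ => sub_pos.mpr (pow_lt_one₀ hq0.le hq1 (by omega))).ne'
    have p2 : ∏ i ∈ Finset.range (2 * N), (1 - (ε : ℤ) * y ^ (2 * i + 1)) ≠ 0 := by
      have : ∏ i ∈ Finset.range (2 * N), (1 - qOpen β ^ (2 * i + 1)) ≠ 0 :=
        (Finset.prod_pos fun i _ => sub_pos.mpr (pow_lt_one₀ hq0.le hq1 (by omega))).ne'
      rw [b0] at this
      exact left_ne_zero_of_mul this
    simp only [Function.comp, Pi.div_apply]
    rw [Finset.prod_mul_distrib, ← b2, b1, b0 (2 * N)]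
    field_simp

/-! ## Characters -/

lemma circleChar_eq (k : ℕ) (s : ℤ) (β : ℝ) :
    circleChar k s (qOpen β) = theta k s β / eta (qOpen β) := tsum_div_const

lemma chiC_eq {β : ℝ} (hβ : 0 < β) :
    chiC (qOpen β) = (theta 4 0 β - theta 4 4 β) / eta (qOpen β) := by
  rw [chiC, tsum_div_const]
  congr 1
  refine HasSum.tsum_eq ?_
  have : theta 4 0 β - theta 4 4 β = ∑ i ∈ Finset.range 2, (-1) ^ i * theta 4 (4 * i) β := by
    simp [Finset.sum_range_succ, sub_eq_add_neg]
  rw [this]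
  refine hasSum_int_of_residues two_pos fun i hi => ?_
  rw [theta_eq (by norm_num) _ hβ]
  refine hasSum_congr' ((hasSum_theta (by norm_num) (4 * i) hβ).mul_left _) (fun n => ?_) rfl
  congr 1
  · rw [zpow_add, zpow_mul]
    interval_cases i <;> simp
  · congr 1
    push_cast
    ring

/-- The twisted characters are circle characters at `k = 4`, whatever the radius, so their modular
transformation is that of level 4. -/
lemma twChar_eq (e : ℤˣ) {β : ℝ} :
    twChar e (qOpen β) = if e = 1 then circleChar 4 1 (qOpen β) else circleChar 4 3 (qOpen β) := by
  rw [twChar, circleChar, circleChar]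
  norm_num

/-- The oscillator partition function of the untwisted sector. -/
lemma tprod_omU {β : ℝ} (hβ : 0 < β) :
    (∏' n : ℕ, (1 - qOpen β ^ omU n))⁻¹ = qOpen β ^ (1 / 24 : ℝ) / eta (qOpen β) := by
  have e : ∀ n : ℕ, qOpen β ^ omU n = qOpen β ^ (n + 1) := fun n => by
    rw [← Real.rpow_natCast, omU]; push_cast; rfl
  have := Real.rpow_pos_of_pos (qOpen_pos β) (1 / 24 : ℝ)
  have h2 := tprod_one_sub_pos (qOpen_pos β).le (qOpen_lt_one hβ)
  simp only [e, eta]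
  field_simp

lemma tprod_omU_neg {β : ℝ} (hβ : 0 < β) :
    (∏' n : ℕ, (1 + qOpen β ^ omU n))⁻¹ = qOpen β ^ (1 / 24 : ℝ) * chiC (qOpen β) := by
  have e : ∀ n : ℕ, qOpen β ^ omU n = qOpen β ^ (n + 1) := fun n => by
    rw [← Real.rpow_natCast, omU]; push_cast; rfl
  have := Real.rpow_pos_of_pos (qOpen_pos β) (1 / 24 : ℝ)
  have h2 := tprod_one_sub_pos (qOpen_pos β).le (qOpen_lt_one hβ)
  rw [chiC_eq hβ, theta_four_zero_sub hβ]
  simp only [e, eta]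
  field_simp

/-- The oscillator partition function of the twisted sector. -/
lemma tprod_omT {β : ℝ} (hβ : 0 < β) (ε : ℤˣ) :
    (∏' n : ℕ, (1 - (ε : ℤ) * qOpen β ^ omT n))⁻¹ = qOpen β ^ (-1 / 48 : ℝ) *
      (twChar 1 (qOpen β) + (ε : ℤ) * twChar (-1) (qOpen β)) := by
  have e : ∀ n : ℕ, qOpen β ^ omT n = Real.exp (-Real.pi * β) ^ (2 * n + 1) := fun n => by
    rw [← Real.rpow_natCast, omT, qOpen_rpow, ← Real.exp_mul]; push_cast; ring_nf
  have h1 := Real.rpow_pos_of_pos (qOpen_pos β) (1 / 24 : ℝ)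
  have h2 := tprod_one_sub_pos (qOpen_pos β).le (qOpen_lt_one hβ)
  have h3 := theta_four_one_add hβ rfl ε
  have h4 : qOpen β ^ (1 / 16 : ℝ) = qOpen β ^ (1 / 24 : ℝ) * qOpen β ^ (1 / 48 : ℝ) := by
    rw [← Real.rpow_add (qOpen_pos β)]; norm_num
  have h5 : qOpen β ^ (-1 / 48 : ℝ) = (qOpen β ^ (1 / 48 : ℝ))⁻¹ := by
    rw [← Real.rpow_neg (qOpen_pos β).le]; norm_num
  have h6 := Real.rpow_pos_of_pos (qOpen_pos β) (1 / 48 : ℝ)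
  rw [twChar_eq, twChar_eq, if_pos rfl, if_neg (by decide), circleChar_eq, circleChar_eq,
    mul_div_assoc', ← add_div, h3, h4, h5]
  simp only [e, eta]
  field_simp

end OrbifoldBoundary

namespace OrbifoldBoundary

/-! ## Sums over occupation numbers -/

open Filter Topology

/-! ## Sums over occupation numbers -/

/-- Occupation numbers as the first occupation number and the others. -/
noncomputable def occEquiv : ℕ × Occ ≃ Occ where
  toFun p := Finsupp.single 0 p.1 + p.2.mapDomain Nat.succ
  invFun K := (K 0, K.comapDomain Nat.succ Nat.succ_injective.injOn)
  left_inv p := by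
    have h0 : (0 : ℕ) ∉ Set.range Nat.succ := by simp
    refine Prod.ext ?_ (Finsupp.ext fun j => ?_)
    · simp [Finsupp.mapDomain_of_notMem_range _ _ h0]
    · simp [Finsupp.mapDomain_apply Nat.succ_injective]
  right_inv K := by
    have h0 : (0 : ℕ) ∉ Set.range Nat.succ := by simp
    refine Finsupp.ext fun j => ?_
    cases j with
    | zero => simp [Finsupp.mapDomain_of_notMem_range _ _ h0]
    | succ j => simp [← Nat.succ_eq_add_one, Finsupp.mapDomain_apply Nat.succ_injective]

lemma occEquiv_succ (c : ℕ) (K : Occ) (j : ℕ) : occEquiv (c, K) (j + 1) = K j :=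
  DFunLike.congr_fun (congrArg Prod.snd (occEquiv.left_inv (c, K))) j

/-- The monomial `∏_j y_j^(K_j)`. -/
noncomputable def occProd (y : ℕ → ℝ) (K : Occ) : ℝ := K.prod fun j c => y j ^ c

lemma occProd_occEquiv (y : ℕ → ℝ) (c : ℕ) (K : Occ) :
    occProd y (occEquiv (c, K)) = y 0 ^ c * occProd (fun j => y (j + 1)) K := by
  change (Finsupp.single 0 c + K.mapDomain Nat.succ).prod _ = _
  rw [Finsupp.prod_add_index' (by simp) (fun _ _ _ => pow_add _ _ _),
    Finsupp.prod_single_index (by simp), Finsupp.prod_mapDomain_index_inj Nat.succ_injective]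
  rfl

lemma abs_occProd (y : ℕ → ℝ) (K : Occ) : |occProd y K| = occProd (fun j => |y j|) K := by
  simp [occProd, Finsupp.prod, Finset.abs_prod]

open Classical in
/-- The monomial, restricted to the first `N` oscillators. -/
noncomputable def occTrunc (N : ℕ) (y : ℕ → ℝ) (K : Occ) : ℝ :=
  if ∀ j, N ≤ j → K j = 0 then occProd y K else 0

open Classical in
-- Induction that splits off the first oscillator by `occEquiv`: it contributes a geometric series,
-- and the others form the same sum for the shifted sequence.
lemma hasSum_occTrunc (N : ℕ) (y : ℕ → ℝ) (hy : ∀ j, |y j| < 1) :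
    HasSum (occTrunc N y) (∏ j ∈ Finset.range N, (1 - y j))⁻¹ := by
  induction N generalizing y with
  | zero =>
    have : ∀ K : Occ, K ≠ 0 → occTrunc 0 y K = 0 := by
      intro K hK
      refine if_neg fun h => hK (Finsupp.ext fun j => h j (Nat.zero_le j))
    refine hasSum_congr' (hasSum_single (0 : Occ) this) (fun _ => rfl) ?_
    simp [occTrunc, occProd]
  | succ N ih =>
    have h1 := hasSum_geometric_of_abs_lt_one (hy 0)
    have h2 := ih (fun j => y (j + 1)) (fun j => hy (j + 1))
    have h3 := h1.mul h2 (summable_mul_of_summable_norm h1.summable.norm h2.summable.norm)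
    refine (occEquiv.hasSum_iff).mp (hasSum_congr' h3 (fun p => ?_) ?_)
    · obtain ⟨c, K⟩ := p
      simp only [Function.comp, occTrunc, mul_ite, mul_zero]
      have : (∀ j, N + 1 ≤ j → occEquiv (c, K) j = 0) ↔ ∀ j, N ≤ j → K j = 0 := by
        constructor
        · intro h j hj
          rw [← occEquiv_succ c K]
          exact h _ (by omega)
        · rintro h (_ | j) hj
          · omega
          · rw [occEquiv_succ]
            exact h j (by omega)
      rw [occProd_occEquiv]
      exact if_congr this rfl rfl
    · rw [Finset.prod_range_succ', mul_inv_rev]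

lemma exists_occTrunc_eq (y : ℕ → ℝ) (K : Occ) : ∃ N, ∀ M, N ≤ M → occTrunc M y K = occProd y K := by
  refine ⟨K.support.sup id + 1, fun M hM => if_pos fun j hj => ?_⟩
  by_contra h
  have := Finset.le_sup (f := id) (Finsupp.mem_support_iff.mpr h)
  simp only [id] at this
  omega

lemma tprod_one_sub_pos_of_summable {y : ℕ → ℝ} (h0 : ∀ j, 0 ≤ y j) (h1 : ∀ j, y j < 1)
    (hs : Summable y) : 0 < ∏' j, (1 - y j) ∧
      ∀ N, ∏' j, (1 - y j) ≤ ∏ j ∈ Finset.range N, (1 - y j) := by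
  have hm : Multipliable fun j => 1 - y j := by
    have := multipliable_one_add_of_summable (f := fun j => -y j)
      (by simpa only [norm_neg] using hs.norm)
    simpa only [← sub_eq_add_neg] using this
  have ht := hm.hasProd.tendsto_prod_nat
  have hpos : ∀ N, 0 < ∏ j ∈ Finset.range N, (1 - y j) := fun N =>
    Finset.prod_pos fun i _ => sub_pos.mpr (h1 i)
  have hanti : Antitone fun N => ∏ j ∈ Finset.range N, (1 - y j) := by
    refine antitone_nat_of_succ_le fun N => ?_
    rw [Finset.prod_range_succ]
    exact mul_le_of_le_one_right (hpos N).le (by linarith [h0 N])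
  refine ⟨lt_of_le_of_ne (ge_of_tendsto' ht fun n => (hpos n).le) (Ne.symm ?_),
    hanti.le_of_tendsto ht⟩
  have := tprod_one_add_ne_zero_of_summable (f := fun j => -y j)
    (fun j => by rw [← sub_eq_add_neg]; exact (sub_pos.mpr (h1 j)).ne')
    (by simpa only [norm_neg] using hs.norm)
  simpa only [← sub_eq_add_neg] using this

/-- A finite set of occupation numbers involves finitely many oscillators, so its sum is at most a
truncated product, and these are bounded by the inverse infinite product. -/
lemma summable_abs_occProd {y : ℕ → ℝ} (hy : ∀ j, |y j| < 1) (hs : Summable y) :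
    Summable fun K => |occProd y K| := by
  obtain ⟨hpos, hle⟩ := tprod_one_sub_pos_of_summable (fun j => abs_nonneg (y j)) hy hs.abs
  refine summable_of_sum_le (c := (∏' j, (1 - |y j|))⁻¹) (fun _ => abs_nonneg _) fun F => ?_
  choose n hn using exists_occTrunc_eq (fun j => |y j|)
  have h := hasSum_occTrunc (F.sup n) (fun j => |y j|) (by simpa using hy)
  have hnn : ∀ K : Occ, 0 ≤ occTrunc (F.sup n) (fun j => |y j|) K := fun K => by
    unfold occTrunc
    split_ifs
    · exact Finset.prod_nonneg fun _ _ => pow_nonneg (abs_nonneg _) _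
    · rfl
  calc ∑ K ∈ F, |occProd y K| = ∑ K ∈ F, occTrunc (F.sup n) (fun j => |y j|) K :=
        Finset.sum_congr rfl fun K hK => by
          rw [abs_occProd, hn K _ (Finset.le_sup hK)]
    _ ≤ _ := sum_le_hasSum F (fun K _ => hnn K) h
    _ ≤ _ := inv_anti₀ hpos (hle _)

/-- The generating function of the occupation numbers. -/
lemma hasSum_occProd {y : ℕ → ℝ} (hy : ∀ j, |y j| < 1) (hs : Summable y) :
    HasSum (occProd y) (∏' j, (1 - y j))⁻¹ := by
  have hsum := summable_abs_occProd hy hs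
  have hm : Multipliable fun j => 1 - y j := by
    have := multipliable_one_add_of_summable (f := fun j => -y j)
      (by simpa only [norm_neg] using hs.norm)
    simpa only [← sub_eq_add_neg] using this
  have hne : ∏' j, (1 - y j) ≠ 0 := by
    have := tprod_one_add_ne_zero_of_summable (f := fun j => -y j)
      (fun j => by
        rw [← sub_eq_add_neg, sub_ne_zero]
        intro h
        have := hy j
        rw [← h, abs_one] at this
        exact lt_irrefl _ this)
      (by simpa only [norm_neg] using hs.norm)
    simpa only [← sub_eq_add_neg] using this
  -- Dominated convergence in the number of oscillators: each `K` is eventually inside the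
  -- truncation.
  have h1 : Tendsto (fun N => ∑' K, occTrunc N y K) atTop (𝓝 (∑' K, occProd y K)) := by
    refine tendsto_tsum_of_dominated_convergence hsum (fun K => ?_)
      (Eventually.of_forall fun N K => ?_)
    · obtain ⟨N, hN⟩ := exists_occTrunc_eq y K
      exact tendsto_const_nhds.congr' (eventually_atTop.mpr ⟨N, fun M hM => (hN M hM).symm⟩)
    · unfold occTrunc
      split_ifs
      · exact le_rfl
      · simp
  have h2 := (hm.hasProd.tendsto_prod_nat.inv₀ hne).congr fun N =>
    (hasSum_occTrunc N y hy).tsum_eq.symm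
  rw [tendsto_nhds_unique h2 h1]
  exact hsum.of_abs.hasSum

end OrbifoldBoundary

namespace OrbifoldBoundary

/-! ## Glued states and their amplitudes -/

open Filter Topology

/-! ## Glued states and their amplitudes -/

lemma hasSum_mul_real {ι κ : Type*} {f : ι → ℝ} {g : κ → ℝ} {a b : ℝ} (hf : HasSum f a)
    (hg : HasSum g b) : HasSum (fun x : ι × κ => f x.1 * g x.2) (a * b) :=
  hf.mul hg (summable_mul_of_summable_norm hf.summable.norm hg.summable.norm)

/-- The coefficients of `exp(ε ∑ α_{-ω} \bar α_{-ω} / ω)` on a ground state. -/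
noncomputable def glueCoeff (ε : ℤˣ) (K L : Occ) : ℝ :=
  if K = L then ((ε : ℤ) : ℝ) ^ occCount K else 0

/-- The norms of the left and right basis vectors cancel `1/ω` and the factorial, so each pair of
quanta contributes just the sign, whatever the energies. -/
lemma expCoeff_eq {om : ℕ → ℝ} (hom : ∀ j, om j ≠ 0) (ε : ℤˣ) (K L : Occ) :
    expCoeff om ((ε : ℤ) : ℂ) K L = glueCoeff ε K L := by
  unfold expCoeff glueCoeff
  split_ifs
  · rw [occCount, Finsupp.prod, Finsupp.sum, ← Finset.prod_pow_eq_pow_sum]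
    push_cast
    refine Finset.prod_congr rfl fun j _ => ?_
    have h1 : (om j : ℂ) ≠ 0 := by exact_mod_cast hom j
    have h2 : ((K j).factorial : ℂ) ≠ 0 := by exact_mod_cast (K j).factorial_ne_zero
    field_simp
    rw [← mul_pow, div_mul_cancel₀ _ h1]
  · simp

lemma omU_pos (j : ℕ) : 0 < omU j := by unfold omU; positivity

lemma omT_pos (j : ℕ) : 0 < omT j := by unfold omT; positivity

/-- The state that is glued by `exp(ε ∑ α_{-ω} \bar α_{-ω} / ω)`, with given ground-state
components. -/
noncomputable def glued (ε : ℤˣ) (c : ℤ → ℤ → ℝ) (t : Bool → ℝ) : State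
  | .inl (m, w, K, L) => ((c m w * glueCoeff ε K L : ℝ) : ℂ)
  | .inr (b, K, L) => ((t b * glueCoeff ε K L : ℝ) : ℂ)

lemma rpow_occ_sum {q : ℝ} (hq : 0 < q) (om : ℕ → ℝ) (ε ε' : ℤˣ) (K : Occ) :
    glueCoeff ε K K * glueCoeff ε' K K * q ^ (K.sum fun j c => om j * c) =
      occProd (fun j => ((ε * ε' : ℤˣ) : ℤ) * q ^ om j) K := by
  rw [glueCoeff, glueCoeff, if_pos rfl, if_pos rfl, ← mul_pow, occCount, Finsupp.sum, Finsupp.sum,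
    Real.rpow_sum_of_pos hq, ← Finset.prod_pow_eq_pow_sum, ← Finset.prod_mul_distrib]
  refine Finset.prod_congr rfl fun j _ => ?_
  rw [mul_pow, Real.rpow_mul hq.le, Real.rpow_natCast]
  push_cast
  ring

lemma hasSum_oscillators {q : ℝ} (h0 : 0 < q) (h1 : q < 1) (a : ℝ) (ha : 0 < a) (ε ε' : ℤˣ) :
    HasSum (fun K : Occ => glueCoeff ε K K * glueCoeff ε' K K *
      q ^ (K.sum fun j c => ((j : ℝ) + a) * c))
      (∏' n : ℕ, (1 - ((ε * ε' : ℤˣ) : ℤ) * q ^ ((n : ℝ) + a)))⁻¹ := by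
  refine hasSum_congr' (hasSum_occProd (fun j => ?_) ?_)
    (fun K => rpow_occ_sum h0 (fun j => (j : ℝ) + a) ε ε' K) rfl
  · rw [abs_mul, unit_abs, one_mul, abs_of_pos (Real.rpow_pos_of_pos h0 _)]
    exact Real.rpow_lt_one h0.le h1 (by positivity)
  · have : Summable fun n : ℕ => q ^ ((n : ℝ) + a) := by
      refine ((summable_geometric_of_lt_one h0.le h1).mul_right (q ^ a)).congr fun n => ?_
      rw [Real.rpow_add h0, Real.rpow_natCast]
    exact this.mul_left _

/-- Only `K = L` contributes, and there the oscillator energy counts twice and is halved. The sum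
factorizes into ground states and oscillators; the exponents left over are `-1/24` in the untwisted
and `(1/8 - 1/12)/2 = 1/48` in the twisted sector. -/
lemma hasSum_cylTerm_glued (k : ℕ) {β : ℝ} (hβ : 0 < β) (ε ε' : ℤˣ) (c c' : ℤ → ℤ → ℝ)
    (t t' : Bool → ℝ) {S : ℝ}
    (hS : HasSum (fun x : ℤ × ℤ => c x.1 x.2 * c' x.1 x.2 *
      qClosed β ^ ((pL k x.1 x.2 ^ 2 + pR k x.1 x.2 ^ 2) / 4)) S) :
    HasSum (cylTerm k β (glued ε c t) (glued ε' c' t'))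
      ((S * (qClosed β ^ (-1 / 24 : ℝ) *
          (∏' n : ℕ, (1 - ((ε * ε' : ℤˣ) : ℤ) * qClosed β ^ omU n))⁻¹) +
        (∑ b, t b * t' b) * (qClosed β ^ (1 / 48 : ℝ) *
          (∏' n : ℕ, (1 - ((ε * ε' : ℤˣ) : ℤ) * qClosed β ^ omT n))⁻¹) : ℝ) : ℂ) := by
  have h0 : 0 < qClosed β := Real.exp_pos _
  have h1 : qClosed β < 1 := by
    rw [qClosed_eq]; exact qOpen_lt_one (one_div_pos.mpr hβ)
  rw [Complex.ofReal_add]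
  refine HasSum.sum ?_ ?_
  · have hU := (hasSum_oscillators h0 h1 1 one_pos ε ε').mul_left (qClosed β ^ (-1 / 24 : ℝ))
    have hp := hasSum_mul_real hS hU
    have hinj : Function.Injective fun x : (ℤ × ℤ) × Occ =>
        ((x.1.1, x.1.2, x.2, x.2) : ℤ × ℤ × Occ × Occ) := by
      rintro ⟨⟨m, w⟩, K⟩ ⟨⟨m', w'⟩, K'⟩ h
      simp only [Prod.mk.injEq] at h
      obtain ⟨rfl, rfl, rfl, -⟩ := h
      rfl
    refine (hinj.hasSum_iff ?_).mp (hasSum_congr' (Complex.hasSum_ofReal.mpr hp) ?_ rfl)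
    · rintro ⟨m, w, K, L⟩ hx
      have hKL : K ≠ L := by rintro rfl; exact hx ⟨((m, w), K), rfl⟩
      simp [cylTerm, glued, glueCoeff, hKL]
    · rintro ⟨⟨m, w⟩, K⟩
      simp only [Function.comp, cylTerm, glued, Complex.conj_ofReal, weight]
      rw [← Complex.ofReal_mul, ← Complex.ofReal_mul]
      congr 1
      rw [show (pL k m w ^ 2 / 2 + (K.sum fun j c => omU j * c) +
        (pR k m w ^ 2 / 2 + K.sum fun j c => omU j * c) - 1 / 12) / 2 =
        (pL k m w ^ 2 + pR k m w ^ 2) / 4 + (-1 / 24) + K.sum fun j c => omU j * (c : ℝ) by ring,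
        Real.rpow_add h0, Real.rpow_add h0]
      simp only [omU]
      ring
  · have hT := (hasSum_oscillators h0 h1 (1 / 2) (by norm_num) ε ε').mul_left
      (qClosed β ^ (1 / 48 : ℝ))
    have hb : HasSum (fun b : Bool => t b * t' b) (∑ b, t b * t' b) := hasSum_fintype _
    have hp := hasSum_mul_real hb hT
    have hinj : Function.Injective fun x : Bool × Occ => ((x.1, x.2, x.2) : Bool × Occ × Occ) := by
      rintro ⟨b, K⟩ ⟨b', K'⟩ h
      simp only [Prod.mk.injEq] at h
      obtain ⟨rfl, rfl, -⟩ := h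
      rfl
    refine (hinj.hasSum_iff ?_).mp (hasSum_congr' (Complex.hasSum_ofReal.mpr hp) ?_ rfl)
    · rintro ⟨b, K, L⟩ hx
      have hKL : K ≠ L := by rintro rfl; exact hx ⟨(b, K), rfl⟩
      simp [cylTerm, glued, glueCoeff, hKL]
    · rintro ⟨b, K⟩
      simp only [Function.comp, cylTerm, glued, Complex.conj_ofReal, weight]
      rw [← Complex.ofReal_mul, ← Complex.ofReal_mul]
      congr 1
      rw [show (1 / 16 + (K.sum fun j c => omT j * c) +
        (1 / 16 + K.sum fun j c => omT j * c) - 1 / 12) / 2 =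
        1 / 48 + K.sum fun j c => omT j * (c : ℝ) by ring, Real.rpow_add h0]
      simp only [omT]
      ring

/-- The amplitude of two states with the same gluing condition. -/
lemma hasSum_cylTerm_glued_same (k : ℕ) {β : ℝ} (hβ : 0 < β) (ε : ℤˣ) (c c' : ℤ → ℤ → ℝ)
    (t t' : Bool → ℝ) {S : ℝ}
    (hS : HasSum (fun x : ℤ × ℤ => c x.1 x.2 * c' x.1 x.2 *
      qClosed β ^ ((pL k x.1 x.2 ^ 2 + pR k x.1 x.2 ^ 2) / 4)) S) :
    HasSum (cylTerm k β (glued ε c t) (glued ε c' t'))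
      ((S / eta (qClosed β) + (∑ b, t b * t' b) *
        (twChar 1 (qClosed β) + twChar (-1) (qClosed β)) : ℝ) : ℂ) := by
  have h := hasSum_cylTerm_glued k hβ ε ε c c' t t' hS
  have hβ' := one_div_pos.mpr hβ
  have e1 := tprod_omU hβ'
  have e2 := tprod_omT hβ' 1
  have h0 : 0 < qOpen (1 / β) := qOpen_pos _
  simp only [← qClosed_eq, Units.val_one, Int.cast_one, one_mul] at e1 e2 h0
  have p1 : qClosed β ^ (-1 / 24 : ℝ) * qClosed β ^ (1 / 24 : ℝ) = 1 := by
    rw [← Real.rpow_add h0]; norm_num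
  have p2 : qClosed β ^ (1 / 48 : ℝ) * qClosed β ^ (-1 / 48 : ℝ) = 1 := by
    rw [← Real.rpow_add h0]; norm_num
  simp only [Int.units_mul_self, Units.val_one, Int.cast_one, one_mul] at h
  rwa [e1, e2, ← mul_assoc (qClosed β ^ (1 / 48 : ℝ)), p2, one_mul, mul_div_assoc', p1,
    mul_one_div] at h

/-- The amplitude of two states with opposite gluing conditions. -/
lemma hasSum_cylTerm_glued_opposite (k : ℕ) {β : ℝ} (hβ : 0 < β) {ε ε' : ℤˣ} (hε : ε * ε' = -1)
    (c c' : ℤ → ℤ → ℝ) (t t' : Bool → ℝ) {S : ℝ}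
    (hS : HasSum (fun x : ℤ × ℤ => c x.1 x.2 * c' x.1 x.2 *
      qClosed β ^ ((pL k x.1 x.2 ^ 2 + pR k x.1 x.2 ^ 2) / 4)) S) :
    HasSum (cylTerm k β (glued ε c t) (glued ε' c' t'))
      ((S * chiC (qClosed β) + (∑ b, t b * t' b) *
        (twChar 1 (qClosed β) - twChar (-1) (qClosed β)) : ℝ) : ℂ) := by
  have h := hasSum_cylTerm_glued k hβ ε ε' c c' t t' hS
  have hβ' := one_div_pos.mpr hβ
  have e1 := tprod_omU_neg hβ'
  have e2 := tprod_omT hβ' (-1)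
  have h0 : 0 < qOpen (1 / β) := qOpen_pos _
  simp only [← qClosed_eq, Units.val_neg, Units.val_one, Int.cast_neg, Int.cast_one, neg_mul,
    one_mul, sub_neg_eq_add, ← sub_eq_add_neg] at e1 e2 h0
  have p1 : qClosed β ^ (-1 / 24 : ℝ) * qClosed β ^ (1 / 24 : ℝ) = 1 := by
    rw [← Real.rpow_add h0]; norm_num
  have p2 : qClosed β ^ (1 / 48 : ℝ) * qClosed β ^ (-1 / 48 : ℝ) = 1 := by
    rw [← Real.rpow_add h0]; norm_num
  simp only [hε, Units.val_neg, Units.val_one, Int.cast_neg, Int.cast_one, neg_mul,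
    one_mul, sub_neg_eq_add] at h
  rwa [e1, e2, ← mul_assoc (qClosed β ^ (1 / 48 : ℝ)), p2, one_mul,
    ← mul_assoc (qClosed β ^ (-1 / 24 : ℝ)), p1, one_mul] at h

end OrbifoldBoundary

namespace OrbifoldBoundary

/-! ## The Ishibashi condition -/

/-! ## Gluing conditions -/

lemma glueCoeff_comm (ε : ℤˣ) (K L : Occ) : glueCoeff ε K L = glueCoeff ε L K := by
  unfold glueCoeff
  by_cases h : K = L
  · subst h; rfl
  · rw [if_neg h, if_neg (Ne.symm h)]

lemma occCount_add_single (K : Occ) (j : ℕ) : occCount (K + Finsupp.single j 1) = occCount K + 1 := by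
  unfold occCount
  rw [Finsupp.sum_add_index' (fun _ => rfl) (fun _ _ _ => rfl), Finsupp.sum_single_index rfl]

/-- The gluing condition `α_ω = ε \bar α_{-ω}` in coordinates. Both sides live on `L = K + single j
1`, where the square roots agree and the left side has one more sign. For `L j = 0` the truncated
subtraction is harmless, since its factor vanishes. -/
lemma annih_glueCoeff (om : ℕ → ℝ) (ε : ℤˣ) (j : ℕ) (K L : Occ) :
    √(om j * (K j + 1)) * glueCoeff ε (K + Finsupp.single j 1) L =
      (ε : ℤ) * (√(om j * L j) * glueCoeff ε K (L - Finsupp.single j 1)) := by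
  by_cases hL : L j = 0
  · have : K + Finsupp.single j 1 ≠ L := by
      rintro rfl
      simp at hL
    simp [glueCoeff, this, hL]
  · obtain ⟨M, rfl⟩ : ∃ M, L = M + Finsupp.single j 1 := by
      refine ⟨L - Finsupp.single j 1, Finsupp.ext fun i => ?_⟩
      by_cases hij : j = i
      · subst hij
        simp only [Finsupp.coe_add, Finsupp.coe_tsub, Pi.add_apply, Pi.sub_apply,
          Finsupp.single_eq_same]
        omega
      · simp [Finsupp.single_eq_of_ne' hij]
    rw [add_tsub_cancel_right]
    by_cases h : K = M
    · subst h
      simp only [glueCoeff, if_true, occCount_add_single, pow_succ]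
      push_cast [Finsupp.add_apply, Finsupp.single_eq_same]
      ring
    · have : K + Finsupp.single j 1 ≠ M + Finsupp.single j 1 := fun e => h (add_right_cancel e)
      simp [glueCoeff, this, h]

lemma creat_glueCoeff (om : ℕ → ℝ) (ε : ℤˣ) (j : ℕ) (K L : Occ) :
    √(om j * K j) * glueCoeff ε (K - Finsupp.single j 1) L =
      (ε : ℤ) * (√(om j * (L j + 1)) * glueCoeff ε K (L + Finsupp.single j 1)) := by
  have h := annih_glueCoeff om ε j L K
  rw [glueCoeff_comm ε _ L, glueCoeff_comm ε K, h, ← mul_assoc, unit_mul_self, one_mul]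

/-- Operators that act by a weighted change of the occupation numbers. -/
def IsShift (T : (Occ → ℂ) → Occ → ℂ) : Prop :=
  ∃ (s : Occ → ℂ) (φ : Occ → Occ), ∀ f K, T f K = s K * f (φ K)

lemma modeU_ofNat_succ (p : ℝ) (j : ℕ) (f : Occ → ℂ) :
    modeU p (Int.ofNat (j + 1)) f = annih omU j f := rfl

lemma modeU_negSucc (p : ℝ) (j : ℕ) (f : Occ → ℂ) :
    modeU p (Int.negSucc j) f = creat omU j f := rfl

lemma modeT_ofNat (j : ℕ) (f : Occ → ℂ) : modeT (Int.ofNat j) f = annih omT j f := rfl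

lemma modeT_negSucc (j : ℕ) (f : Occ → ℂ) : modeT (Int.negSucc j) f = creat omT j f := rfl

lemma isShift_modeU (p : ℝ) (a : ℤ) : IsShift (modeU p a) := by
  rcases a with (_ | j) | j
  · exact ⟨fun _ => p, id, fun _ _ => rfl⟩
  · exact ⟨_, _, fun _ _ => rfl⟩
  · exact ⟨_, _, fun _ _ => rfl⟩

lemma isShift_modeT (a : ℤ) : IsShift (modeT a) := by
  rcases a with j | j
  · exact ⟨_, _, fun _ _ => rfl⟩
  · exact ⟨_, _, fun _ _ => rfl⟩

lemma IsShift.comm {S T : (Occ → ℂ) → Occ → ℂ} (hS : IsShift S) (hT : IsShift T)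
    (X : Occ → Occ → ℂ) (K L : Occ) :
    S (fun J => T (X J) L) K = T (fun J' => S (fun J => X J J') K) L := by
  obtain ⟨s, φ, hS⟩ := hS
  obtain ⟨t, ψ, hT⟩ := hT
  simp only [hS, hT]
  ring

lemma IsShift.const_mul {T : (Occ → ℂ) → Occ → ℂ} (hT : IsShift T) (c : ℂ) (f : Occ → ℂ) (K : Occ) :
    T (fun J => c * f J) K = c * T f K := by
  obtain ⟨t, ψ, hT⟩ := hT
  simp only [hT]
  ring

lemma IsShift.add {T : (Occ → ℂ) → Occ → ℂ} (hT : IsShift T) (f g : Occ → ℂ) (K : Occ) :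
    T (fun J => f J + g J) K = T f K + T g K := by
  obtain ⟨t, ψ, hT⟩ := hT
  simp only [hT]
  ring

/-- The gluing condition for single modes implies it for their normal ordered products. -/
lemma normalOrd_glue {mode mode' : ℤ → (Occ → ℂ) → Occ → ℂ} (hm : ∀ a, IsShift (mode a))
    (hm' : ∀ a, IsShift (mode' a)) {τ : ℤ → ℤ} (hτ : ∀ a b, τ a ≤ τ b ↔ b ≤ a) {ε : ℤˣ}
    {X : Occ → Occ → ℂ}
    (h : ∀ a K L, mode a (fun J => X J L) K = ((ε : ℤ) : ℂ) * mode' (τ a) (X K) L) (a b : ℤ)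
    (K L : Occ) :
    normalOrd mode a b (fun J => X J L) K = normalOrd mode' (τ a) (τ b) (X K) L := by
  have hε : ((ε : ℤ) : ℂ) * ((ε : ℤ) : ℂ) = 1 := by exact_mod_cast unit_mul_self ε
  -- Left and right modes act on different variables and commute. Moving two left modes to the right
  -- reverses their order and gives the sign `ε² = 1`; as `τ` reverses the order of the indices,
  -- normal ordering is preserved.
  have key : ∀ a b, mode a (mode b (fun J => X J L)) K = mode' (τ b) (mode' (τ a) (X K)) L := by
    intro a b
    have h1 : mode b (fun J => X J L) = fun J => ((ε : ℤ) : ℂ) * mode' (τ b) (X J) L :=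
      funext fun J => h b J L
    have h2 : (fun J' => mode a (fun J => X J J') K) =
        fun J' => ((ε : ℤ) : ℂ) * mode' (τ a) (X K) J' := funext fun J' => h a K J'
    rw [h1, (hm a).const_mul, (hm a).comm (hm' (τ b)), h2, (hm' (τ b)).const_mul, ← mul_assoc, hε,
      one_mul]
  unfold normalOrd
  rcases lt_trichotomy a b with hab | rfl | hab
  · rw [if_pos hab.le, if_neg (by rw [hτ]; omega), key]
  · rw [if_pos le_rfl, if_pos le_rfl, key]
  · rw [if_neg (by omega), if_pos (by rw [hτ]; omega), key]

/-- The gluing condition for all untwisted modes. The zero mode is the only one that restricts the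
ground states on which `C` may be nonzero. -/
lemma modeU_glue {p p' : ℝ} {ε : ℤˣ} {C : ℝ} (hp : C ≠ 0 → p = (ε : ℤ) * p') (a : ℤ) (K L : Occ) :
    modeU p a (fun J => ((C * glueCoeff ε J L : ℝ) : ℂ)) K =
      ((ε : ℤ) : ℂ) * modeU p' (-a) (fun J => ((C * glueCoeff ε K J : ℝ) : ℂ)) L := by
  rcases a with (_ | j) | j
  · change (p : ℂ) * _ = _ * ((p' : ℂ) * _)
    by_cases hC : C = 0
    · simp [hC]
    · rw [hp hC]
      push_cast
      ring
  · rw [modeU_ofNat_succ, show -(Int.ofNat (j + 1)) = Int.negSucc j from rfl, modeU_negSucc]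
    simp only [annih, creat]
    exact_mod_cast (by linear_combination C * annih_glueCoeff omU ε j K L :
      √(omU j * (K j + 1)) * (C * glueCoeff ε (K + Finsupp.single j 1) L) =
      (ε : ℤ) * (√(omU j * L j) * (C * glueCoeff ε K (L - Finsupp.single j 1))))
  · rw [modeU_negSucc, show -(Int.negSucc j) = Int.ofNat (j + 1) from rfl, modeU_ofNat_succ]
    simp only [annih, creat]
    exact_mod_cast (by linear_combination C * creat_glueCoeff omU ε j K L :
      √(omU j * K j) * (C * glueCoeff ε (K - Finsupp.single j 1) L) =
      (ε : ℤ) * (√(omU j * (L j + 1)) * (C * glueCoeff ε K (L + Finsupp.single j 1))))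

/-- The index `a` stands for the mode `a + 1/2`, so reversing the mode is `a ↦ -a - 1`; there is no
zero mode and hence no condition on the ground state. -/
lemma modeT_glue {ε : ℤˣ} (C : ℝ) (a : ℤ) (K L : Occ) :
    modeT a (fun J => ((C * glueCoeff ε J L : ℝ) : ℂ)) K =
      ((ε : ℤ) : ℂ) * modeT (-a - 1) (fun J => ((C * glueCoeff ε K J : ℝ) : ℂ)) L := by
  rcases a with j | j
  · have : -(Int.ofNat j) - 1 = Int.negSucc j := by simp; omega
    rw [this, modeT_ofNat, modeT_negSucc]
    simp only [annih, creat]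
    exact_mod_cast (by linear_combination C * annih_glueCoeff omT ε j K L :
      √(omT j * (K j + 1)) * (C * glueCoeff ε (K + Finsupp.single j 1) L) =
      (ε : ℤ) * (√(omT j * L j) * (C * glueCoeff ε K (L - Finsupp.single j 1))))
  · have : -(Int.negSucc j) - 1 = Int.ofNat j := by simp
    rw [this, modeT_ofNat, modeT_negSucc]
    simp only [annih, creat]
    exact_mod_cast (by linear_combination C * creat_glueCoeff omT ε j K L :
      √(omT j * K j) * (C * glueCoeff ε (K - Finsupp.single j 1) L) =
      (ε : ℤ) * (√(omT j * (L j + 1)) * (C * glueCoeff ε K (L + Finsupp.single j 1))))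

/-- By `normalOrd_glue` each left term equals a right term with the reflected pair of modes, of
total `-n`. Reflecting the summation index turns the sum for `L_n` into the one for `\bar L_{-n}`;
the constant `1/16` occurs on both sides. -/
lemma isIshibashi_glued {k : ℕ} {ε : ℤˣ} {c : ℤ → ℤ → ℝ}
    (hc : ∀ m w, c m w ≠ 0 → pL k m w = (ε : ℤ) * pR k m w) (t : Bool → ℝ) :
    IsIshibashi k (glued ε c t) := by
  intro n
  rw [sub_eq_zero]
  funext v
  rcases v with ⟨m, w, K, L⟩ | ⟨b, K, L⟩
  · change (1 / 2 : ℂ) * _ = (1 / 2 : ℂ) * _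
    congr 1
    refine Eq.trans (finsum_congr fun i => ?_)
      (finsum_comp_equiv (Equiv.neg ℤ) (f := fun i => normalOrd (modeU (pR k m w)) (-n - i) i
        (fun J => glued ε c t (.inl (m, w, K, J))) L))
    have := normalOrd_glue (isShift_modeU (pL k m w)) (isShift_modeU (pR k m w))
      (τ := fun a => -a) (fun a b => by simp) (ε := ε)
      (X := fun K L => ((c m w * glueCoeff ε K L : ℝ) : ℂ))
      (fun a K L => modeU_glue (hc m w) a K L) (n - i) i K L
    simp only [neg_sub] at this
    change normalOrd (modeU (pL k m w)) (n - i) i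
      (fun J => ((c m w * glueCoeff ε J L : ℝ) : ℂ)) K = _
    rw [this]
    change normalOrd _ _ _ _ L = normalOrd _ (-n - -i) (-i) _ L
    rw [show -n - -i = i - n by ring]
    rfl
  · change (1 / 2 : ℂ) * _ + _ = (1 / 2 : ℂ) * _ + _
    congr 1
    · congr 1
      refine Eq.trans (finsum_congr fun i => ?_)
        (finsum_comp_equiv (Equiv.subLeft (-1 : ℤ)) (f := fun i => normalOrd modeT (-n - i - 1) i
          (fun J => glued ε c t (.inr (b, K, J))) L))
      have := normalOrd_glue isShift_modeT isShift_modeT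
        (τ := fun a => -a - 1) (fun a b => by simp) (ε := ε)
        (X := fun K L => ((t b * glueCoeff ε K L : ℝ) : ℂ))
        (fun a K L => modeT_glue (t b) a K L) (n - i - 1) i K L
      change normalOrd modeT (n - i - 1) i
        (fun J => ((t b * glueCoeff ε J L : ℝ) : ℂ)) K = _
      rw [this]
      change normalOrd _ (-(n - i - 1) - 1) (-i - 1) _ L =
        normalOrd _ (-n - (-1 - i) - 1) (-1 - i) _ L
      rw [show -n - (-1 - i) - 1 = -(n - i - 1) - 1 by ring, show -1 - i = -i - 1 by ring]
      rfl
    · simp only [neg_eq_zero]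

/-! ## Linearity of the Virasoro generators -/

lemma IsShift.normalOrd_add {mode : ℤ → (Occ → ℂ) → Occ → ℂ} (hm : ∀ a, IsShift (mode a)) (a b : ℤ)
    (f g : Occ → ℂ) (K : Occ) :
    normalOrd mode a b (fun J => f J + g J) K = normalOrd mode a b f K + normalOrd mode a b g K := by
  have key : ∀ a b, mode a (mode b (fun J => f J + g J)) K =
      mode a (mode b f) K + mode a (mode b g) K := fun a b => by
    rw [show mode b (fun J => f J + g J) = fun J => mode b f J + mode b g J from
      funext fun J => (hm b).add f g J, (hm a).add]
  unfold normalOrd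
  split_ifs <;> exact key _ _

lemma IsShift.normalOrd_const_mul {mode : ℤ → (Occ → ℂ) → Occ → ℂ} (hm : ∀ a, IsShift (mode a))
    (a b : ℤ) (c : ℂ) (f : Occ → ℂ) (K : Occ) :
    normalOrd mode a b (fun J => c * f J) K = c * normalOrd mode a b f K := by
  have key : ∀ a b, mode a (mode b (fun J => c * f J)) K = c * mode a (mode b f) K := fun a b => by
    rw [show mode b (fun J => c * f J) = fun J => c * mode b f J from
      funext fun J => (hm b).const_mul c f J, (hm a).const_mul]
  unfold normalOrd
  split_ifs <;> exact key _ _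

/-- At a given vector only finitely many normal ordered products of given total mode act
nontrivially. -/
lemma normalOrd_support_finite {mode : ℤ → (Occ → ℂ) → Occ → ℂ} {om : ℕ → ℝ}
    (hmode : ∀ j f, mode (Int.negSucc j) f = creat om j f) (N : ℤ) (f : Occ → ℂ) (K : Occ) :
    (Function.support fun i : ℤ => normalOrd mode (N - i) i f K).Finite := by
  set T : Set ℤ := (fun j : ℕ => Int.negSucc j) '' K.support ∪ Set.Icc 0 (max N 0) with hT
  have hTf : T.Finite := ((Finset.finite_toSet _).image _).union (Set.finite_Icc _ _)
  -- The smaller mode `a` acts last. If it is nonnegative it lies between `0` and `N`; if it is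
  -- negative it creates a quantum `j`, and its coefficient at `K` vanishes unless `K j ≠ 0`.
  have key : ∀ a b, a + b = N → a ≤ b → mode a (mode b f) K ≠ 0 → a ∈ T := by
    intro a b hab hle hne
    rcases a with j | j
    · right
      simp only [Int.ofNat_eq_natCast, Set.mem_Icc] at *
      omega
    · left
      refine ⟨j, ?_, rfl⟩
      rw [Finset.mem_coe, Finsupp.mem_support_iff]
      intro h0
      apply hne
      rw [hmode, creat]
      simp [h0]
  refine (hTf.union (hTf.image fun a => N - a)).subset fun i hi => ?_
  simp only [Function.mem_support, normalOrd] at hi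
  split_ifs at hi with h
  · exact Or.inr ⟨N - i, key _ _ (by ring) h hi, by ring⟩
  · exact Or.inl (key _ _ (by ring) (by omega) hi)

lemma virU_add (p : ℝ) (n : ℤ) (f g : Occ → ℂ) (K : Occ) :
    virU p n (fun J => f J + g J) K = virU p n f K + virU p n g K := by
  unfold virU
  rw [← mul_add, ← finsum_add_distrib (normalOrd_support_finite (fun _ _ => rfl) _ _ _)
    (normalOrd_support_finite (fun _ _ => rfl) _ _ _)]
  simp only [IsShift.normalOrd_add (isShift_modeU p)]

lemma virT_add (n : ℤ) (f g : Occ → ℂ) (K : Occ) :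
    virT n (fun J => f J + g J) K = virT n f K + virT n g K := by
  have h : ∀ f : Occ → ℂ, (Function.support fun i : ℤ => normalOrd modeT (n - i - 1) i f K).Finite :=
    fun f => by
      simpa only [sub_right_comm] using
        normalOrd_support_finite (mode := modeT) (om := omT) (fun _ _ => rfl) (n - 1) f K
  unfold virT
  rw [add_add_add_comm, ← mul_add, ← finsum_add_distrib (h f) (h g)]
  simp only [IsShift.normalOrd_add isShift_modeT]
  congr 1
  split_ifs <;> ring

lemma virU_const_mul (p : ℝ) (n : ℤ) (c : ℂ) (f : Occ → ℂ) (K : Occ) :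
    virU p n (fun J => c * f J) K = c * virU p n f K := by
  unfold virU
  simp only [IsShift.normalOrd_const_mul (isShift_modeU p)]
  rw [← mul_finsum]
  ring

lemma virT_const_mul (n : ℤ) (c : ℂ) (f : Occ → ℂ) (K : Occ) :
    virT n (fun J => c * f J) K = c * virT n f K := by
  unfold virT
  simp only [IsShift.normalOrd_const_mul isShift_modeT]
  rw [← mul_finsum]
  split_ifs <;> ring

lemma IsIshibashi.add {k : ℕ} {x y : State} (hx : IsIshibashi k x) (hy : IsIshibashi k y) :
    IsIshibashi k (x + y) := by
  intro n
  have hx := sub_eq_zero.mp (hx n)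
  have hy := sub_eq_zero.mp (hy n)
  rw [sub_eq_zero]
  funext v
  have h := congrArg₂ (· + ·) (congrFun hx v) (congrFun hy v)
  rcases v with ⟨m, w, K, L⟩ | ⟨b, K, L⟩
  · exact (virU_add _ _ _ _ _).trans (h.trans (virU_add _ _ _ _ _).symm)
  · exact (virT_add _ _ _ _).trans (h.trans (virT_add _ _ _ _).symm)

lemma IsIshibashi.smul {k : ℕ} {x : State} (c : ℂ) (hx : IsIshibashi k x) :
    IsIshibashi k (c • x) := by
  intro n
  have hx := sub_eq_zero.mp (hx n)
  rw [sub_eq_zero]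
  funext v
  have h := congrArg (c * ·) (congrFun hx v)
  rcases v with ⟨m, w, K, L⟩ | ⟨b, K, L⟩
  · exact (virU_const_mul _ _ _ _ _).trans (h.trans (virU_const_mul _ _ _ _ _).symm)
  · exact (virT_const_mul _ _ _ _).trans (h.trans (virT_const_mul _ _ _ _).symm)

lemma isIshibashi_zero (k : ℕ) : IsIshibashi k 0 := by
  have h := (isIshibashi_glued (k := k) (ε := 1) (c := 0) (fun _ _ h => (h rfl).elim) 0).smul 0
  rwa [zero_smul] at h

lemma reflect_add (x y : State) : reflect (x + y) = reflect x + reflect y := by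
  funext v
  rcases v with ⟨m, w, K, L⟩ | ⟨b, K, L⟩ <;> exact mul_add _ _ _

lemma reflect_smul (c : ℂ) (x : State) : reflect (c • x) = c • reflect x := by
  funext v
  rcases v with ⟨m, w, K, L⟩ | ⟨b, K, L⟩ <;> exact mul_left_comm _ _ _

/-- Equal left and right occupation numbers make the number of oscillators even, so only the
symmetry of the ground-state components is needed. -/
lemma reflect_glued (ε : ℤˣ) {c : ℤ → ℤ → ℝ} (hc : ∀ m w, c (-m) (-w) = c m w) (t : Bool → ℝ) :
    reflect (glued ε c t) = glued ε c t := by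
  have h : ∀ (C : ℝ) (K L : Occ), (-1 : ℂ) ^ (occCount K + occCount L) *
      ((C * glueCoeff ε K L : ℝ) : ℂ) = ((C * glueCoeff ε K L : ℝ) : ℂ) := fun C K L => by
    by_cases hKL : K = L
    · subst hKL
      rw [← two_mul, pow_mul]
      simp
    · simp [glueCoeff, hKL]
  funext v
  rcases v with ⟨m, w, K, L⟩ | ⟨b, K, L⟩
  · change _ * ((c (-m) (-w) * glueCoeff ε K L : ℝ) : ℂ) = _
    rw [hc]
    exact h _ _ _
  · exact h _ _ _

end OrbifoldBoundary

namespace OrbifoldBoundary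

/-! ## The boundary states as glued states -/

/-! ## The boundary states as glued states -/

/-- Winding components of the Neumann states. -/
noncomputable def nGlue (k : ℕ) (A : ℝ) (s : ℕ) (m w : ℤ) : ℝ :=
  if m = 0 then A * Real.cos (Real.pi * s * w / k) else 0

/-- Momentum components of the Dirichlet states. -/
noncomputable def dGlue (A : ℝ) (s : ℕ) (m w : ℤ) : ℝ :=
  if w = 0 then A * Real.cos (Real.pi * s * m) else 0

/-- The normalization of the Neumann states `0N±`, `kN±`. -/
noncomputable def ampN (k : ℕ) : ℝ := 1 / (√2 * (2 * (k : ℝ)) ^ (1 / 4 : ℝ))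

/-- The normalization of the Dirichlet states. -/
noncomputable def ampD (k : ℕ) : ℝ := 1 / √2 * ((k : ℝ) / 2) ^ (1 / 4 : ℝ)

/-- The normalization of the twisted components. -/
noncomputable def ampT : ℝ := 1 / (2 : ℝ) ^ (1 / 4 : ℝ)

/-- Only `n = w` and `n = -w` contribute. Treating them as two separate one-point sums covers `w =
0`, where they coincide. -/
lemma finsum_ite_eq_or_neg (c : ℤ → ℂ) (w : ℤ) (e : ℂ) :
    ∑ᶠ n : ℤ, c n * (1 / 2 * ((if w = n then e else 0) + if w = -n then e else 0)) =
      (c w + c (-w)) / 2 * e := by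
  have h1 : ∀ n, c n * (1 / 2 * ((if w = n then e else 0) + if w = -n then e else 0)) =
      (if n = w then c n / 2 * e else 0) + if n = -w then c n / 2 * e else 0 := by
    intro n
    have p1 : (if w = n then e else 0) = if n = w then e else 0 := if_congr eq_comm rfl rfl
    have p2 : (if w = -n then e else 0) = if n = -w then e else 0 :=
      if_congr (by rw [eq_comm, neg_eq_iff_eq_neg]) rfl rfl
    rw [p1, p2]
    split_ifs <;> ring
  rw [finsum_congr h1, finsum_add_distrib, finsum_eq_single _ w, finsum_eq_single _ (-w)]
  · simp only [if_true]; ring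
  · intro n hn; exact if_neg hn
  · intro n hn; exact if_neg hn
  · exact (Set.finite_singleton w).subset fun n hn => by
      by_contra h
      exact hn (if_neg h)
  · exact (Set.finite_singleton (-w)).subset fun n hn => by
      by_contra h
      exact hn (if_neg h)

lemma expCoeff_omU_neg (K L : Occ) : expCoeff omU (-1) K L = glueCoeff (-1) K L := by
  simpa using expCoeff_eq (fun j => (omU_pos j).ne') (-1) K L

lemma expCoeff_omU_one (K L : Occ) : expCoeff omU 1 K L = glueCoeff 1 K L := by
  simpa using expCoeff_eq (fun j => (omU_pos j).ne') 1 K L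

lemma expCoeff_omT_neg (K L : Occ) : expCoeff omT (-1) K L = glueCoeff (-1) K L := by
  simpa using expCoeff_eq (fun j => (omT_pos j).ne') (-1) K L

lemma expCoeff_omT_one (K L : Occ) : expCoeff omT 1 K L = glueCoeff 1 K L := by
  simpa using expCoeff_eq (fun j => (omT_pos j).ne') 1 K L

lemma formalSum_ishUN_inl (c : ℤ → ℂ) (m w : ℤ) (K L : Occ) :
    formalSum c ishUN (.inl (m, w, K, L)) =
      if m = 0 then (c w + c (-w)) / 2 * glueCoeff (-1) K L else 0 := by
  change ∑ᶠ n, c n * (1 / 2 * ((if m = 0 ∧ w = n then expCoeff omU (-1) K L else 0) +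
    if m = 0 ∧ w = -n then expCoeff omU (-1) K L else 0)) = _
  by_cases hm : m = 0
  · simp only [hm, true_and, if_true]
    rw [finsum_ite_eq_or_neg, expCoeff_omU_neg]
  · simp [hm]

lemma formalSum_ishUD_inl (c : ℤ → ℂ) (m w : ℤ) (K L : Occ) :
    formalSum c ishUD (.inl (m, w, K, L)) =
      if w = 0 then (c m + c (-m)) / 2 * glueCoeff 1 K L else 0 := by
  change ∑ᶠ n, c n * (1 / 2 * ((if m = n ∧ w = 0 then expCoeff omU 1 K L else 0) +
    if m = -n ∧ w = 0 then expCoeff omU 1 K L else 0)) = _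
  by_cases hw : w = 0
  · simp only [hw, and_true, if_true]
    rw [finsum_ite_eq_or_neg, expCoeff_omU_one]
  · simp [hw]

lemma formalSum_inr (c : ℤ → ℂ) (x : ℤ → State) (v : Bool × Occ × Occ)
    (hx : ∀ n, x n (.inr v) = 0) : formalSum c x (.inr v) = 0 := by
  simp [formalSum, hx]

lemma ishUN_inr (n : ℤ) (v : Bool × Occ × Occ) : ishUN n (.inr v) = 0 := by
  simp [ishUN, circleN]

lemma ishUD_inr (n : ℤ) (v : Bool × Occ × Occ) : ishUD n (.inr v) = 0 := by
  simp [ishUD, circleD]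

lemma finsum_comp_of_support {ι κ M : Type*} [AddCommMonoid M] {φ : ι → κ}
    (hφ : Function.Injective φ) {g : κ → M} (hg : ∀ n, n ∉ Set.range φ → g n = 0) :
    ∑ᶠ i, g (φ i) = ∑ᶠ n, g n := by
  rw [← finsum_mem_range hφ, finsum_mem_def]
  congr 1
  funext n
  by_cases h : n ∈ Set.range φ
  · rw [Set.indicator_of_mem h]
  · rw [Set.indicator_of_notMem h, hg n h]

/-- Exactly one residue is selected, and as `m` is an integer the phase depends only on `w` modulo
`2k`. -/
lemma sum_exp_residue {k : ℕ} (hk : 1 ≤ k) (m : ℕ) (w : ℤ) :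
    ∑ l ∈ Finset.range (2 * k), Complex.exp (2 * Real.pi * Complex.I * l * m / (2 * k)) *
      (if w % ((2 * k : ℕ) : ℤ) = l then 1 else 0) =
      Complex.exp (2 * Real.pi * Complex.I * w * m / (2 * k)) := by
  have hkC : (k : ℂ) ≠ 0 := by exact_mod_cast (by omega : k ≠ 0)
  have hN : (0 : ℤ) < ((2 * k : ℕ) : ℤ) := by exact_mod_cast (by omega : 0 < 2 * k)
  obtain ⟨r, hr⟩ := Int.eq_ofNat_of_zero_le (Int.emod_nonneg w hN.ne')
  have hlt := Int.emod_lt_of_pos w hN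
  have hw := Int.mul_ediv_add_emod w ((2 * k : ℕ) : ℤ)
  rw [Finset.sum_eq_single r]
  · rw [if_pos hr, mul_one, Complex.exp_eq_exp_iff_exists_int]
    refine ⟨-(w / ((2 * k : ℕ) : ℤ) * m), ?_⟩
    have hwC : (w : ℂ) = 2 * k * (w / ((2 * k : ℕ) : ℤ) : ℤ) + r := by
      rw [hr] at hw
      exact_mod_cast hw.symm
    rw [hwC]
    push_cast
    field_simp
    ring
  · intro l _ hl
    rw [if_neg (by rw [hr]; exact_mod_cast Ne.symm hl), mul_zero]
  · intro h
    rw [Finset.mem_range] at h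
    omega

/-- The states of one residue class of windings. -/
lemma formalSum_ishUN_residue {N : ℕ} (hN : 0 < N) (l : ℕ) (hl : l < N) (m w : ℤ) (K L : Occ) :
    formalSum (fun _ => 1) (fun n => ishUN (N * n + l)) (.inl (m, w, K, L)) =
      if m = 0 then (((if w % N = l then 1 else 0) + if -w % N = l then 1 else 0) / 2 : ℂ) *
        (glueCoeff (-1) K L : ℂ) else 0 := by
  have hN' : (0 : ℤ) < N := by exact_mod_cast hN
  have hl' : (l : ℤ) < N := by exact_mod_cast hl
  have h1 : formalSum (fun _ => 1) (fun n => ishUN (N * n + l)) (.inl (m, w, K, L)) =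
      formalSum (fun n : ℤ => if n % N = l then 1 else 0) ishUN (.inl (m, w, K, L)) := by
    simp only [formalSum]
    have hinj : Function.Injective fun n : ℤ => (N : ℤ) * n + l := fun a b hab => by
      simpa [hN.ne'] using hab
    refine Eq.trans ?_ (finsum_comp_of_support hinj (g := fun n : ℤ =>
      (if n % N = l then (1 : ℂ) else 0) * ishUN n (.inl (m, w, K, L))) fun n hn => ?_)
    · refine finsum_congr fun n => ?_
      have : ((N : ℤ) * n + l) % N = l := by
        rw [Int.mul_add_emod_self_left, Int.emod_eq_of_lt (by positivity) hl']
      simp [this]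
    · rw [if_neg, zero_mul]
      intro e
      refine hn ⟨n / N, ?_⟩
      change (N : ℤ) * (n / N) + l = n
      rw [← e]; exact Int.mul_ediv_add_emod n N
  rw [h1, formalSum_ishUN_inl]

lemma altSign_eq (n : ℤ) : altSign n = (Real.cos (Real.pi * n) : ℂ) := by
  rw [mul_comm, Real.cos_int_mul_pi, altSign]
  rcases Int.even_or_odd n with h | h
  · simp [h.neg_one_zpow]
  · simp [h.neg_one_zpow]

/-- The gluing sign of a boundary state: `-1` for Neumann, `1` for Dirichlet. -/
def glueSign {k : ℕ} : Label k → ℤˣ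
  | .N0 _ => -1
  | .N _ => -1
  | .Nk _ => -1
  | .D0 _ => 1
  | .Dk _ => 1

/-- The untwisted components of a boundary state. -/
noncomputable def unCoeff (k : ℕ) : Label k → ℤ → ℤ → ℝ
  | .N0 _ => nGlue k (ampN k) 0
  | .N m => nGlue k (2 * ampN k) m
  | .Nk _ => nGlue k (ampN k) k
  | .D0 _ => dGlue (ampD k) 0
  | .Dk _ => dGlue (ampD k) 1

/-- The twisted components of a boundary state. -/
noncomputable def twCoeff {k : ℕ} : Label k → Bool → ℝ
  | .N0 e, _ => (e : ℤ) * ampT / √2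
  | .N _, _ => 0
  | .Nk e, b => if b then -((e : ℤ) * ampT / √2) else (e : ℤ) * ampT / √2
  | .D0 e, b => if b then 0 else (e : ℤ) * ampT
  | .Dk e, b => if b then (e : ℤ) * ampT else 0

lemma cT_eq (e : ℤˣ) : cT e = (((e : ℤ) * ampT : ℝ) : ℂ) := by
  rw [cT, ampT, mul_one_div]

/-- The average over `w` and `-w` turns `exp(2πi w m / 2k)` into `cos(π m w / k)`, and `(-1)^w` is
the case of charge `k`. So one cosine family describes all Neumann states and another all Dirichlet
states. -/
lemma boundaryState_eq {k : ℕ} (hk : 1 ≤ k) (a : Label k) :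
    boundaryState k a = glued (glueSign a) (unCoeff k a) (twCoeff a) := by
  have hkC : (k : ℂ) ≠ 0 := by exact_mod_cast (by omega : k ≠ 0)
  have hkR : (k : ℝ) ≠ 0 := by exact_mod_cast (by omega : k ≠ 0)
  funext v
  rcases a with e | m | e | e | e
  · rcases v with ⟨p, w, K, L⟩ | ⟨b, K, L⟩
    · change cN k * formalSum _ ishUN _ + cT e * (_ * (0 + 0)) = (_ : ℂ)
      rw [formalSum_ishUN_inl]
      simp only [glued, unCoeff, nGlue, glueSign, cN, ampN]
      by_cases hp : p = 0 <;> simp [hp]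
    · change cN k * formalSum _ ishUN _ + cT e * (_ * (twistExp _ _ _ + twistExp _ _ _)) = (_ : ℂ)
      rw [formalSum_inr _ _ _ (fun n => ishUN_inr n _), cT_eq]
      simp only [glued, twCoeff, glueSign, twistExp, expCoeff_omT_neg]
      cases b <;> simp <;> ring
  · rcases v with ⟨p, w, K, L⟩ | ⟨b, K, L⟩
    · have hsum : boundaryState k (.N m) (.inl (p, w, K, L)) = cM k *
          ∑ l ∈ Finset.range (2 * k),
            Complex.exp (2 * Real.pi * Complex.I * l * (m : ℕ) / (2 * k)) *
            formalSum (fun _ => 1) (fun n => ishUN ((2 * k : ℕ) * n + l)) (.inl (p, w, K, L)) := by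
        simp only [boundaryState, Pi.smul_apply, Finset.sum_apply, smul_eq_mul]
        push_cast
        rfl
      rw [hsum, Finset.sum_congr rfl fun l hl => by
        rw [formalSum_ishUN_residue (by omega) l (Finset.mem_range.mp hl)]]
      by_cases hp : p = 0
      · simp only [hp, if_true]
        have e1 := sum_exp_residue hk m w
        have e2 := sum_exp_residue hk m (-w)
        have e3 : ((Real.cos (Real.pi * (m : ℕ) * w / k) : ℝ) : ℂ) =
            (Complex.exp (2 * Real.pi * Complex.I * w * (m : ℕ) / (2 * k)) +
              Complex.exp (2 * Real.pi * Complex.I * (-w : ℤ) * (m : ℕ) / (2 * k))) / 2 := by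
          rw [Complex.ofReal_cos, Complex.cos]
          push_cast
          congr 3
          · field_simp
          · field_simp
        -- The states `N m` carry twice the normalization of `N0` and `Nk`, as `√2 = 2/√2`.
        have e4 : cM k = ((2 * ampN k : ℝ) : ℂ) := by
          have h2 : √(2 : ℝ) ≠ 0 := by positivity
          rw [cM, ampN]
          congr 1
          field_simp
          rw [Real.sq_sqrt (by norm_num)]
        simp only [glued, unCoeff, nGlue, if_true, glueSign]
        rw [Complex.ofReal_mul, Complex.ofReal_mul, ← e4, e3, ← e1, ← e2, ← Finset.sum_add_distrib,
          mul_assoc (cM k), Finset.sum_div, Finset.sum_mul]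
        congr 1
        refine Finset.sum_congr rfl fun l _ => ?_
        ring
      · simp [glued, unCoeff, nGlue, hp]
    · have : boundaryState k (.N m) (.inr (b, K, L)) = 0 := by
        simp only [boundaryState, Pi.smul_apply, Finset.sum_apply, smul_eq_mul]
        rw [Finset.sum_eq_zero, mul_zero]
        intro l _
        rw [formalSum_inr _ _ _ (fun n => ishUN_inr _ _), mul_zero]
      rw [this]
      simp [glued, twCoeff]
  · rcases v with ⟨p, w, K, L⟩ | ⟨b, K, L⟩
    · change cN k * formalSum _ ishUN _ + cT e * (_ * (0 - 0)) = (_ : ℂ)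
      rw [formalSum_ishUN_inl]
      simp only [glued, unCoeff, nGlue, glueSign, cN, altSign_eq]
      rw [show Real.pi * k * w / k = Real.pi * w by field_simp]
      by_cases hp : p = 0 <;> simp [hp, ampN]
      ring
    · change cN k * formalSum _ ishUN _ + cT e * (_ * (twistExp _ _ _ - twistExp _ _ _)) = (_ : ℂ)
      rw [formalSum_inr _ _ _ (fun n => ishUN_inr n _), cT_eq]
      simp only [glued, twCoeff, glueSign, twistExp, expCoeff_omT_neg]
      cases b <;> simp <;> ring
  · rcases v with ⟨p, w, K, L⟩ | ⟨b, K, L⟩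
    · change cD k * formalSum _ ishUD _ + cT e * 0 = (_ : ℂ)
      rw [formalSum_ishUD_inl]
      simp only [glued, unCoeff, dGlue, glueSign, cD, ampD]
      by_cases hp : w = 0 <;> simp [hp]
    · change cD k * formalSum _ ishUD _ + cT e * twistExp _ _ _ = (_ : ℂ)
      rw [formalSum_inr _ _ _ (fun n => ishUD_inr n _), cT_eq]
      simp only [glued, twCoeff, glueSign, twistExp, expCoeff_omT_one]
      cases b <;> simp
  · rcases v with ⟨p, w, K, L⟩ | ⟨b, K, L⟩
    · change cD k * formalSum _ ishUD _ + cT e * 0 = (_ : ℂ)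
      rw [formalSum_ishUD_inl]
      simp only [glued, unCoeff, dGlue, glueSign, cD, ampD, altSign_eq]
      by_cases hp : w = 0 <;> simp [hp]
      ring
    · change cD k * formalSum _ ishUD _ + cT e * twistExp _ _ _ = (_ : ℂ)
      rw [formalSum_inr _ _ _ (fun n => ishUD_inr n _), cT_eq]
      simp only [glued, twCoeff, glueSign, twistExp, expCoeff_omT_one]
      cases b <;> simp

end OrbifoldBoundary

namespace OrbifoldBoundary

/-! ## Modular transformation of the characters; amplitudes of glued states -/

/-! ## Modular transformation of the characters -/

lemma circleChar_neg {k : ℕ} (hk : 1 ≤ k) (s : ℤ) {β : ℝ} (hβ : 0 < β) :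
    circleChar k (-s) (qOpen β) = circleChar k s (qOpen β) := by
  rw [circleChar_eq, circleChar_eq, theta_neg hk s hβ]

lemma circleChar_add {k : ℕ} (hk : 1 ≤ k) (s : ℤ) {β : ℝ} (hβ : 0 < β) :
    circleChar k (s + 2 * k) (qOpen β) = circleChar k s (qOpen β) := by
  rw [circleChar_eq, circleChar_eq, theta_add hk s hβ]

lemma cos_mul_neg_div (s t k : ℝ) : Real.cos (Real.pi * s * -t / k) = Real.cos (Real.pi * s * t / k) := by
  rw [mul_neg, neg_div, Real.cos_neg]

lemma cos_add_two_mul {k : ℕ} (hk : 1 ≤ k) (s t : ℤ) :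
    Real.cos (Real.pi * s * (t + 2 * k : ℤ) / k) = Real.cos (Real.pi * s * t / k) := by
  have hk' : (k : ℝ) ≠ 0 := by exact_mod_cast (by omega : k ≠ 0)
  rw [show Real.pi * s * (t + 2 * k : ℤ) / k = Real.pi * s * t / k + s * (2 * Real.pi) by
    push_cast; field_simp, Real.cos_add_int_mul_two_pi]

/-- The factors `√β` of theta and eta cancel. The residues modulo `2k` are folded by `t ↦ -t`, whose
fixed points `0` and `k` are counted once. -/
lemma circleChar_qClosed {k : ℕ} (hk : 1 ≤ k) (s : ℤ) {β : ℝ} (hβ : 0 < β) :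
    circleChar k s (qClosed β) = 1 / √(2 * k) * (circleChar k 0 (qOpen β) +
      (-1) ^ s * circleChar k k (qOpen β) + 2 * ∑ t ∈ Finset.Ioo 0 k,
        Real.cos (Real.pi * s * t / k) * circleChar k t (qOpen β)) := by
  have hk' : (k : ℝ) ≠ 0 := by exact_mod_cast (by omega : k ≠ 0)
  have h := sum_range_two_mul_of_even hk
    (g := fun t : ℤ => Real.cos (Real.pi * s * t / k) * circleChar k t (qOpen β))
    (fun t => by rw [circleChar_neg hk _ hβ, Int.cast_neg, cos_mul_neg_div])
    (fun t => by rw [circleChar_add hk _ hβ, cos_add_two_mul hk])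
  have h1 : Real.cos (Real.pi * s * k / k) = (-1) ^ s := by
    rw [← Real.cos_int_mul_pi]; congr 1; field_simp
  have hb : √β ≠ 0 := (Real.sqrt_pos.mpr hβ).ne'
  simp only [Int.cast_zero, mul_zero, zero_div, Real.cos_zero, one_mul, nsmul_eq_mul,
    Nat.cast_ofNat, Int.cast_natCast, h1] at h
  rw [← h, qClosed_eq, circleChar_eq, ← qClosed_eq, eta_qClosed hβ, theta_inv hk s hβ]
  simp only [circleChar_eq, mul_div_assoc', ← Finset.sum_div]
  field_simp

lemma chiC_eq_circleChar {β : ℝ} (hβ : 0 < β) :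
    chiC (qOpen β) = circleChar 4 0 (qOpen β) - circleChar 4 4 (qOpen β) := by
  rw [chiC_eq hβ, circleChar_eq, circleChar_eq, sub_div]

lemma twChar_one {β : ℝ} : twChar 1 (qOpen β) = circleChar 4 1 (qOpen β) := by
  rw [twChar_eq, if_pos rfl]

lemma twChar_neg_one {β : ℝ} : twChar (-1) (qOpen β) = circleChar 4 3 (qOpen β) := by
  rw [twChar_eq, if_neg (by decide)]

lemma sqrt_two_mul_four : √(2 * (4 : ℕ)) = 2 * √2 := by
  rw [show (2 * (4 : ℕ) : ℝ) = 2 ^ 2 * 2 by norm_num, Real.sqrt_mul (by norm_num),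
    Real.sqrt_sq (by norm_num)]

lemma circleChar_four_qClosed (s : ℤ) {β : ℝ} (hβ : 0 < β) :
    circleChar 4 s (qClosed β) = 1 / (2 * √2) * (circleChar 4 0 (qOpen β) +
      (-1) ^ s * circleChar 4 4 (qOpen β) + 2 * (
        Real.cos (Real.pi * s * 1 / 4) * circleChar 4 1 (qOpen β) +
        Real.cos (Real.pi * s * 2 / 4) * circleChar 4 2 (qOpen β) +
        Real.cos (Real.pi * s * 3 / 4) * circleChar 4 3 (qOpen β))) := by
  rw [circleChar_qClosed (by norm_num) s hβ, sqrt_two_mul_four,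
    show Finset.Ioo 0 4 = {1, 2, 3} by decide]
  simp [Finset.sum_insert]
  ring

lemma cos_three_pi_div_four : Real.cos (Real.pi * 3 / 4) = -(√2 / 2) := by
  rw [show Real.pi * 3 / 4 = Real.pi - Real.pi / 4 by ring, Real.cos_pi_sub, Real.cos_pi_div_four]

/-- `χ_c(\tilde q) = √2 (χ_+(q) + χ_-(q))`. -/
lemma chiC_qClosed {β : ℝ} (hβ : 0 < β) :
    chiC (qClosed β) = √2 * (twChar 1 (qOpen β) + twChar (-1) (qOpen β)) := by
  have e1 : Real.cos (Real.pi * 4 * 2 / 4) = 1 := by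
    rw [show Real.pi * 4 * 2 / 4 = 2 * Real.pi by ring, Real.cos_two_pi]
  have e2 : Real.cos (Real.pi * 4 * 3 / 4) = -1 := by
    rw [show Real.pi * 4 * 3 / 4 = Real.pi + 2 * Real.pi by ring, Real.cos_add_two_pi, Real.cos_pi]
  have e3 : Real.cos (Real.pi * 4 * 1 / 4) = -1 := by
    rw [show Real.pi * 4 * 1 / 4 = Real.pi by ring, Real.cos_pi]
  have h2 : √(2 : ℝ) * √2 = 2 := Real.mul_self_sqrt (by norm_num)
  have h3 : √(2 : ℝ) ≠ 0 := by positivity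
  -- In the difference of the level 4 rows `0` and `4` the weight of charge `t` is `1 - (-1)^t`, so
  -- only charges 1 and 3 survive.
  rw [qClosed_eq, chiC_eq_circleChar (one_div_pos.mpr hβ), ← qClosed_eq,
    circleChar_four_qClosed _ hβ, circleChar_four_qClosed _ hβ, twChar_one, twChar_neg_one]
  have n4 : (-1 : ℝ) ^ (4 : ℤ) = 1 := by norm_num
  simp only [Int.cast_zero, Int.cast_ofNat, e1, e2, e3, n4, mul_zero, zero_mul, zero_div,
    Real.cos_zero, zpow_zero]
  field_simp
  linear_combination (-2 * circleChar 4 1 (qOpen β) - 2 * circleChar 4 3 (qOpen β)) * h2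

lemma twChar_add_qClosed {β : ℝ} (hβ : 0 < β) :
    twChar 1 (qClosed β) + twChar (-1) (qClosed β) = chiC (qOpen β) / √2 := by
  have h := chiC_qClosed (one_div_pos.mpr hβ)
  rw [qClosed_eq, one_div_one_div, ← qClosed_eq] at h
  rw [h, mul_div_cancel_left₀]
  positivity

/-- The level 4 rows `1` and `3` agree at charges 0, 2, 4 and have opposite entries `±√2/2` at
charges 1 and 3, so the difference of these characters is invariant. -/
lemma twChar_sub_qClosed {β : ℝ} (hβ : 0 < β) :
    twChar 1 (qClosed β) - twChar (-1) (qClosed β) =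
      twChar 1 (qOpen β) - twChar (-1) (qOpen β) := by
  have e1 : Real.cos (Real.pi * 3 * 3 / 4) = √2 / 2 := by
    rw [show Real.pi * 3 * 3 / 4 = Real.pi / 4 + 2 * Real.pi by ring, Real.cos_add_two_pi,
      Real.cos_pi_div_four]
  have e2 : Real.cos (Real.pi * 3 * 2 / 4) = 0 := by
    rw [show Real.pi * 3 * 2 / 4 = Real.pi + Real.pi / 2 by ring, Real.cos_add,
      Real.cos_pi_div_two, Real.sin_pi]; ring
  have e3 : Real.cos (Real.pi * 2 / 4) = 0 := by
    rw [show Real.pi * 2 / 4 = Real.pi / 2 by ring, Real.cos_pi_div_two]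
  have h2 : √(2 : ℝ) * √2 = 2 := Real.mul_self_sqrt (by norm_num)
  have h3 : √(2 : ℝ) ≠ 0 := by positivity
  rw [qClosed_eq, twChar_one, twChar_neg_one, ← qClosed_eq,
    circleChar_four_qClosed _ hβ, circleChar_four_qClosed _ hβ, twChar_one, twChar_neg_one]
  have n3 : (-1 : ℝ) ^ (3 : ℤ) = -1 := by norm_num
  simp only [Int.cast_one, Int.cast_ofNat, e1, e2, e3, n3, mul_one, Real.cos_pi_div_four,
    cos_three_pi_div_four, zpow_one]
  field_simp
  ring

/-! ## Amplitudes -/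

lemma rpow_quarter_mul_self {x : ℝ} (hx : 0 ≤ x) :
    x ^ (1 / 4 : ℝ) * x ^ (1 / 4 : ℝ) = √x := by
  rw [← Real.rpow_add_of_nonneg hx (by norm_num) (by norm_num), Real.sqrt_eq_rpow]
  norm_num

lemma ampN_mul_self (k : ℕ) : ampN k * ampN k = 1 / (2 * √(2 * k)) := by
  rw [ampN, div_mul_div_comm, mul_mul_mul_comm, rpow_quarter_mul_self (by positivity),
    Real.mul_self_sqrt (by norm_num), one_mul]

lemma ampD_mul_self (k : ℕ) : ampD k * ampD k = 1 / 2 * √(k / 2) := by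
  rw [ampD, mul_mul_mul_comm, rpow_quarter_mul_self (by positivity), div_mul_div_comm,
    Real.mul_self_sqrt (by norm_num), one_mul]

lemma ampT_mul_self : ampT * ampT = 1 / √2 := by
  rw [ampT, div_mul_div_comm, rpow_quarter_mul_self (by norm_num), one_mul]

/-- The powers of `k` cancel. Neumann and Dirichlet states share only the untwisted ground state
without momentum and winding, so their amplitudes do not depend on the radius. -/
lemma ampN_mul_ampD {k : ℕ} (hk : 1 ≤ k) : ampN k * ampD k = 1 / (2 * √2) := by
  have hk' : (0 : ℝ) < k := by exact_mod_cast hk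
  have h : ((k : ℝ) / 2) ^ (1 / 4 : ℝ) * √2 = (2 * (k : ℝ)) ^ (1 / 4 : ℝ) := by
    rw [show 2 * (k : ℝ) = k / 2 * (2 * 2) by ring, Real.mul_rpow (by positivity) (by norm_num),
      Real.mul_rpow (by norm_num) (by norm_num), rpow_quarter_mul_self (by norm_num)]
  have h1 : ((k : ℝ) / 2) ^ (1 / 4 : ℝ) ≠ 0 := (Real.rpow_pos_of_pos (by positivity) _).ne'
  have h2 : √(2 : ℝ) * √2 = 2 := Real.mul_self_sqrt (by norm_num)
  have h3 : √(2 : ℝ) ≠ 0 := by positivity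
  rw [ampN, ampD, ← h]
  field_simp
  linarith

lemma radius_sq {k : ℕ} : radius k ^ 2 = 1 / (2 * k) := by
  rw [radius, div_pow, one_pow, Real.sq_sqrt (by positivity)]

/-- The product of two cosines splits into the charges `s + s'` and `s - s'`; the exponent of
winding `w` is `w²/4k` because `R² = 1/2k`. -/
lemma hasSum_nGlue {k : ℕ} (hk : 1 ≤ k) {β : ℝ} (hβ : 0 < β) (A A' : ℝ) (s s' : ℕ) :
    HasSum (fun x : ℤ × ℤ => nGlue k A s x.1 x.2 * nGlue k A' s' x.1 x.2 *
      qClosed β ^ ((pL k x.1 x.2 ^ 2 + pR k x.1 x.2 ^ 2) / 4))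
      (A * A' / 2 * (√(2 * k * β) * theta k (s + s') β + √(2 * k * β) * theta k (s - s') β)) := by
  have hk' : (k : ℝ) ≠ 0 := by exact_mod_cast (by omega : k ≠ 0)
  have h := ((hasSum_theta_dual hk (s + s') hβ).add (hasSum_theta_dual hk (s - s') hβ)).mul_left
    (A * A' / 2)
  have hinj : Function.Injective fun w : ℤ => ((0, w) : ℤ × ℤ) := fun a b hab => by simpa using hab
  refine (hinj.hasSum_iff ?_).mp (hasSum_congr' h (fun w => ?_) rfl)
  · rintro ⟨m, w⟩ hx
    have : m ≠ 0 := by rintro rfl; exact hx ⟨w, rfl⟩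
    simp [nGlue, this]
  · have e1 : (pL k 0 w ^ 2 + pR k 0 w ^ 2) / 4 = (w : ℝ) ^ 2 / (4 * k) := by
      have := radius_sq (k := k)
      simp only [pL, pR, Int.cast_zero, zero_div, zero_add, zero_sub, neg_sq, mul_pow, this]
      field_simp
      ring
    simp only [Function.comp, nGlue, if_true, e1]
    push_cast
    rw [show Real.pi * (s + s') * w / k = Real.pi * s * w / k + Real.pi * s' * w / k by ring,
      show Real.pi * (s - s') * w / k = Real.pi * s * w / k - Real.pi * s' * w / k by ring,
      Real.cos_add, Real.cos_sub]
    ring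

lemma hasSum_dGlue {k : ℕ} (hk : 1 ≤ k) {β : ℝ} (hβ : 0 < β) (A A' : ℝ) (s s' : ℕ) :
    HasSum (fun x : ℤ × ℤ => dGlue A s x.1 x.2 * dGlue A' s' x.1 x.2 *
      qClosed β ^ ((pL k x.1 x.2 ^ 2 + pR k x.1 x.2 ^ 2) / 4))
      (A * A' * (√(2 * β / k) * ∑ t ∈ Finset.range k, theta k (2 * t + (s + s' : ℕ)) β)) := by
  have hk' : (k : ℝ) ≠ 0 := by exact_mod_cast (by omega : k ≠ 0)
  have h := (hasSum_theta_dirichlet hk (s + s') hβ).mul_left (A * A')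
  have hinj : Function.Injective fun m : ℤ => ((m, 0) : ℤ × ℤ) := fun a b hab => by simpa using hab
  refine (hinj.hasSum_iff ?_).mp (hasSum_congr' h (fun m => ?_) rfl)
  · rintro ⟨m, w⟩ hx
    have : w ≠ 0 := by rintro rfl; exact hx ⟨m, rfl⟩
    simp [dGlue, this]
  · have e1 : (pL k m 0 ^ 2 + pR k m 0 ^ 2) / 4 = (k : ℝ) * (m : ℝ) ^ 2 / 4 := by
      have := radius_sq (k := k)
      simp only [pL, pR, Int.cast_zero, zero_mul, add_zero, sub_zero, div_pow, mul_pow, this]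
      field_simp
      ring
    simp only [Function.comp, dGlue, if_true, e1]
    push_cast
    -- At integer charges the sines vanish, so the product of the cosines is a single cosine.
    have e2 : Real.sin (Real.pi * s * m) = 0 := by
      rw [show Real.pi * s * m = ((s * m : ℤ) : ℝ) * Real.pi by push_cast; ring,
        Real.sin_int_mul_pi]
    rw [show Real.pi * (s + s') * m = Real.pi * s * m + Real.pi * s' * m by ring,
      Real.cos_add, e2]
    ring

lemma hasSum_nGlue_dGlue (k : ℕ) (β : ℝ) (A A' : ℝ) (s s' : ℕ) :
    HasSum (fun x : ℤ × ℤ => nGlue k A s x.1 x.2 * dGlue A' s' x.1 x.2 *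
      qClosed β ^ ((pL k x.1 x.2 ^ 2 + pR k x.1 x.2 ^ 2) / 4)) (A * A') := by
  refine hasSum_congr' (hasSum_single ((0, 0) : ℤ × ℤ) ?_) (fun _ => rfl) ?_
  · rintro ⟨m, w⟩ hx
    by_cases hm : m = 0
    · have : w ≠ 0 := by rintro rfl; exact hx (by rw [hm])
      simp [dGlue, this]
    · simp [nGlue, hm]
  · simp [nGlue, dGlue, pL, pR]

/-- Amplitudes between Neumann states. -/
lemma hasSum_neumann {k : ℕ} (hk : 1 ≤ k) {β : ℝ} (hβ : 0 < β) (A A' : ℝ) (s s' : ℕ)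
    (t t' : Bool → ℝ) :
    HasSum (cylTerm k β (glued (-1) (nGlue k (A * ampN k) s) t)
        (glued (-1) (nGlue k (A' * ampN k) s') t'))
      ((A * A' / 4 * (circleChar k (s + s') (qOpen β) + circleChar k (s - s') (qOpen β)) +
        (∑ b, t b * t' b) * (chiC (qOpen β) / √2) : ℝ) : ℂ) := by
  have hk' : (0 : ℝ) < k := by exact_mod_cast hk
  refine hasSum_congr' (hasSum_cylTerm_glued_same k hβ (-1) _ _ t t'
    (hasSum_nGlue hk hβ _ _ s s')) (fun _ => rfl) ?_
  rw [twChar_add_qClosed hβ, eta_qClosed hβ, circleChar_eq, circleChar_eq,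
    mul_mul_mul_comm, ampN_mul_self, Real.sqrt_mul (by positivity) β]
  have h1 : √β ≠ 0 := (Real.sqrt_pos.mpr hβ).ne'
  have h2 : √(2 * (k : ℝ)) ≠ 0 := (Real.sqrt_pos.mpr (by positivity)).ne'
  have h3 := (eta_pos (qOpen_pos β) (qOpen_lt_one hβ)).ne'
  congr 2
  field_simp
  ring

/-- Amplitudes between Dirichlet states. -/
lemma hasSum_dirichlet {k : ℕ} (hk : 1 ≤ k) {β : ℝ} (hβ : 0 < β) (s s' : ℕ)
    (t t' : Bool → ℝ) :
    HasSum (cylTerm k β (glued 1 (dGlue (ampD k) s) t) (glued 1 (dGlue (ampD k) s') t'))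
      ((1 / 2 * (∑ r ∈ Finset.range k, circleChar k (2 * r + (s + s' : ℕ)) (qOpen β)) +
        (∑ b, t b * t' b) * (chiC (qOpen β) / √2) : ℝ) : ℂ) := by
  have hk' : (0 : ℝ) < k := by exact_mod_cast hk
  refine hasSum_congr' (hasSum_cylTerm_glued_same k hβ 1 _ _ t t'
    (hasSum_dGlue hk hβ _ _ s s')) (fun _ => rfl) ?_
  simp only [circleChar_eq]
  rw [twChar_add_qClosed hβ, eta_qClosed hβ, ampD_mul_self, ← Finset.sum_div,
    show 2 * β / k = β / (k / 2) by field_simp, Real.sqrt_div hβ.le]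
  have h1 : √β ≠ 0 := (Real.sqrt_pos.mpr hβ).ne'
  have h2 : √((k : ℝ) / 2) ≠ 0 := (Real.sqrt_pos.mpr (by positivity)).ne'
  have h3 := (eta_pos (qOpen_pos β) (qOpen_lt_one hβ)).ne'
  congr 2
  field_simp

/-- Amplitudes between a Neumann and a Dirichlet state. -/
lemma hasSum_neumann_dirichlet {k : ℕ} (hk : 1 ≤ k) {β : ℝ} (hβ : 0 < β) (A : ℝ) (s s' : ℕ)
    (t t' : Bool → ℝ) :
    HasSum (cylTerm k β (glued (-1) (nGlue k (A * ampN k) s) t) (glued 1 (dGlue (ampD k) s') t'))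
      ((A / 2 * (twChar 1 (qOpen β) + twChar (-1) (qOpen β)) +
        (∑ b, t b * t' b) * (twChar 1 (qOpen β) - twChar (-1) (qOpen β)) : ℝ) : ℂ) := by
  refine hasSum_congr' (hasSum_cylTerm_glued_opposite k hβ (by decide) _ _ t t'
    (hasSum_nGlue_dGlue k β _ _ s s')) (fun _ => rfl) ?_
  rw [chiC_qClosed hβ, twChar_sub_qClosed hβ, mul_assoc A, ampN_mul_ampD hk]
  have h3 : √(2 : ℝ) ≠ 0 := by positivity
  congr 2
  field_simp

end OrbifoldBoundary

namespace OrbifoldBoundary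

/-! ## The cylinder amplitudes -/

/-- The charges `2t + r` run over one parity class modulo `2k`, folded by `s ↦ -s`; the fixed points
`0` and `k` occur only if they have the right parity. -/
lemma sum_range_even_add_of_even {k r : ℕ} (hk : 1 ≤ k) (hr : r < 2) {g : ℤ → ℝ}
    (hneg : ∀ s, g (-s) = g s) (hper : ∀ s, g (s + 2 * k) = g s) :
    ∑ t ∈ Finset.range k, g (2 * t + r) = (if r = 0 then g 0 else 0) +
      (if k % 2 = r then g k else 0) + 2 * ∑ s ∈ Finset.Ioo 0 k with s % 2 = r, g s := by
  have h := sum_range_two_mul_of_even hk (g := fun s : ℤ => if s % 2 = r then g s else 0)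
    (fun s => by
      simp only [hneg]
      exact if_congr (by omega) rfl rfl)
    (fun s => by
      simp only [hper]
      exact if_congr (by omega) rfl rfl)
  have c : ∀ t : ℕ, ((t : ℤ) % 2 = r) ↔ t % 2 = r := fun t => by omega
  simp only [c] at h
  rw [sum_range_even_add k r hr, h, Finset.sum_filter, nsmul_eq_mul, Nat.cast_ofNat]
  congr 2
  exact if_congr (by omega) rfl rfl

lemma sum_circleChar_even {k : ℕ} (hk : 1 ≤ k) {β : ℝ} (hβ : 0 < β) :
    ∑ r ∈ Finset.range k, circleChar k (2 * r + (0 : ℕ)) (qOpen β) = circleChar k 0 (qOpen β) +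
      (if Even k then circleChar k k (qOpen β) else 0) +
      2 * ∑ s ∈ Finset.Ioo 0 k with Even s, circleChar k (s : ℕ) (qOpen β) := by
  simpa only [if_true, ← Nat.even_iff] using sum_range_even_add_of_even (r := 0) hk two_pos
    (g := fun s => circleChar k s (qOpen β)) (fun s => circleChar_neg hk s hβ)
    (fun s => circleChar_add hk s hβ)

/-- A cyclic shift of the even charges modulo `2k`; it makes the amplitudes at the second fixed
point equal to those at the first. -/
lemma sum_circleChar_even' {k : ℕ} (hk : 1 ≤ k) {β : ℝ} (hβ : 0 < β) :
    ∑ r ∈ Finset.range k, circleChar k (2 * r + (2 : ℕ)) (qOpen β) =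
      ∑ r ∈ Finset.range k, circleChar k (2 * r + (0 : ℕ)) (qOpen β) := by
  have h1 := Finset.sum_range_succ (fun r : ℕ => circleChar k (2 * r + (0 : ℕ)) (qOpen β)) k
  have h2 := Finset.sum_range_succ' (fun r : ℕ => circleChar k (2 * r + (0 : ℕ)) (qOpen β)) k
  have h3 : circleChar k (2 * k + (0 : ℕ)) (qOpen β) =
      circleChar k (2 * (0 : ℕ) + (0 : ℕ)) (qOpen β) := by
    rw [← circleChar_add hk (2 * (0 : ℕ) + (0 : ℕ)) hβ]; congr 1; push_cast; ring
  have h4 : ∀ r : ℕ, circleChar k (2 * (r + 1 : ℕ) + (0 : ℕ)) (qOpen β) =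
      circleChar k (2 * r + (2 : ℕ)) (qOpen β) := fun r => by congr 1
  simp only [h3, h4] at h1 h2
  linarith

lemma sum_circleChar_odd {k : ℕ} (hk : 1 ≤ k) {β : ℝ} (hβ : 0 < β) :
    ∑ r ∈ Finset.range k, circleChar k (2 * r + (1 : ℕ)) (qOpen β) =
      (if Odd k then circleChar k k (qOpen β) else 0) +
      2 * ∑ s ∈ Finset.Ioo 0 k with Odd s, circleChar k (s : ℕ) (qOpen β) := by
  simpa only [one_ne_zero, if_false, zero_add, ← Nat.odd_iff] using
    sum_range_even_add_of_even (r := 1) hk one_lt_two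
    (g := fun s => circleChar k s (qOpen β)) (fun s => circleChar_neg hk s hβ)
    (fun s => circleChar_add hk s hβ)

lemma cylTerm_symm (k : ℕ) (β : ℝ) (x y : State) (v : BasisVec) :
    cylTerm k β y x v = starRingEnd ℂ (cylTerm k β x y v) := by
  simp only [cylTerm, map_mul, Complex.conj_conj, Complex.conj_ofReal]
  ring

lemma hasSum_cylTerm_symm {k : ℕ} {β : ℝ} {x y : State} {r : ℝ}
    (h : HasSum (cylTerm k β x y) (r : ℂ)) : HasSum (cylTerm k β y x) (r : ℂ) := by
  have := (Complex.hasSum_conj' (f := cylTerm k β x y)).mpr h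
  rw [Complex.conj_ofReal] at this
  exact hasSum_congr' this (fun v => cylTerm_symm k β x y v) rfl

variable {k : ℕ} {β : ℝ}

lemma hasSum_NN (hk : 1 ≤ k) (hβ : 0 < β) {a b : Label k} {A A' : ℝ} {s s' : ℕ}
    (ha : unCoeff k a = nGlue k (A * ampN k) s) (hb : unCoeff k b = nGlue k (A' * ampN k) s')
    (ha' : glueSign a = -1) (hb' : glueSign b = -1) :
    HasSum (cylTerm k β (boundaryState k a) (boundaryState k b))
      ((A * A' / 4 * (circleChar k (s + s') (qOpen β) + circleChar k (s - s') (qOpen β)) +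
        (∑ x, twCoeff a x * twCoeff b x) * (chiC (qOpen β) / √2) : ℝ) : ℂ) := by
  rw [boundaryState_eq hk, boundaryState_eq hk, ha, hb, ha', hb']
  exact hasSum_neumann hk hβ _ _ _ _ _ _

lemma hasSum_DD (hk : 1 ≤ k) (hβ : 0 < β) {a b : Label k} {s s' : ℕ}
    (ha : unCoeff k a = dGlue (ampD k) s) (hb : unCoeff k b = dGlue (ampD k) s')
    (ha' : glueSign a = 1) (hb' : glueSign b = 1) :
    HasSum (cylTerm k β (boundaryState k a) (boundaryState k b))
      ((1 / 2 * (∑ r ∈ Finset.range k, circleChar k (2 * r + (s + s' : ℕ)) (qOpen β)) +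
        (∑ x, twCoeff a x * twCoeff b x) * (chiC (qOpen β) / √2) : ℝ) : ℂ) := by
  rw [boundaryState_eq hk, boundaryState_eq hk, ha, hb, ha', hb']
  exact hasSum_dirichlet hk hβ _ _ _ _

lemma hasSum_ND (hk : 1 ≤ k) (hβ : 0 < β) {a b : Label k} {A : ℝ} {s s' : ℕ}
    (ha : unCoeff k a = nGlue k (A * ampN k) s) (hb : unCoeff k b = dGlue (ampD k) s')
    (ha' : glueSign a = -1) (hb' : glueSign b = 1) :
    HasSum (cylTerm k β (boundaryState k a) (boundaryState k b))
      ((A / 2 * (twChar 1 (qOpen β) + twChar (-1) (qOpen β)) +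
        (∑ x, twCoeff a x * twCoeff b x) * (twChar 1 (qOpen β) - twChar (-1) (qOpen β)) : ℝ) : ℂ) := by
  rw [boundaryState_eq hk, boundaryState_eq hk, ha, hb, ha', hb']
  exact hasSum_neumann_dirichlet hk hβ _ _ _ _ _

lemma unCoeff_N0 (e : ℤˣ) : unCoeff k (.N0 e) = nGlue k (1 * ampN k) 0 := by rw [one_mul]; rfl

lemma unCoeff_Nk (e : ℤˣ) : unCoeff k (.Nk e) = nGlue k (1 * ampN k) k := by rw [one_mul]; rfl

/-- Every label is of Neumann or of Dirichlet type. -/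
lemma label_cases (a : Label k) :
    (∃ (A : ℝ) (s : ℕ), unCoeff k a = nGlue k (A * ampN k) s ∧ glueSign a = -1) ∨
      ∃ s : ℕ, unCoeff k a = dGlue (ampD k) s ∧ glueSign a = 1 := by
  rcases a with e | m | e | e | e
  · exact Or.inl ⟨1, 0, unCoeff_N0 e, rfl⟩
  · exact Or.inl ⟨2, m, rfl, rfl⟩
  · exact Or.inl ⟨1, k, unCoeff_Nk e, rfl⟩
  · exact Or.inr ⟨0, rfl, rfl⟩
  · exact Or.inr ⟨1, rfl, rfl⟩

lemma exists_hasSum_cylTerm (hk : 1 ≤ k) (hβ : 0 < β) (a b : Label k) :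
    ∃ r : ℝ, HasSum (cylTerm k β (boundaryState k a) (boundaryState k b)) (r : ℂ) := by
  rcases label_cases a with ⟨A, s, ha, ha'⟩ | ⟨s, ha, ha'⟩ <;>
    rcases label_cases b with ⟨A', s', hb, hb'⟩ | ⟨s', hb, hb'⟩
  · exact ⟨_, hasSum_NN hk hβ ha hb ha' hb'⟩
  · exact ⟨_, hasSum_ND hk hβ ha hb ha' hb'⟩
  · exact ⟨_, hasSum_cylTerm_symm (hasSum_ND hk hβ hb ha hb' ha')⟩
  · exact ⟨_, hasSum_DD hk hβ ha hb ha' hb'⟩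

lemma summable_cylTerm_boundaryState (hk : 1 ≤ k) (hβ : 0 < β) (a b : Label k) :
    Summable (cylTerm k β (boundaryState k a) (boundaryState k b)) :=
  (exists_hasSum_cylTerm hk hβ a b).choose_spec.summable

lemma Z_comm (hk : 1 ≤ k) (hβ : 0 < β) (a b : Label k) : Z k β a b = Z k β b a := by
  obtain ⟨r, h⟩ := exists_hasSum_cylTerm hk hβ a b
  exact h.tsum_eq.trans (hasSum_cylTerm_symm h).tsum_eq.symm

lemma Z_eq_of_hasSum {a b : Label k} {r r' : ℝ}
    (h : HasSum (cylTerm k β (boundaryState k a) (boundaryState k b)) (r : ℂ)) (e : r = r') :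
    Z k β a b = (r' : ℂ) := e ▸ h.tsum_eq

/-! ### Overlaps of the twisted components -/

lemma ampT_mul_self' : ampT * ampT / √2 = 1 / 2 := by
  rw [ampT_mul_self, div_div, Real.mul_self_sqrt (by norm_num)]

lemma unit_mul_cast (d e : ℤˣ) : (((d * e : ℤˣ) : ℤ) : ℝ) = ((d : ℤ) : ℝ) * ((e : ℤ) : ℝ) := by
  push_cast; rfl

lemma twChar_unit (e : ℤˣ) (q : ℝ) : twChar e q = 1 / 2 * (twChar 1 q + twChar (-1) q) +
    ((e : ℤ) : ℝ) * (1 / 2) * (twChar 1 q - twChar (-1) q) := by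
  rcases Int.units_eq_one_or e with rfl | rfl
  · simp; ring
  · simp; ring

lemma half_div (x : ℝ) : 1 / √2 * (x / √2) = 1 / 2 * x := by
  rw [div_mul_div_comm, Real.mul_self_sqrt (by norm_num)]; ring

lemma sum_twCoeff_N (m : Finset.Ioo 0 k) (b : Label k) :
    ∑ x, twCoeff (.N m : Label k) x * twCoeff b x = 0 := by
  simp [twCoeff]

lemma sum_twCoeff_N' (m : Finset.Ioo 0 k) (b : Label k) :
    ∑ x, twCoeff b x * twCoeff (.N m : Label k) x = 0 := by
  simp [twCoeff]

lemma sqrt_two_inv_sq : (√2 : ℝ)⁻¹ * (√2)⁻¹ = 1 / 2 := by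
  rw [← mul_inv, Real.mul_self_sqrt (by norm_num), one_div]

lemma sum_twCoeff_N0_N0 (d e : ℤˣ) :
    ∑ x, twCoeff (.N0 d : Label k) x * twCoeff (.N0 e : Label k) x =
      ((d * e : ℤˣ) : ℤ) * (1 / √2) := by
  simp only [Fintype.sum_bool, twCoeff, unit_mul_cast]
  rw [← ampT_mul_self]
  linear_combination 2 * ((d : ℤ) : ℝ) * ((e : ℤ) : ℝ) * ampT * ampT * sqrt_two_inv_sq

lemma sum_twCoeff_N0_Nk (d e : ℤˣ) :
    ∑ x, twCoeff (.N0 d : Label k) x * twCoeff (.Nk e : Label k) x = 0 := by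
  simp [twCoeff]

lemma sum_twCoeff_Nk_Nk (d e : ℤˣ) :
    ∑ x, twCoeff (.Nk d : Label k) x * twCoeff (.Nk e : Label k) x =
      ((d * e : ℤˣ) : ℤ) * (1 / √2) := by
  simp only [Fintype.sum_bool, twCoeff, unit_mul_cast, if_true, Bool.false_eq_true, if_false]
  rw [← ampT_mul_self]
  linear_combination 2 * ((d : ℤ) : ℝ) * ((e : ℤ) : ℝ) * ampT * ampT * sqrt_two_inv_sq

lemma sum_twCoeff_N0_D0 (d e : ℤˣ) :
    ∑ x, twCoeff (.N0 d : Label k) x * twCoeff (.D0 e : Label k) x =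
      ((d * e : ℤˣ) : ℤ) * (1 / 2) := by
  simp only [Fintype.sum_bool, twCoeff, unit_mul_cast, if_true, Bool.false_eq_true, if_false]
  linear_combination ((d : ℤ) : ℝ) * ((e : ℤ) : ℝ) * ampT_mul_self'

lemma sum_twCoeff_N0_Dk (d e : ℤˣ) :
    ∑ x, twCoeff (.N0 d : Label k) x * twCoeff (.Dk e : Label k) x =
      ((d * e : ℤˣ) : ℤ) * (1 / 2) := by
  simp only [Fintype.sum_bool, twCoeff, unit_mul_cast, if_true, Bool.false_eq_true, if_false]
  linear_combination ((d : ℤ) : ℝ) * ((e : ℤ) : ℝ) * ampT_mul_self'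

lemma sum_twCoeff_Nk_D0 (d e : ℤˣ) :
    ∑ x, twCoeff (.Nk d : Label k) x * twCoeff (.D0 e : Label k) x =
      ((d * e : ℤˣ) : ℤ) * (1 / 2) := by
  simp only [Fintype.sum_bool, twCoeff, unit_mul_cast, if_true, Bool.false_eq_true, if_false]
  linear_combination ((d : ℤ) : ℝ) * ((e : ℤ) : ℝ) * ampT_mul_self'

lemma sum_twCoeff_Nk_Dk (d e : ℤˣ) :
    ∑ x, twCoeff (.Nk d : Label k) x * twCoeff (.Dk e : Label k) x =
      ((-(d * e) : ℤˣ) : ℤ) * (1 / 2) := by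
  simp only [Fintype.sum_bool, twCoeff, Units.val_neg, Int.cast_neg, unit_mul_cast, if_true,
    Bool.false_eq_true, if_false]
  linear_combination -((d : ℤ) : ℝ) * ((e : ℤ) : ℝ) * ampT_mul_self'

lemma sum_twCoeff_D0_D0 (d e : ℤˣ) :
    ∑ x, twCoeff (.D0 d : Label k) x * twCoeff (.D0 e : Label k) x =
      ((d * e : ℤˣ) : ℤ) * (1 / √2) := by
  simp only [Fintype.sum_bool, twCoeff, unit_mul_cast, if_true, Bool.false_eq_true, if_false]
  linear_combination ((d : ℤ) : ℝ) * ((e : ℤ) : ℝ) * ampT_mul_self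

lemma sum_twCoeff_D0_Dk (d e : ℤˣ) :
    ∑ x, twCoeff (.D0 d : Label k) x * twCoeff (.Dk e : Label k) x = 0 := by
  simp [twCoeff]

lemma sum_twCoeff_Dk_Dk (d e : ℤˣ) :
    ∑ x, twCoeff (.Dk d : Label k) x * twCoeff (.Dk e : Label k) x =
      ((d * e : ℤˣ) : ℤ) * (1 / √2) := by
  simp only [Fintype.sum_bool, twCoeff, unit_mul_cast, if_true, Bool.false_eq_true, if_false]
  linear_combination ((d : ℤ) : ℝ) * ((e : ℤ) : ℝ) * ampT_mul_self

/-! ### The table of amplitudes -/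

lemma Z_N0_N0 (hk : 1 ≤ k) (hβ : 0 < β) (d e : ℤˣ) :
    Z k β (.N0 d) (.N0 e) = (vacChar k (d * e) (qOpen β) : ℂ) := by
  refine Z_eq_of_hasSum (hasSum_NN hk hβ (unCoeff_N0 d) (unCoeff_N0 e) rfl rfl) ?_
  rw [sum_twCoeff_N0_N0, mul_assoc, half_div, vacChar]
  norm_num
  ring

lemma Z_N0_N (hk : 1 ≤ k) (hβ : 0 < β) (d : ℤˣ) (m : Finset.Ioo 0 k) :
    Z k β (.N0 d) (.N m) = (circleChar k (m : ℕ) (qOpen β) : ℂ) := by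
  refine Z_eq_of_hasSum (hasSum_NN hk hβ (unCoeff_N0 d) rfl rfl rfl) ?_
  rw [sum_twCoeff_N', Nat.cast_zero, zero_add, zero_sub, circleChar_neg hk _ hβ]
  ring

lemma Z_N0_Nk (hk : 1 ≤ k) (hβ : 0 < β) (d e : ℤˣ) :
    Z k β (.N0 d) (.Nk e) = (midChar k (qOpen β) : ℂ) := by
  refine Z_eq_of_hasSum (hasSum_NN hk hβ (unCoeff_N0 d) (unCoeff_Nk e) rfl rfl) ?_
  rw [sum_twCoeff_N0_Nk, Nat.cast_zero, zero_add, zero_sub, circleChar_neg hk _ hβ, midChar]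
  ring

lemma Z_N_N (hk : 1 ≤ k) (hβ : 0 < β) (m n : Finset.Ioo 0 k) :
    Z k β (.N m) (.N n) = (circleChar k ((m : ℕ) - (n : ℕ)) (qOpen β) : ℂ) +
        (circleChar k ((m : ℕ) + (n : ℕ)) (qOpen β) : ℂ) := by
  rw [← Complex.ofReal_add]
  refine Z_eq_of_hasSum (hasSum_NN hk hβ rfl rfl rfl rfl) ?_
  rw [sum_twCoeff_N']
  ring

lemma Z_N_Nk (hk : 1 ≤ k) (hβ : 0 < β) (m : Finset.Ioo 0 k) (e : ℤˣ) :
    Z k β (.N m) (.Nk e) = (circleChar k (k - (m : ℕ)) (qOpen β) : ℂ) := by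
  refine Z_eq_of_hasSum (hasSum_NN hk hβ rfl (unCoeff_Nk e) rfl rfl) ?_
  have h1 : circleChar k ((m : ℕ) - k) (qOpen β) = circleChar k (k - (m : ℕ)) (qOpen β) := by
    rw [← circleChar_neg hk _ hβ, neg_sub]
  have h2 : circleChar k ((m : ℕ) + k) (qOpen β) = circleChar k (k - (m : ℕ)) (qOpen β) := by
    rw [← h1, ← circleChar_add hk ((m : ℕ) - k) hβ]; congr 1; ring
  rw [sum_twCoeff_N, h1, h2]
  ring

lemma Z_Nk_Nk (hk : 1 ≤ k) (hβ : 0 < β) (d e : ℤˣ) :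
    Z k β (.Nk d) (.Nk e) = (vacChar k (d * e) (qOpen β) : ℂ) := by
  refine Z_eq_of_hasSum (hasSum_NN hk hβ (unCoeff_Nk d) (unCoeff_Nk e) rfl rfl) ?_
  have h : circleChar k (k + k) (qOpen β) = circleChar k 0 (qOpen β) := by
    rw [← circleChar_add hk 0 hβ]; congr 1; ring
  rw [sum_twCoeff_Nk_Nk, mul_assoc, half_div, vacChar, h, sub_self]
  ring

lemma Z_N0_D0 (hk : 1 ≤ k) (hβ : 0 < β) (d e : ℤˣ) :
    Z k β (.N0 d) (.D0 e) = (twChar (d * e) (qOpen β) : ℂ) := by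
  refine Z_eq_of_hasSum (hasSum_ND hk hβ (unCoeff_N0 d) rfl rfl rfl) ?_
  rw [sum_twCoeff_N0_D0, ← twChar_unit]

lemma Z_N0_Dk (hk : 1 ≤ k) (hβ : 0 < β) (d e : ℤˣ) :
    Z k β (.N0 d) (.Dk e) = (twChar (d * e) (qOpen β) : ℂ) := by
  refine Z_eq_of_hasSum (hasSum_ND hk hβ (unCoeff_N0 d) rfl rfl rfl) ?_
  rw [sum_twCoeff_N0_Dk, ← twChar_unit]

lemma Z_Nk_D0 (hk : 1 ≤ k) (hβ : 0 < β) (d e : ℤˣ) :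
    Z k β (.Nk d) (.D0 e) = (twChar (d * e) (qOpen β) : ℂ) := by
  refine Z_eq_of_hasSum (hasSum_ND hk hβ (unCoeff_Nk d) rfl rfl rfl) ?_
  rw [sum_twCoeff_Nk_D0, ← twChar_unit]

lemma Z_Nk_Dk (hk : 1 ≤ k) (hβ : 0 < β) (d e : ℤˣ) :
    Z k β (.Nk d) (.Dk e) = (twChar (-(d * e)) (qOpen β) : ℂ) := by
  refine Z_eq_of_hasSum (hasSum_ND hk hβ (unCoeff_Nk d) rfl rfl rfl) ?_
  rw [sum_twCoeff_Nk_Dk, ← twChar_unit]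

lemma Z_N_D0 (hk : 1 ≤ k) (hβ : 0 < β) (m : Finset.Ioo 0 k) (e : ℤˣ) :
    Z k β (.N m) (.D0 e) = (twChar 1 (qOpen β) : ℂ) + (twChar (-1) (qOpen β) : ℂ) := by
  rw [← Complex.ofReal_add]
  refine Z_eq_of_hasSum (hasSum_ND hk hβ rfl rfl rfl rfl) ?_
  rw [sum_twCoeff_N]
  ring

lemma Z_N_Dk (hk : 1 ≤ k) (hβ : 0 < β) (m : Finset.Ioo 0 k) (e : ℤˣ) :
    Z k β (.N m) (.Dk e) = (twChar 1 (qOpen β) : ℂ) + (twChar (-1) (qOpen β) : ℂ) := by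
  rw [← Complex.ofReal_add]
  refine Z_eq_of_hasSum (hasSum_ND hk hβ rfl rfl rfl rfl) ?_
  rw [sum_twCoeff_N]
  ring

lemma even_amplitude (hk : 1 ≤ k) (hβ : 0 < β) (e : ℤˣ) :
    1 / 2 * (∑ r ∈ Finset.range k, circleChar k (2 * r + (0 : ℕ)) (qOpen β)) +
      ((e : ℤ) : ℝ) * (1 / √2) * (chiC (qOpen β) / √2) =
    vacChar k e (qOpen β) + (∑ s ∈ Finset.Ioo 0 k with Even s, circleChar k (s : ℕ) (qOpen β)) +
      (if Even k then midChar k (qOpen β) else 0) := by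
  rw [sum_circleChar_even hk hβ, mul_assoc, half_div, vacChar, midChar]
  split_ifs <;> ring

lemma even_amplitude_cast (e : ℤˣ) :
    ((vacChar k e (qOpen β) + (∑ s ∈ Finset.Ioo 0 k with Even s, circleChar k (s : ℕ) (qOpen β)) +
      (if Even k then midChar k (qOpen β) else 0) : ℝ) : ℂ) = (vacChar k e (qOpen β) : ℂ) +
      (∑ s ∈ Finset.Ioo 0 k with Even s, (circleChar k (s : ℕ) (qOpen β) : ℂ)) +
      (if Even k then (midChar k (qOpen β) : ℂ) else 0) := by
  push_cast
  split_ifs <;> simp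

lemma Z_D0_D0 (hk : 1 ≤ k) (hβ : 0 < β) (d e : ℤˣ) :
    Z k β (.D0 d) (.D0 e) = (vacChar k (d * e) (qOpen β) : ℂ) +
      (∑ s ∈ Finset.Ioo 0 k with Even s, (circleChar k (s : ℕ) (qOpen β) : ℂ)) +
      (if Even k then (midChar k (qOpen β) : ℂ) else 0) := by
  rw [← even_amplitude_cast]
  refine Z_eq_of_hasSum (hasSum_DD hk hβ rfl rfl rfl rfl) ?_
  rw [sum_twCoeff_D0_D0]
  exact even_amplitude hk hβ (d * e)

lemma Z_Dk_Dk (hk : 1 ≤ k) (hβ : 0 < β) (d e : ℤˣ) :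
    Z k β (.Dk d) (.Dk e) = (vacChar k (d * e) (qOpen β) : ℂ) +
      (∑ s ∈ Finset.Ioo 0 k with Even s, (circleChar k (s : ℕ) (qOpen β) : ℂ)) +
      (if Even k then (midChar k (qOpen β) : ℂ) else 0) := by
  rw [← even_amplitude_cast]
  refine Z_eq_of_hasSum (hasSum_DD hk hβ rfl rfl rfl rfl) ?_
  rw [sum_twCoeff_Dk_Dk, sum_circleChar_even' hk hβ]
  exact even_amplitude hk hβ (d * e)

lemma Z_D0_Dk (hk : 1 ≤ k) (hβ : 0 < β) (d e : ℤˣ) :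
    Z k β (.D0 d) (.Dk e) =
      (∑ s ∈ Finset.Ioo 0 k with Odd s, (circleChar k (s : ℕ) (qOpen β) : ℂ)) +
      (if Odd k then (midChar k (qOpen β) : ℂ) else 0) := by
  refine (Z_eq_of_hasSum (r' := (∑ s ∈ Finset.Ioo 0 k with Odd s, circleChar k (s : ℕ) (qOpen β)) +
    (if Odd k then midChar k (qOpen β) else 0)) (hasSum_DD hk hβ rfl rfl rfl rfl) ?_).trans ?_
  · rw [sum_twCoeff_D0_Dk, zero_add, sum_circleChar_odd hk hβ, midChar]
    split_ifs <;> ring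
  · push_cast
    split_ifs <;> simp

end OrbifoldBoundary

namespace OrbifoldBoundary

/-! ## The rows of the modular matrix -/

variable {k : ℕ}

/-- The labels as a disjoint union. -/
def labelEquiv (k : ℕ) : Label k ≃ ℤˣ ⊕ Finset.Ioo 0 k ⊕ ℤˣ ⊕ ℤˣ ⊕ ℤˣ where
  toFun
    | .N0 e => .inl e
    | .N m => .inr (.inl m)
    | .Nk e => .inr (.inr (.inl e))
    | .D0 e => .inr (.inr (.inr (.inl e)))
    | .Dk e => .inr (.inr (.inr (.inr e)))
  invFun
    | .inl e => .N0 e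
    | .inr (.inl m) => .N m
    | .inr (.inr (.inl e)) => .Nk e
    | .inr (.inr (.inr (.inl e))) => .D0 e
    | .inr (.inr (.inr (.inr e))) => .Dk e
  left_inv a := by rcases a <;> rfl
  right_inv a := by rcases a with a | a | a | a | a <;> rfl

lemma card_label (hk : 1 ≤ k) : Fintype.card (Label k) = k + 7 := by
  rw [Fintype.card_congr (labelEquiv k)]
  simp only [Fintype.card_sum, Fintype.card_units_int, Fintype.card_coe, Nat.card_Ioo]
  omega

lemma sum_units {M : Type*} [AddCommMonoid M] (f : ℤˣ → M) : ∑ e, f e = f 1 + f (-1) := by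
  rw [UnitsInt.univ, Finset.sum_pair (by decide)]

lemma sum_label {M : Type*} [AddCommMonoid M] (f : Label k → M) :
    ∑ a, f a = (f (.N0 1) + f (.N0 (-1))) + (∑ m, f (.N m) + ((f (.Nk 1) + f (.Nk (-1))) +
      ((f (.D0 1) + f (.D0 (-1))) + (f (.Dk 1) + f (.Dk (-1)))))) := by
  rw [← (labelEquiv k).symm.sum_comp]
  simp only [Fintype.sum_sum_type, sum_units]
  rfl

/-- A vector indexed by the labels: affine in the signs, a multiple of a cosine on the labels of
the untwisted fields. -/
noncomputable def rowVec (k s : ℕ) (A B C D E F G : ℂ) : Label k → ℂ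
  | .N0 e => A + (e : ℤ) * B
  | .N m => 2 * A * (Real.cos (Real.pi * s * (m : ℕ) / k) : ℝ)
  | .Nk e => A * (-1) ^ s + (e : ℤ) * C
  | .D0 e => D + (e : ℤ) * E
  | .Dk e => F + (e : ℤ) * G

lemma cos_pi_mul_div (hk : 1 ≤ k) (s : ℕ) : Real.cos (Real.pi * s * k / k) = (-1) ^ s := by
  rw [mul_div_assoc, div_self (by positivity), mul_one, mul_comm, Real.cos_nat_mul_pi]

lemma cos_pi_mul_div' (hk : 1 ≤ k) (m : ℕ) : Real.cos (Real.pi * k * m / k) = (-1) ^ m := by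
  rw [mul_right_comm, cos_pi_mul_div hk]

lemma sEntry_N0 (d : ℤˣ) : sEntry k (.N0 d) =
    rowVec k 0 1 0 0 ((d : ℤ) * (√k : ℝ)) 0 ((d : ℤ) * (√k : ℝ)) 0 := by
  funext a; rcases a <;> simp [sEntry, rowVec]

lemma sEntry_N (m : Finset.Ioo 0 k) : sEntry k (.N m) = rowVec k m 2 0 0 0 0 0 0 := by
  funext a; rcases a <;> (simp only [sEntry, rowVec]; norm_num)

lemma sEntry_Nk (hk : 1 ≤ k) (d : ℤˣ) : sEntry k (.Nk d) =
    rowVec k k 1 0 0 ((d : ℤ) * (-Complex.I) ^ k * (√k : ℝ)) 0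
      (-((d : ℤ) * (-Complex.I) ^ k * (√k : ℝ))) 0 := by
  funext a; rcases a <;> simp [sEntry, rowVec, -Complex.ofReal_cos, cos_pi_mul_div' hk]

lemma sEntry_D0 (d : ℤˣ) : sEntry k (.D0 d) =
    rowVec k 0 0 (√k : ℝ) ((-Complex.I) ^ k * (√k : ℝ)) 0
      ((d : ℤ) * (√(k / 2) : ℝ) * (1 + (-Complex.I) ^ k)) 0
      ((d : ℤ) * (√(k / 2) : ℝ) * (1 - (-Complex.I) ^ k)) := by
  funext a; rcases a <;> simp [sEntry, rowVec] <;> ring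

lemma sEntry_Dk (d : ℤˣ) : sEntry k (.Dk d) =
    rowVec k 0 0 (√k : ℝ) (-((-Complex.I) ^ k * (√k : ℝ))) 0
      ((d : ℤ) * (√(k / 2) : ℝ) * (1 - (-Complex.I) ^ k)) 0
      ((d : ℤ) * (√(k / 2) : ℝ) * (1 + (-Complex.I) ^ k)) := by
  funext a; rcases a <;> simp [sEntry, rowVec] <;> ring

lemma sEntry_symm (a b : Label k) : sEntry k a b = sEntry k b a := by
  rcases a <;> rcases b <;> simp only [sEntry] <;> ring_nf

/-- Multiplication by `2 sin(x/2)` makes the sum telescope; over a full period the two ends cancel,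
and `sin(x/2) ≠ 0` unless `2k` divides `r`. -/
lemma sum_cos_range (hk : 1 ≤ k) (r : ℤ) :
    ∑ t ∈ Finset.range (2 * k), Real.cos (Real.pi * r * t / k) =
      if (2 * k : ℤ) ∣ r then (2 * k : ℝ) else 0 := by
  have hk0 : (k : ℝ) ≠ 0 := by positivity
  split_ifs with h
  · obtain ⟨c, rfl⟩ := h
    have : ∀ t ∈ Finset.range (2 * k), Real.cos (Real.pi * (2 * k * c : ℤ) * t / k) = 1 := by
      intro t _
      rw [show Real.pi * (2 * k * c : ℤ) * t / k = (c * t : ℤ) * (2 * Real.pi) by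
        push_cast; field_simp, Real.cos_int_mul_two_pi]
    rw [Finset.sum_congr rfl this]; simp
  · set x : ℝ := Real.pi * r / k
    have hx : Real.sin (x / 2) ≠ 0 := by
      intro h0
      obtain ⟨n, hn⟩ := Real.sin_eq_zero_iff.mp h0
      refine h ⟨n, ?_⟩
      have : (n : ℝ) * Real.pi = Real.pi * r / k / 2 := hn
      field_simp at this
      exact_mod_cast (by linarith : (r : ℝ) = 2 * k * n)
    have key : ∀ n : ℕ, (∑ t ∈ Finset.range n, Real.cos (x * t)) * (2 * Real.sin (x / 2)) =
        Real.sin (x * n - x / 2) + Real.sin (x / 2) := by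
      intro n
      induction n with
      | zero => simp [Real.sin_neg]
      | succ n ih =>
        rw [Finset.sum_range_succ, add_mul, ih]
        have e1 : x * (n + 1 : ℕ) - x / 2 = x * n + x / 2 := by push_cast; ring
        rw [e1, Real.sin_add, Real.sin_sub]; ring
    have h2 := key (2 * k)
    rw [show x * (2 * k : ℕ) - x / 2 = -(x / 2) + r * (2 * Real.pi) by
      simp only [x]; push_cast; field_simp; ring, Real.sin_add_int_mul_two_pi, Real.sin_neg,
      neg_add_cancel] at h2
    have h3 := (mul_eq_zero.mp h2).resolve_right (by simpa using hx)
    rw [← h3]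
    exact Finset.sum_congr rfl fun t _ => by simp only [x]; ring_nf

/-- Orthogonality of characters modulo `2k`, folded to charges from `0` to `k`: the ends have weight
one and the interior weight two, as do the dimensions of the folded classes. -/
lemma sum_cos_mul_cos (hk : 1 ≤ k) (s s' : ℕ) :
    1 + (-1) ^ s * (-1) ^ s' + 2 * ∑ t ∈ Finset.Ioo 0 k,
      Real.cos (Real.pi * s * t / k) * Real.cos (Real.pi * s' * t / k) =
    (if (2 * k : ℤ) ∣ s + s' then (k : ℝ) else 0) + if (2 * k : ℤ) ∣ s - s' then (k : ℝ) else 0 := by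
  have h := sum_range_two_mul_of_even hk
    (g := fun t : ℤ => Real.cos (Real.pi * s * t / k) * Real.cos (Real.pi * s' * t / k))
    (fun t => by push_cast; simp only [cos_mul_neg_div])
    (fun t => by
      have h1 := cos_add_two_mul hk s t
      have h2 := cos_add_two_mul hk s' t
      push_cast at h1 h2 ⊢
      rw [h1, h2])
  simp only [Int.cast_zero, mul_zero, zero_div, Real.cos_zero, Int.cast_natCast, cos_pi_mul_div hk,
    mul_one, nsmul_eq_mul, Nat.cast_ofNat] at h
  rw [← h]
  have h1 := sum_cos_range hk (s + s')
  have h2 := sum_cos_range hk (s - s')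
  have : ∀ t ∈ Finset.range (2 * k),
      Real.cos (Real.pi * s * t / k) * Real.cos (Real.pi * s' * t / k) =
      (Real.cos (Real.pi * (s + s' : ℤ) * t / k) + Real.cos (Real.pi * (s - s' : ℤ) * t / k)) / 2 := by
    intro t _
    rw [show Real.pi * (s + s' : ℤ) * t / k = Real.pi * s * t / k + Real.pi * s' * t / k by
      push_cast; ring, show Real.pi * (s - s' : ℤ) * t / k =
      Real.pi * s * t / k - Real.pi * s' * t / k by push_cast; ring, Real.cos_add, Real.cos_sub]
    ring
  rw [Finset.sum_congr rfl this, ← Finset.sum_div, Finset.sum_add_distrib, h1, h2]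
  split_ifs <;> ring

/-- Summation over a sign kills the products of constant and odd parts. The constant parts at `N0`,
`Nk` and the cosines combine into `sum_cos_mul_cos`. -/
lemma sum_rowVec_mul (hk : 1 ≤ k) (s s' : ℕ) (A B C D E F G A' B' C' D' E' F' G' : ℂ) :
    ∑ j, rowVec k s A B C D E F G j * rowVec k s' A' B' C' D' E' F' G' j =
      2 * (A * A' * ((if (2 * k : ℤ) ∣ s + s' then (k : ℂ) else 0) +
        (if (2 * k : ℤ) ∣ s - s' then (k : ℂ) else 0)) + B * B' + C * C' + D * D' + E * E' +
        F * F' + G * G') := by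
  have h := congrArg (fun x : ℝ => (x : ℂ)) (sum_cos_mul_cos hk s s')
  simp only [apply_ite Complex.ofReal, Complex.ofReal_add, Complex.ofReal_mul, Complex.ofReal_sum,
    Complex.ofReal_pow, Complex.ofReal_neg, Complex.ofReal_one, Complex.ofReal_natCast,
    Complex.ofReal_zero, Complex.ofReal_ofNat] at h
  rw [← h, sum_label]
  simp only [rowVec]
  have h2 : ∑ m : Finset.Ioo 0 k, 2 * A * ((Real.cos (Real.pi * s * (m : ℕ) / k) : ℝ) : ℂ) *
      (2 * A' * ((Real.cos (Real.pi * s' * (m : ℕ) / k) : ℝ) : ℂ)) =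
      4 * A * A' * ∑ m ∈ Finset.Ioo 0 k, ((Real.cos (Real.pi * s * (m : ℕ) / k) : ℝ) : ℂ) *
        ((Real.cos (Real.pi * s' * (m : ℕ) / k) : ℝ) : ℂ) := by
    rw [← Finset.sum_coe_sort (Finset.Ioo 0 k), Finset.mul_sum]
    exact Finset.sum_congr rfl fun m _ => by ring
  rw [h2]
  push_cast
  ring

end OrbifoldBoundary

namespace OrbifoldBoundary

/-! ## Unitarity and modular transformation -/

variable {k : ℕ} {β : ℝ}

lemma unit_cast_mul_self (e : ℤˣ) : ((e : ℤ) : ℂ) * ((e : ℤ) : ℂ) = 1 := by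
  rcases Int.units_eq_one_or e with rfl | rfl <;> simp

lemma neg_I_pow_mul_self (k : ℕ) : (-Complex.I) ^ k * (-Complex.I) ^ k = (-1) ^ k := by
  rw [← mul_pow]; simp

/-- The number `(-i)^k` is real for even and imaginary for odd `k`; this is the origin of the
nontrivial charge conjugation. -/
lemma neg_I_pow_cases (k : ℕ) :
    (Even k ∧ (-Complex.I) ^ k * (-Complex.I) ^ k = 1 ∧
      starRingEnd ℂ ((-Complex.I) ^ k) = (-Complex.I) ^ k) ∨
    (¬ Even k ∧ (-Complex.I) ^ k * (-Complex.I) ^ k = -1 ∧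
      starRingEnd ℂ ((-Complex.I) ^ k) = -(-Complex.I) ^ k) := by
  rcases Nat.even_or_odd k with h | h
  · refine Or.inl ⟨h, by rw [neg_I_pow_mul_self, h.neg_one_pow], ?_⟩
    simp [h.neg_pow]
  · refine Or.inr ⟨Nat.not_even_iff_odd.mpr h, by rw [neg_I_pow_mul_self, h.neg_one_pow], ?_⟩
    simp [h.neg_pow]

lemma ofReal_sqrt_mul_self {x : ℝ} (hx : 0 ≤ x) : ((√x : ℝ) : ℂ) * ((√x : ℝ) : ℂ) = x := by
  rw [← Complex.ofReal_mul, Real.mul_self_sqrt hx]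

lemma sqrt_cast_mul_self (k : ℕ) : ((√k : ℝ) : ℂ) * ((√k : ℝ) : ℂ) = k := by
  rw [ofReal_sqrt_mul_self (by positivity), Complex.ofReal_natCast]

lemma sqrt_half_mul_self (k : ℕ) : ((√(k / 2) : ℝ) : ℂ) * ((√(k / 2) : ℝ) : ℂ) = k / 2 := by
  rw [ofReal_sqrt_mul_self (by positivity)]; push_cast; ring

lemma sqrt_eight_mul_self (k : ℕ) : ((√(8 * k) : ℝ) : ℂ) * ((√(8 * k) : ℝ) : ℂ) = 8 * k := by
  rw [ofReal_sqrt_mul_self (by positivity)]; push_cast; ring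

lemma not_two_mul_dvd_of_pos_of_lt {k : ℕ} {r : ℤ} (h0 : r ≠ 0) (h1 : -(2 * k) < r) (h2 : r < 2 * k) :
    ¬ (2 * k : ℤ) ∣ r := fun h => h0 (Int.eq_zero_of_abs_lt_dvd h (abs_lt.mpr ⟨h1, h2⟩))

lemma conj_sEntry (a b : Label k) : starRingEnd ℂ (sEntry k a b) = sEntry k (dual k a) b := by
  rcases neg_I_pow_cases k with ⟨hk, h1, h2⟩ | ⟨hk, h1, h2⟩ <;>
    rcases a <;> rcases b <;> simp only [dual, hk, sEntry, map_mul, map_add, map_sub, map_one,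
      map_neg, h2, Complex.conj_ofReal, map_ofNat, map_pow, map_intCast, if_true, if_false,
      map_zero, Units.val_neg, Int.cast_neg, sub_neg_eq_add] <;> ring

lemma dual_dual (a : Label k) : dual k (dual k a) = a := by
  rcases a with e | m | e | e | e <;> by_cases h : Even k <;> simp [dual, h]

lemma units_ne_neg_self (e : ℤˣ) : e ≠ -e := by
  rcases Int.units_eq_one_or e with rfl | rfl <;> decide

lemma neg_units_ne_self (e : ℤˣ) : -e ≠ e := (units_ne_neg_self e).symm

/-- This is `S Sᵀ` without its normalization. It is computed rather than `S S*` because the rows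
multiply without conjugation; `conj_sEntry` converts it to unitarity. The divisibility facts decide
which terms of the cosine orthogonality survive. -/
lemma sum_sEntry_mul (hk : 1 ≤ k) (a b : Label k) :
    ∑ j, sEntry k a j * sEntry k b j = if b = dual k a then 8 * (k : ℂ) else 0 := by
  have hk' : (2 * (k : ℤ)) ≠ 0 := by positivity
  have d1 : ¬ (2 * k : ℤ) ∣ k := not_two_mul_dvd_of_pos_of_lt (by omega) (by omega) (by omega)
  have d2 : (2 * k : ℤ) ∣ k + k := ⟨1, by ring⟩
  have d3 : ∀ m : Finset.Ioo 0 k, ¬ (2 * k : ℤ) ∣ (m : ℕ) := fun m => by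
    have := Finset.mem_Ioo.mp m.2
    exact not_two_mul_dvd_of_pos_of_lt (by omega) (by omega) (by omega)
  have d4 : ∀ m : Finset.Ioo 0 k, ¬ (2 * k : ℤ) ∣ (m : ℕ) + k := fun m => by
    have := Finset.mem_Ioo.mp m.2
    exact not_two_mul_dvd_of_pos_of_lt (by omega) (by omega) (by omega)
  have d5 : ∀ m : Finset.Ioo 0 k, ¬ (2 * k : ℤ) ∣ (m : ℕ) - k := fun m => by
    have := Finset.mem_Ioo.mp m.2
    exact not_two_mul_dvd_of_pos_of_lt (by omega) (by omega) (by omega)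
  have d6 : ∀ m n : Finset.Ioo 0 k, ¬ (2 * k : ℤ) ∣ (m : ℕ) + (n : ℕ) := fun m n => by
    have := Finset.mem_Ioo.mp m.2
    have := Finset.mem_Ioo.mp n.2
    exact not_two_mul_dvd_of_pos_of_lt (by omega) (by omega) (by omega)
  have d7 : ∀ m n : Finset.Ioo 0 k, (2 * k : ℤ) ∣ (m : ℕ) - (n : ℕ) ↔ n = m := fun m n => by
    have := Finset.mem_Ioo.mp m.2
    have := Finset.mem_Ioo.mp n.2
    constructor
    · intro h
      by_contra hne
      refine not_two_mul_dvd_of_pos_of_lt ?_ (by omega) (by omega) h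
      intro h0
      exact hne (Subtype.ext (by omega))
    · rintro rfl
      simp
  have d8 : ∀ m : Finset.Ioo 0 k, ¬ (2 * k : ℤ) ∣ k + (m : ℕ) := fun m => by
    rw [add_comm]; exact d4 m
  have d9 : ∀ m : Finset.Ioo 0 k, ¬ (2 * k : ℤ) ∣ k - (m : ℕ) := fun m => by
    rw [← dvd_neg, neg_sub]; exact d5 m
  have q1 := sqrt_cast_mul_self k
  have q2 := sqrt_half_mul_self k
  rcases neg_I_pow_cases k with ⟨he, h1, h2⟩ | ⟨he, h1, h2⟩ <;>
    rcases a with d | m | d | d | d <;> rcases b with e | n | e | e | e <;>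
    simp only [sEntry_N0, sEntry_N, sEntry_Nk hk, sEntry_D0, sEntry_Dk, sum_rowVec_mul hk, dual, he,
      if_true, if_false, Label.N0.injEq, Label.N.injEq, Label.Nk.injEq, Label.D0.injEq,
      Label.Dk.injEq, reduceCtorEq, d1, d2, d3, d4, d5, d6, d7, d8, d9, Nat.cast_zero, add_zero,
      zero_add, sub_zero, zero_sub, dvd_neg, sub_self, dvd_zero, mul_zero, zero_mul]
  -- What remains are polynomial identities in `σ`, `x`, `y` with `σ² = ±1`, `x² = k`, `y² = k/2`.
  all_goals
    generalize (-Complex.I) ^ k = σ at h1 h2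
    generalize ((√k : ℝ) : ℂ) = x at q1
    generalize ((√(k / 2) : ℝ) : ℂ) = y at q2
    try rcases Int.units_eq_one_or d with rfl | rfl
    all_goals try rcases Int.units_eq_one_or e with rfl | rfl
    all_goals try simp only [Units.val_one, Units.val_neg, Int.cast_one, Int.cast_neg, neg_neg,
      if_true, if_false, neg_units_ne_self, units_ne_neg_self]
    all_goals grind

/-! ### The normalized modular matrix -/

lemma sqrt_eight_pos (hk : 1 ≤ k) : 0 < √(8 * k : ℝ) := Real.sqrt_pos.mpr (by positivity)

lemma sqrt_eight_ne_zero (hk : 1 ≤ k) : ((√(8 * k) : ℝ) : ℂ) ≠ 0 :=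
  Complex.ofReal_ne_zero.mpr (sqrt_eight_pos hk).ne'

lemma modularS_symm (a b : Label k) : modularS k a b = modularS k b a := by
  simp only [modularS, Matrix.of_apply, sEntry_symm a b]

lemma isSymm_modularS (k : ℕ) : (modularS k).IsSymm := by
  ext a b
  exact modularS_symm b a

lemma conj_modularS (a b : Label k) :
    starRingEnd ℂ (modularS k a b) = modularS k (dual k a) b := by
  simp only [modularS, Matrix.of_apply, map_div₀, conj_sEntry, Complex.conj_ofReal]

lemma sum_modularS_mul (hk : 1 ≤ k) (a b : Label k) :
    ∑ j, modularS k a j * modularS k b j = if b = dual k a then 1 else 0 := by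
  have h := sum_sEntry_mul hk a b
  have h8 : (8 * k : ℂ) ≠ 0 := by simp; omega
  have : ∀ j, modularS k a j * modularS k b j = sEntry k a j * sEntry k b j / (8 * k) := fun j => by
    simp only [modularS, Matrix.of_apply]
    rw [div_mul_div_comm, sqrt_eight_mul_self]
  simp only [this]
  rw [← Finset.sum_div, h]
  split_ifs
  · exact div_self h8
  · exact zero_div _

lemma modularS_mul_self (hk : 1 ≤ k) :
    modularS k * modularS k = Matrix.of (fun a b => if b = dual k a then 1 else 0) := by
  ext a b
  simp only [Matrix.mul_apply, Matrix.of_apply]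
  rw [← sum_modularS_mul hk a b]
  exact Finset.sum_congr rfl fun j _ => by rw [modularS_symm j b]

lemma dual_injective {a b : Label k} (h : dual k a = dual k b) : a = b := by
  rw [← dual_dual a, h, dual_dual]

lemma sum_modularS_mul_conj (hk : 1 ≤ k) (a b : Label k) :
    ∑ j, modularS k a j * starRingEnd ℂ (modularS k b j) = if a = b then 1 else 0 := by
  simp only [conj_modularS]
  rw [sum_modularS_mul hk]
  exact if_congr ⟨fun h => (dual_injective h).symm, fun h => h ▸ rfl⟩ rfl rfl

lemma modularS_mem_unitaryGroup (hk : 1 ≤ k) :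
    modularS k ∈ Matrix.unitaryGroup (Label k) ℂ := by
  rw [Matrix.mem_unitaryGroup_iff]
  ext a b
  simp only [Matrix.mul_apply, Matrix.star_apply, Matrix.one_apply]
  exact sum_modularS_mul_conj hk a b

lemma modularS_vac_pos (hk : 1 ≤ k) (j : Label k) :
    ∃ r : ℝ, 0 < r ∧ modularS k (vac k) j = (r : ℂ) := by
  have h := sqrt_eight_pos hk
  have hk' : 0 < √(k : ℝ) := Real.sqrt_pos.mpr (by positivity)
  have h1 : (0 : ℝ) < 1 / √(8 * k : ℝ) := by positivity
  have h2 : (0 : ℝ) < 2 / √(8 * k : ℝ) := by positivity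
  have h3 : (0 : ℝ) < √(k : ℝ) / √(8 * k : ℝ) := by positivity
  rcases j with e | m | e | e | e
  exacts [⟨_, h1, by simp [modularS, vac, sEntry]⟩, ⟨_, h2, by simp [modularS, vac, sEntry]⟩,
    ⟨_, h1, by simp [modularS, vac, sEntry]⟩, ⟨_, h3, by simp [modularS, vac, sEntry]⟩,
    ⟨_, h3, by simp [modularS, vac, sEntry]⟩]

/-! ### Modular transformation of the extended characters -/

lemma extChar_N0 (e : ℤˣ) (q : ℝ) : extChar k (.N0 e) q =
    1 / 2 * circleChar k 0 q + ((e : ℤ) : ℝ) * (1 / 2 * chiC q) := by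
  simp only [extChar, vacChar]; ring

lemma extChar_D0 (e : ℤˣ) (q : ℝ) : extChar k (.D0 e) q = 1 / 2 * (twChar 1 q + twChar (-1) q) +
    ((e : ℤ) : ℝ) * (1 / 2 * (twChar 1 q - twChar (-1) q)) := by
  simp only [extChar]; rw [twChar_unit]; ring

lemma extChar_Dk (e : ℤˣ) (q : ℝ) : extChar k (.Dk e) q = 1 / 2 * (twChar 1 q + twChar (-1) q) +
    ((e : ℤ) : ℝ) * (1 / 2 * (twChar 1 q - twChar (-1) q)) := extChar_D0 (k := k) e q

/-- The characters are affine in the signs, so a row only sees `χ_c`, `χ_+ ± χ_-` and a cosine sum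
of circle characters. The coefficient `C` drops out, as both fields `Nk` have the same character. -/
lemma sum_rowVec_mul_extChar (s : ℕ) (A B C D E F G : ℂ) (q : ℝ) :
    ∑ b, rowVec k s A B C D E F G b * (extChar k b q : ℂ) =
      A * ((circleChar k 0 q + (-1) ^ s * circleChar k k q + 2 * ∑ t ∈ Finset.Ioo 0 k,
        Real.cos (Real.pi * s * t / k) * circleChar k (t : ℕ) q : ℝ) : ℂ) + B * (chiC q : ℂ) +
      (D + F) * ((twChar 1 q + twChar (-1) q : ℝ) : ℂ) +
      (E + G) * ((twChar 1 q - twChar (-1) q : ℝ) : ℂ) := by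
  rw [sum_label]
  have h : ∑ m : Finset.Ioo 0 k, rowVec k s A B C D E F G (.N m) * (extChar k (.N m) q : ℂ) =
      2 * A * ((∑ t ∈ Finset.Ioo 0 k,
        Real.cos (Real.pi * s * t / k) * circleChar k (t : ℕ) q : ℝ) : ℂ) := by
    rw [← Finset.sum_coe_sort (Finset.Ioo 0 k), Complex.ofReal_sum, Finset.mul_sum]
    exact Finset.sum_congr rfl fun m _ => by
      simp only [rowVec, extChar, Complex.ofReal_mul]; ring
  have hk : ∀ e : ℤˣ, extChar k (.Nk e) q = circleChar k k q / 2 := fun _ => rfl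
  rw [h]
  simp only [extChar_N0, extChar_D0, extChar_Dk, hk, rowVec]
  generalize ∑ t ∈ Finset.Ioo 0 k, Real.cos (Real.pi * s * t / k) * circleChar k (t : ℕ) q = x
  push_cast
  ring

/-- After multiplication by `√(8k)` each row reduces to the transformations of the circle
characters, of `χ_c`, and of `χ_+ ± χ_-`; the last do not mix with each other. -/
lemma extChar_qClosed (hk : 1 ≤ k) (hβ : 0 < β) (a : Label k) :
    (extChar k a (qClosed β) : ℂ) = ∑ b, modularS k a b * (extChar k b (qOpen β) : ℂ) := by
  have key : ((√(8 * k) : ℝ) : ℂ) * (extChar k a (qClosed β) : ℂ) =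
      ∑ b, sEntry k a b * (extChar k b (qOpen β) : ℂ) := by
    have h2k : (0 : ℝ) < √(2 * k) := Real.sqrt_pos.mpr (by positivity)
    have h8 : √(8 * k : ℝ) = 2 * √(2 * k) := by
      rw [show (8 * k : ℝ) = 2 ^ 2 * (2 * k) by ring, Real.sqrt_mul (by norm_num),
        Real.sqrt_sq (by norm_num)]
    have h8' : √(8 * k : ℝ) = 2 * √2 * √k := by
      rw [h8, Real.sqrt_mul (by norm_num)]; ring
    have hhalf : √(8 * k : ℝ) = 4 * √(k / 2) := by
      rw [show (8 * k : ℝ) = 4 ^ 2 * (k / 2) by ring, Real.sqrt_mul (by norm_num),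
        Real.sqrt_sq (by norm_num)]
    have h2 : √2 * √2 = (2 : ℝ) := Real.mul_self_sqrt (by norm_num)
    have circ : ∀ s : ℕ, √(8 * k : ℝ) * circleChar k s (qClosed β) =
        2 * (circleChar k 0 (qOpen β) + (-1) ^ s * circleChar k k (qOpen β) +
          2 * ∑ t ∈ Finset.Ioo 0 k,
            Real.cos (Real.pi * s * t / k) * circleChar k (t : ℕ) (qOpen β)) := fun s => by
      have h := circleChar_qClosed hk s hβ
      simp only [Int.cast_natCast, zpow_natCast] at h
      rw [h, h8, ← mul_assoc]
      congr 1
      field_simp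
    have hc : √(8 * k : ℝ) * chiC (qClosed β) =
        4 * √k * (twChar 1 (qOpen β) + twChar (-1) (qOpen β)) := by
      rw [chiC_qClosed hβ, h8']
      linear_combination (2 * √k * (twChar 1 (qOpen β) + twChar (-1) (qOpen β))) * h2
    have ht : √(8 * k : ℝ) * (twChar 1 (qClosed β) + twChar (-1) (qClosed β)) =
        2 * √k * chiC (qOpen β) := by
      rw [twChar_add_qClosed hβ, h8']
      field_simp
    have ht' : √(8 * k : ℝ) * (twChar 1 (qClosed β) - twChar (-1) (qClosed β)) =
        4 * √(k / 2) * (twChar 1 (qOpen β) - twChar (-1) (qOpen β)) := by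
      rw [twChar_sub_qClosed hβ, hhalf]
    have circ0 := circ 0
    rw [Nat.cast_zero] at circ0
    have cast : ∀ {x y : ℝ}, x = y → (x : ℂ) = (y : ℂ) := fun h => congrArg _ h
    rcases a with d | m | d | d | d
    · rw [sEntry_N0, sum_rowVec_mul_extChar, extChar_N0]
      have h1 := cast circ0
      have h2 := cast hc
      push_cast at h1 h2 ⊢
      linear_combination 1 / 2 * h1 + ((d : ℤ) : ℂ) * (1 / 2) * h2
    · rw [sEntry_N, sum_rowVec_mul_extChar]
      have h1 := cast (circ m)
      simp only [extChar]
      push_cast at h1 ⊢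
      linear_combination h1
    · rw [sEntry_Nk hk, sum_rowVec_mul_extChar]
      have h1 := cast (circ k)
      simp only [extChar, midChar]
      push_cast at h1 ⊢
      linear_combination 1 / 2 * h1
    · rw [sEntry_D0, sum_rowVec_mul_extChar, extChar_D0]
      have h1 := cast ht
      have h2 := cast ht'
      push_cast at h1 h2 ⊢
      linear_combination 1 / 2 * h1 + ((d : ℤ) : ℂ) * (1 / 2) * h2
    · rw [sEntry_Dk, sum_rowVec_mul_extChar, extChar_Dk]
      have h1 := cast ht
      have h2 := cast ht'
      push_cast at h1 h2 ⊢
      linear_combination 1 / 2 * h1 + ((d : ℤ) : ℂ) * (1 / 2) * h2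
  have h8 := sqrt_eight_ne_zero hk
  rw [← mul_right_inj' h8, key, Finset.mul_sum]
  refine Finset.sum_congr rfl fun b _ => ?_
  simp only [modularS, Matrix.of_apply]
  field_simp

end OrbifoldBoundary

namespace OrbifoldBoundary

/-! ## Fusion rules -/

variable {k : ℕ} {β : ℝ}

/-- The extended fields contained in the circle field of charge `s ≤ k`. -/
def circFields (k s : ℕ) : Multiset (Label k) :=
  if h : s ∈ Finset.Ioo 0 k then {.N ⟨s, h⟩} else if s = 0 then {.N0 1, .N0 (-1)}
  else {.Nk 1, .Nk (-1)}

/-- The fields of charge `0 < s < k` and of parity `p`. -/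
def parityFields (k p : ℕ) : Multiset (Label k) :=
  (Finset.univ.filter fun m : Finset.Ioo 0 k => (m : ℕ) % 2 = p).val.map .N

/-- The product of two fields of the orbifold, as a multiset of fields. -/
def fusionFields (k : ℕ) : Label k → Label k → Multiset (Label k)
  | .N0 d, .N0 e => {.N0 (d * e)}
  | .N0 _, .N m => {.N m}
  | .N0 d, .Nk e => {.Nk (d * e)}
  | .N0 d, .D0 e => {.D0 (d * e)}
  | .N0 d, .Dk e => {.Dk (d * e)}
  | .N m, .N0 _ => {.N m}
  | .N m, .N n => circFields k ((m : ℤ) - (n : ℤ)).natAbs +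
      circFields k (if (m : ℕ) + n ≤ k then m + n else 2 * k - (m + n))
  | .N m, .Nk _ => circFields k (k - m)
  | .N m, .D0 _ => if Even (m : ℕ) then {.D0 1, .D0 (-1)} else {.Dk 1, .Dk (-1)}
  | .N m, .Dk _ => if Even (m : ℕ) then {.Dk 1, .Dk (-1)} else {.D0 1, .D0 (-1)}
  | .Nk d, .N0 e => {.Nk (d * e)}
  | .Nk _, .N m => circFields k (k - m)
  | .Nk d, .Nk e => if Even k then {.N0 (d * e)} else {.N0 (-(d * e))}
  | .Nk d, .D0 e => if Even k then {.D0 (d * e)} else {.Dk (-(d * e))}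
  | .Nk d, .Dk e => if Even k then {.Dk (-(d * e))} else {.D0 (d * e)}
  | .D0 d, .N0 e => {.D0 (d * e)}
  | .D0 _, .N m => if Even (m : ℕ) then {.D0 1, .D0 (-1)} else {.Dk 1, .Dk (-1)}
  | .D0 d, .Nk e => if Even k then {.D0 (d * e)} else {.Dk (-(d * e))}
  | .D0 d, .D0 e => if Even k then {.N0 (d * e), .Nk (d * e)} + parityFields k 0
      else {.Nk (d * e)} + parityFields k 1
  | .D0 d, .Dk e => if Even k then parityFields k 1 else {.N0 (d * e)} + parityFields k 0
  | .Dk d, .N0 e => {.Dk (d * e)}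
  | .Dk _, .N m => if Even (m : ℕ) then {.Dk 1, .Dk (-1)} else {.D0 1, .D0 (-1)}
  | .Dk d, .Nk e => if Even k then {.Dk (-(d * e))} else {.D0 (d * e)}
  | .Dk d, .D0 e => if Even k then parityFields k 1 else {.N0 (d * e)} + parityFields k 0
  | .Dk d, .Dk e => if Even k then {.N0 (d * e), .Nk (-(d * e))} + parityFields k 0
      else {.Nk (-(d * e))} + parityFields k 1

/-- The fusion multiplicities. -/
def fusionMult (k : ℕ) (a b c : Label k) : ℕ := (fusionFields k a b).count c

lemma sum_count_mul (M : Multiset (Label k)) (f : Label k → ℂ) :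
    ∑ c, (M.count c : ℂ) * f c = (M.map f).sum := by
  induction M using Multiset.induction with
  | empty => simp
  | cons a M ih =>
    rw [Multiset.map_cons, Multiset.sum_cons, ← ih]
    simp [Multiset.count_cons, add_mul, Finset.sum_add_distrib, add_comm]

/-- The circle fields of charge `0` and `k` split into two orbifold fields. The lemma is applied
both to characters and to quotients of the modular matrix. -/
lemma sum_circFields (f : Label k → ℂ) (g : ℕ → ℂ) (h0 : f (.N0 1) + f (.N0 (-1)) = g 0)
    (hm : ∀ m : Finset.Ioo 0 k, f (.N m) = g m) (h1 : f (.Nk 1) + f (.Nk (-1)) = g k)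
    {s : ℕ} (hs : s ≤ k) : ((circFields k s).map f).sum = g s := by
  unfold circFields
  split_ifs with h h'
  · simp [hm]
  · subst h'; simp [h0]
  · have : s = k := by simp at h; omega
    subst this; simp [h1]

lemma sum_parityFields (f : Label k → ℂ) (g : ℕ → ℂ) (hm : ∀ m : Finset.Ioo 0 k, f (.N m) = g m)
    (p : ℕ) : ((parityFields k p).map f).sum = ∑ s ∈ Finset.Ioo 0 k with s % 2 = p, g s := by
  rw [parityFields, Multiset.map_map]
  change ∑ m ∈ Finset.univ.filter (fun m : Finset.Ioo 0 k => (m : ℕ) % 2 = p), f (.N m) = _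
  rw [Finset.sum_filter, Finset.sum_filter, ← Finset.sum_coe_sort (Finset.Ioo 0 k)]
  exact Finset.sum_congr rfl fun m _ => by rw [hm]

/-- The characters `a ↦ S_{aj} / S_{0j}` for a field `j` of the untwisted sector. -/
noncomputable def untwistedQuot (k s : ℕ) (u v : ℂ) : Label k → ℂ
  | .N0 _ => 1
  | .N m => 2 * (Real.cos (Real.pi * s * (m : ℕ) / k) : ℝ)
  | .Nk _ => (-1) ^ s
  | .D0 _ => u
  | .Dk _ => v

/-- The characters `a ↦ S_{aj} / S_{0j}` for a field `j` of the twisted sector. -/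
noncomputable def twistedQuot (k : ℕ) (τ u v : ℂ) : Label k → ℂ
  | .N0 d => (d : ℤ)
  | .N _ => 0
  | .Nk d => (d : ℤ) * τ
  | .D0 d => (d : ℤ) * u
  | .Dk d => (d : ℤ) * v

/-- The quotient is odd in the sign and vanishes on `N m`, so pairs of opposite signs and whole
parity classes contribute nothing. The hypotheses are the products that remain; they hold for `τ² =
(-1)^k` and `u, v = ±(1 ± τ)/√2` with a common outer sign. -/
lemma sum_fusionFields_twistedQuot {τ u v : ℂ} (hτ : τ * τ = if Even k then 1 else -1)
    (hu : 2 * (u * u) = (1 + τ) * (1 + τ)) (hv : 2 * (v * v) = (1 - τ) * (1 - τ))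
    (huv : 2 * (u * v) = (1 + τ) * (1 - τ)) (hτu : τ * u = if Even k then u else -v)
    (hτv : τ * v = if Even k then -v else u) (a b : Label k) :
    ((fusionFields k a b).map (twistedQuot k τ u v)).sum =
      twistedQuot k τ u v a * twistedQuot k τ u v b := by
  have hc : ∀ s ≤ k, ((circFields k s).map (twistedQuot k τ u v)).sum = 0 := fun s hs =>
    sum_circFields _ (fun _ => 0) (by simp [twistedQuot]) (fun _ => rfl) (by simp [twistedQuot]) hs
  have hp : ∀ p, ((parityFields k p).map (twistedQuot k τ u v)).sum = 0 := fun p => by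
    rw [sum_parityFields _ (fun _ => 0) (fun _ => rfl)]; simp
  have hd : ∀ m n : Finset.Ioo 0 k, ((m : ℤ) - (n : ℤ)).natAbs ≤ k := fun m n => by
    have := Finset.mem_Ioo.mp m.2
    have := Finset.mem_Ioo.mp n.2
    omega
  have hs : ∀ m n : Finset.Ioo 0 k, (if (m : ℕ) + n ≤ k then (m + n : ℕ) else 2 * k - (m + n)) ≤ k :=
    fun m n => by split_ifs <;> omega
  have hk : ∀ m : Finset.Ioo 0 k, k - (m : ℕ) ≤ k := fun m => Nat.sub_le _ _
  by_cases he : Even k <;> simp only [he, if_true, if_false] at hτ hτu hτv <;>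
    rcases a with d | m | d | d | d <;> rcases b with e | n | e | e | e <;>
    simp only [fusionFields, he, if_true, if_false, Multiset.map_add, Multiset.sum_add, hc _ (hd _ _),
      hc _ (hs _ _), hc _ (hk _), hp, Multiset.map_singleton, Multiset.sum_singleton, twistedQuot,
      mul_zero, zero_mul, add_zero, Units.val_mul, Units.val_neg, Int.cast_mul, Int.cast_neg,
      Multiset.insert_eq_cons, Multiset.map_cons, Multiset.sum_cons]
  all_goals try grind
  all_goals try (split_ifs <;> simp [twistedQuot])

lemma sum_parity_add (F : ℕ → ℝ) :
    ∑ t ∈ Finset.Ioo 0 k with t % 2 = 0, F t + ∑ t ∈ Finset.Ioo 0 k with t % 2 = 1, F t =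
      ∑ t ∈ Finset.Ioo 0 k, F t := by
  rw [← Finset.sum_filter_add_sum_filter_not (Finset.Ioo 0 k) (fun t => t % 2 = 0)]
  simp only [Nat.mod_two_ne_zero]

lemma sum_cos_parity (hk : 1 ≤ k) (s : ℕ) :
    ∑ t ∈ Finset.Ioo 0 k with t % 2 = 0, 2 * Real.cos (Real.pi * s * t / k) +
      ∑ t ∈ Finset.Ioo 0 k with t % 2 = 1, 2 * Real.cos (Real.pi * s * t / k) =
      (if (2 * k : ℤ) ∣ s then 2 * (k : ℝ) else 0) - (1 + (-1) ^ s) := by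
  have h := sum_cos_mul_cos hk s 0
  rw [sum_parity_add, ← Finset.mul_sum]
  simp only [Nat.cast_zero, mul_zero, zero_mul, zero_div, Real.cos_zero, mul_one, pow_zero, add_zero,
    sub_zero] at h
  split_ifs at h ⊢ <;> linarith

/-- As `(-1)^t = cos(πkt/k)`, this is orthogonality against charge `k`; against charge `0` it gives
the sum of the two classes. -/
lemma sum_cos_parity_sub (hk : 1 ≤ k) (s : ℕ) :
    ∑ t ∈ Finset.Ioo 0 k with t % 2 = 0, 2 * Real.cos (Real.pi * s * t / k) -
      ∑ t ∈ Finset.Ioo 0 k with t % 2 = 1, 2 * Real.cos (Real.pi * s * t / k) =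
      (if (2 * k : ℤ) ∣ s + k then (k : ℝ) else 0) + (if (2 * k : ℤ) ∣ s - k then (k : ℝ) else 0) -
        (1 + (-1) ^ s * (-1) ^ k) := by
  have h := sum_cos_mul_cos hk s k
  have h2 := sum_parity_add (k := k) (fun t => 2 * (Real.cos (Real.pi * s * t / k) * (-1) ^ t))
  rw [← Finset.mul_sum (Finset.Ioo 0 k)] at h2
  simp only [cos_pi_mul_div' hk] at h
  rw [← h, add_sub_cancel_left, ← h2, sub_eq_add_neg, ← Finset.sum_neg_distrib]
  refine congrArg₂ _ (Finset.sum_congr rfl fun t ht => ?_) (Finset.sum_congr rfl fun t ht => ?_)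
  · rw [(Nat.even_iff.mpr (Finset.mem_filter.mp ht).2).neg_one_pow, mul_one]
  · rw [(Nat.odd_iff.mpr (Finset.mem_filter.mp ht).2).neg_one_pow]; ring

/-- The product formula for cosines, with difference and sum of the charges folded back to the range
up to `k`. -/
lemma cos_natAbs_add (hk : 1 ≤ k) (s : ℕ) (m n : ℕ) (h : m + n ≤ 2 * k) :
    Real.cos (Real.pi * s * ((m : ℤ) - (n : ℤ)).natAbs / k) +
      Real.cos (Real.pi * s * (if m + n ≤ k then m + n else 2 * k - (m + n) : ℕ) / k) =
    2 * (Real.cos (Real.pi * s * m / k) * Real.cos (Real.pi * s * n / k)) := by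
  have e1 : Real.cos (Real.pi * s * ((m : ℤ) - (n : ℤ)).natAbs / k) =
      Real.cos (Real.pi * s * m / k - Real.pi * s * n / k) := by
    rw [Nat.cast_natAbs, Int.cast_abs]
    rcases abs_choice (((m : ℤ) - (n : ℤ) : ℤ) : ℝ) with h | h <;> rw [h]
    · push_cast; ring_nf
    · rw [cos_mul_neg_div]; push_cast; ring_nf
  have e2 : Real.cos (Real.pi * s * (if m + n ≤ k then m + n else 2 * k - (m + n) : ℕ) / k) =
      Real.cos (Real.pi * s * m / k + Real.pi * s * n / k) := by
    split_ifs with h'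
    · push_cast; ring_nf
    · have hk' : (k : ℝ) ≠ 0 := by positivity
      rw [← Real.cos_nat_mul_two_pi_sub _ s]
      congr 1
      rw [Nat.cast_sub h]
      push_cast
      field_simp
      ring
  rw [e1, e2, Real.cos_sub, Real.cos_add]
  ring

lemma cos_sub_div (hk : 1 ≤ k) (s m : ℕ) (h : m ≤ k) :
    Real.cos (Real.pi * s * (k - m : ℕ) / k) = (-1) ^ s * Real.cos (Real.pi * s * m / k) := by
  have hk' : (k : ℝ) ≠ 0 := by positivity
  rw [← Real.cos_nat_mul_pi_sub]
  congr 1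
  rw [Nat.cast_sub h]
  field_simp

/-- The three alternatives for `s`, `u`, `v` are the columns `N0`, `Nk` and `N m`. On charges the
product rule is that of cosines; the products of two twisted fields need sums of cosines over a
parity class. -/
lemma sum_fusionFields_untwistedQuot (hk : 1 ≤ k) {s : ℕ} {u v : ℂ}
    (hs : (s = 0 ∧ u * u = k ∧ v = u) ∨ (s = k ∧ u * u = (-1) ^ k * k ∧ v = -u) ∨
      (0 < s ∧ s < k ∧ u = 0 ∧ v = 0)) (a b : Label k) :
    ((fusionFields k a b).map (untwistedQuot k s u v)).sum =
      untwistedQuot k s u v a * untwistedQuot k s u v b := by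
  set g : ℕ → ℂ := fun t => 2 * (Real.cos (Real.pi * s * t / k) : ℝ) with hg
  have hc : ∀ t ≤ k, ((circFields k t).map (untwistedQuot k s u v)).sum = g t := fun t ht =>
    sum_circFields _ g (by simp [untwistedQuot, hg]; norm_num) (fun _ => rfl)
      (by simp only [untwistedQuot, hg, cos_pi_mul_div hk]; push_cast; ring) ht
  have hp : ∀ p, ((parityFields k p).map (untwistedQuot k s u v)).sum =
      ((∑ t ∈ Finset.Ioo 0 k with t % 2 = p, 2 * Real.cos (Real.pi * s * t / k) : ℝ) : ℂ) :=
    fun p => by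
      rw [sum_parityFields _ g (fun _ => rfl)]
      push_cast
      simp [hg]
  have hd : ∀ m n : Finset.Ioo 0 k, ((m : ℤ) - (n : ℤ)).natAbs ≤ k := fun m n => by
    have := Finset.mem_Ioo.mp m.2
    have := Finset.mem_Ioo.mp n.2
    omega
  have hs' : ∀ m n : Finset.Ioo 0 k, (if (m : ℕ) + n ≤ k then (m + n : ℕ) else 2 * k - (m + n)) ≤ k :=
    fun m n => by split_ifs <;> omega
  have hk' : ∀ m : Finset.Ioo 0 k, k - (m : ℕ) ≤ k := fun m => Nat.sub_le _ _
  have hmn : ∀ m n : Finset.Ioo 0 k, g ((m : ℤ) - (n : ℤ)).natAbs +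
      g (if (m : ℕ) + n ≤ k then m + n else 2 * k - (m + n)) = g m * g n := fun m n => by
    have h1 := Finset.mem_Ioo.mp m.2
    have h2 := Finset.mem_Ioo.mp n.2
    have := congrArg (fun x : ℝ => (x : ℂ)) (cos_natAbs_add hk s m n (by omega))
    simp only [Complex.ofReal_add, Complex.ofReal_mul, Complex.ofReal_ofNat] at this
    simp only [hg]
    linear_combination 2 * this
  have hmk : ∀ m : Finset.Ioo 0 k, g (k - m) = (-1) ^ s * g m := fun m => by
    have h1 := Finset.mem_Ioo.mp m.2
    simp only [hg, cos_sub_div hk s m (by omega)]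
    push_cast; ring
  have hmD : ∀ m : Finset.Ioo 0 k, 2 * (if Even (m : ℕ) then u else v) = g m * u ∧
      2 * (if Even (m : ℕ) then v else u) = g m * v := fun m => by
    rcases hs with ⟨rfl, -, rfl⟩ | ⟨rfl, -, rfl⟩ | ⟨-, -, rfl, rfl⟩
    · simp [hg]
    · simp only [hg, cos_pi_mul_div' hk]
      split_ifs with h
      · simp [h.neg_one_pow]
      · simp [(Nat.not_even_iff_odd.mp h).neg_one_pow]
    · simp
  have hN : ∀ m, untwistedQuot k s u v (.N m) = g m := fun _ => rfl
  have hD := congrArg (fun x : ℝ => (x : ℂ)) (sum_cos_parity hk s)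
  have hD' := congrArg (fun x : ℝ => (x : ℂ)) (sum_cos_parity_sub hk s)
  simp only [Complex.ofReal_add, Complex.ofReal_sub, Complex.ofReal_mul, apply_ite Complex.ofReal,
    Complex.ofReal_pow, Complex.ofReal_neg, Complex.ofReal_one, Complex.ofReal_natCast,
    Complex.ofReal_zero, Complex.ofReal_ofNat, ← hp] at hD hD'
  have d1 : ¬ (2 * k : ℤ) ∣ k := not_two_mul_dvd_of_pos_of_lt (by omega) (by omega) (by omega)
  have hss : ((-1 : ℂ) ^ s) * (-1) ^ s = 1 := by rw [← mul_pow]; simp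
  -- The sum and the difference of the two class sums are known from `hD` and `hD'`, which
  -- determines both. The last two clauses are the products of `Nk` with the twisted fields.
  have hfin : if Even k then
        (1 + (-1) ^ s + ((parityFields k 0).map (untwistedQuot k s u v)).sum = u * u ∧
        1 + (-1) ^ s + ((parityFields k 0).map (untwistedQuot k s u v)).sum = v * v ∧
        ((parityFields k 1).map (untwistedQuot k s u v)).sum = u * v ∧
        u = (-1) ^ s * u ∧ v = (-1) ^ s * v)
      else ((-1) ^ s + ((parityFields k 1).map (untwistedQuot k s u v)).sum = u * u ∧
        (-1) ^ s + ((parityFields k 1).map (untwistedQuot k s u v)).sum = v * v ∧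
        1 + ((parityFields k 0).map (untwistedQuot k s u v)).sum = u * v ∧
        v = (-1) ^ s * u ∧ u = (-1) ^ s * v) := by
    clear hp hc hN hmD hmk hmn
    generalize ((parityFields k 0).map (untwistedQuot k s u v)).sum = P at *
    generalize ((parityFields k 1).map (untwistedQuot k s u v)).sum = Q at *
    rcases hs with ⟨rfl, hu, rfl⟩ | ⟨h, hu, rfl⟩ | ⟨h1, h2, rfl, rfl⟩
    · simp [d1] at hD hD'
      split_ifs with he
      · simp only [he.neg_one_pow] at *
        grind
      · simp only [(Nat.not_even_iff_odd.mp he).neg_one_pow] at *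
        grind
    · have d2 : (2 * k : ℤ) ∣ k + k := ⟨1, by ring⟩
      simp only [h, d1, d2, sub_self, dvd_zero, if_true, if_false] at hD hD' ⊢
      split_ifs with he
      · simp only [he.neg_one_pow] at *
        grind
      · simp only [(Nat.not_even_iff_odd.mp he).neg_one_pow] at *
        grind
    · have d3 : ¬ (2 * k : ℤ) ∣ s := not_two_mul_dvd_of_pos_of_lt (by omega) (by omega) (by omega)
      have d4 : ¬ (2 * k : ℤ) ∣ s + k :=
        not_two_mul_dvd_of_pos_of_lt (by omega) (by omega) (by omega)
      have d5 : ¬ (2 * k : ℤ) ∣ s - k :=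
        not_two_mul_dvd_of_pos_of_lt (by omega) (by omega) (by omega)
      simp only [d3, d4, d5, if_false] at hD hD'
      split_ifs with he
      · simp only [he.neg_one_pow] at *
        grind
      · simp only [(Nat.not_even_iff_odd.mp he).neg_one_pow] at *
        grind
  clear_value g
  by_cases he : Even k <;> simp only [he, if_true, if_false] at hfin <;>
    obtain ⟨f1, f2, f3, f4, f5⟩ := hfin <;>
    rcases a with d | m | d | d | d <;> rcases b with e | n | e | e | e <;>
    simp only [fusionFields, he, if_true, if_false, Multiset.map_add, Multiset.sum_add, hc _ (hd _ _),
      hc _ (hs' _ _), hc _ (hk' _), Multiset.map_singleton, Multiset.sum_singleton, hN, hmn, hmk,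
      Multiset.insert_eq_cons, Multiset.map_cons, Multiset.sum_cons] <;>
    simp only [untwistedQuot]
  all_goals try grind
  all_goals first
    | rw [mul_comm _ (g _), ← (hmD _).1]
    | rw [mul_comm _ (g _), ← (hmD _).2]
    | rw [← (hmD _).1]
    | rw [← (hmD _).2]
  all_goals
    split_ifs <;>
    simp only [Multiset.map_cons, Multiset.map_singleton, Multiset.sum_cons,
      Multiset.sum_singleton, untwistedQuot] <;> ring

end OrbifoldBoundary

namespace OrbifoldBoundary

/-! ## The Verlinde formula -/

variable {k : ℕ} {β : ℝ}

/-- The heart of the Verlinde formula: each column of `S`, divided by its vacuum entry, is a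
one-dimensional representation of the explicit product of fields. -/
lemma sEntry_eq_mul_quot (hk : 1 ≤ k) (j : Label k) : ∃ f : Label k → ℂ,
    (∀ a, sEntry k a j = sEntry k (vac k) j * f a) ∧
      ∀ a b, ((fusionFields k a b).map f).sum = f a * f b := by
  have hk0 : ((√k : ℝ) : ℂ) ≠ 0 :=
    Complex.ofReal_ne_zero.mpr (Real.sqrt_pos.mpr (by positivity)).ne'
  have q1 := sqrt_cast_mul_self k
  have q2 := sqrt_half_mul_self k
  have q3 := neg_I_pow_mul_self k
  have hτ : ∀ τ : ℂ, τ * τ = (-1) ^ k → τ * τ = if Even k then 1 else -1 := fun τ h => by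
    rw [h]
    split_ifs with he
    · exact he.neg_one_pow
    · exact (Nat.not_even_iff_odd.mp he).neg_one_pow
  -- Here `r` is `1/√2`, but only `2r² = 1` and its relation to the entries are used.
  obtain ⟨r, hr, hr'⟩ : ∃ r : ℂ, ((√(k / 2) : ℝ) : ℂ) = √k * r ∧ 2 * (r * r) = 1 := by
    refine ⟨((√(k / 2) : ℝ) : ℂ) / √k, by field_simp, ?_⟩
    rw [div_mul_div_comm, q1, q2]
    have : (k : ℂ) ≠ 0 := by exact_mod_cast (by omega : k ≠ 0)
    field_simp
  have tw : ∀ (e : ℤˣ) (τ : ℂ), τ * τ = (-1) ^ k → ∀ a b, ((fusionFields k a b).map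
      (twistedQuot k τ ((e : ℤ) * r * (1 + τ)) ((e : ℤ) * r * (1 - τ)))).sum =
      twistedQuot k τ ((e : ℤ) * r * (1 + τ)) ((e : ℤ) * r * (1 - τ)) a *
      twistedQuot k τ ((e : ℤ) * r * (1 + τ)) ((e : ℤ) * r * (1 - τ)) b := fun e τ h => by
    have h1 := hτ τ h
    have h2 := unit_cast_mul_self e
    refine sum_fusionFields_twistedQuot h1 ?_ ?_ ?_ ?_ ?_
    · linear_combination (1 + τ) * (1 + τ) * (2 * (r * r) * h2 + hr')
    · linear_combination (1 - τ) * (1 - τ) * (2 * (r * r) * h2 + hr')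
    · linear_combination (1 + τ) * (1 - τ) * (2 * (r * r) * h2 + hr')
    · split_ifs at h1 ⊢ <;> linear_combination (e : ℤ) * r * h1
    · split_ifs at h1 ⊢ <;> linear_combination -((e : ℤ) * r * h1)
  have he : ∀ e : ℤˣ, ((e : ℤ) : ℂ) * (e : ℤ) = 1 := unit_cast_mul_self
  rcases j with e | m | e | e | e
  · refine ⟨untwistedQuot k 0 ((e : ℤ) * (√k : ℝ)) ((e : ℤ) * (√k : ℝ)), fun a => ?_,
      sum_fusionFields_untwistedQuot hk (Or.inl ⟨rfl, ?_, rfl⟩)⟩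
    · rcases a <;> simp [sEntry, vac, untwistedQuot]
    · linear_combination he e * ((√k : ℝ) : ℂ) * ((√k : ℝ) : ℂ) + q1
  · have hm := Finset.mem_Ioo.mp m.2
    refine ⟨untwistedQuot k m 0 0, fun a => ?_,
      sum_fusionFields_untwistedQuot hk (Or.inr (Or.inr ⟨hm.1, hm.2, rfl, rfl⟩))⟩
    rcases a with d | n | d | d | d <;> simp only [sEntry, vac, untwistedQuot]
    · ring
    · rw [mul_right_comm Real.pi]; ring
    · ring
    · ring
  · refine ⟨untwistedQuot k k ((e : ℤ) * (-Complex.I) ^ k * (√k : ℝ))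
      (-((e : ℤ) * (-Complex.I) ^ k * (√k : ℝ))), fun a => ?_,
      sum_fusionFields_untwistedQuot hk (Or.inr (Or.inl ⟨rfl, ?_, rfl⟩))⟩
    · rcases a with d | n | d | d | d <;> simp only [sEntry, vac, untwistedQuot, one_mul]
      rw [cos_pi_mul_div' hk]; simp
    · linear_combination he e * ((-Complex.I) ^ k) * ((-Complex.I) ^ k) * ((√k : ℝ) : ℂ) *
        ((√k : ℝ) : ℂ) + q3 * ((√k : ℝ) : ℂ) * ((√k : ℝ) : ℂ) + (-1) ^ k * q1
  · refine ⟨_, fun a => ?_, tw e ((-Complex.I) ^ k) q3⟩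
    rcases a with d | n | d | d | d <;> simp only [sEntry, vac, twistedQuot, hr] <;>
      push_cast <;> ring
  -- The column of `Dk` is that of `D0` with the opposite root of `(-1)^k`.
  · refine ⟨_, fun a => ?_, tw e (-(-Complex.I) ^ k) (by rw [neg_mul_neg, q3])⟩
    rcases a with d | n | d | d | d <;> simp only [sEntry, vac, twistedQuot, hr] <;>
      push_cast <;> ring

lemma sum_modularS_mul_fusionMult (hk : 1 ≤ k) (a b j : Label k) :
    ∑ c, modularS k c j * (fusionMult k a b c : ℂ) =
      modularS k a j * modularS k b j / modularS k (vac k) j := by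
  obtain ⟨f, hf, hmul⟩ := sEntry_eq_mul_quot hk j
  obtain ⟨r, hr, hr'⟩ := modularS_vac_pos hk j
  have h0 : modularS k (vac k) j ≠ 0 := hr' ▸ Complex.ofReal_ne_zero.mpr hr.ne'
  have hS : ∀ a, modularS k a j = modularS k (vac k) j * f a := fun a => by
    simp only [modularS, Matrix.of_apply, hf a, mul_div_right_comm]
  rw [hS a, hS b, mul_mul_mul_comm, mul_assoc, mul_div_cancel_left₀ _ h0, ← hmul,
    ← sum_count_mul, Finset.mul_sum]
  exact Finset.sum_congr rfl fun c _ => by rw [hS c]; simp only [fusionMult]; ring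

/-- Unitarity inverts `sum_modularS_mul_fusionMult`: multiplying by the conjugate of `S_{cj}` and
summing over `j` isolates the multiplicity of `c`. -/
lemma fusionMult_eq_fusion (hk : 1 ≤ k) (a b c : Label k) :
    (fusionMult k a b c : ℂ) = fusion k a b c := by
  have h : ∀ j, modularS k a j * modularS k b j * starRingEnd ℂ (modularS k c j) /
      modularS k (vac k) j = ∑ d, (fusionMult k a b d : ℂ) *
        (modularS k d j * starRingEnd ℂ (modularS k c j)) := fun j => by
    rw [mul_div_right_comm, ← sum_modularS_mul_fusionMult hk, Finset.sum_mul]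
    exact Finset.sum_congr rfl fun d _ => by ring
  simp only [fusion, h]
  rw [Finset.sum_comm]
  simp only [← Finset.mul_sum, sum_modularS_mul_conj hk]
  simp

lemma fusionMult_vac (b c : Label k) : fusionMult k (vac k) b c = if b = c then 1 else 0 := by
  have : fusionFields k (vac k) b = {b} := by
    rcases b with e | m | e | e | e <;> simp [fusionFields, vac]
  rw [fusionMult, this, Multiset.count_singleton]
  exact if_congr eq_comm rfl rfl

lemma cardyCoeff_eq (a j : Label k) : cardyCoeff k a j =
    modularS k a j / ((√(modularS k (vac k) j).re : ℝ) : ℂ) := rfl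

/-- Replacing `a` by its dual conjugates `S_{aj}`, and the positive denominator `S_{0j}` is shared
as two square roots. -/
lemma sum_modularS_mul_fusionMult_dual (hk : 1 ≤ k) (a b j : Label k) :
    ∑ c, modularS k c j * (fusionMult k (dual k a) b c : ℂ) =
      starRingEnd ℂ (cardyCoeff k a j) * cardyCoeff k b j := by
  obtain ⟨r, hr, hr'⟩ := modularS_vac_pos hk j
  rw [sum_modularS_mul_fusionMult hk, ← conj_modularS, cardyCoeff_eq, cardyCoeff_eq, hr',
    Complex.ofReal_re, map_div₀, Complex.conj_ofReal, div_mul_div_comm,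
    ofReal_sqrt_mul_self hr.le]

/-- A comparison of the amplitude table with `fusionFields`, after folding charges by the symmetries
of the circle characters. Dualizing matters for odd `k`: the vacuum then occurs in `Dk × D0`, while
its character appears in the amplitude of `D0` with itself. -/
lemma Z_eq_sum_fusionMult (hk : 1 ≤ k) (hβ : 0 < β) (a b : Label k) :
    Z k β a b = ∑ c, (fusionMult k (dual k a) b c : ℂ) * (extChar k c (qOpen β) : ℂ) := by
  simp only [fusionMult]
  rw [sum_count_mul (fusionFields k (dual k a) b) (fun c => (extChar k c (qOpen β) : ℂ))]
  set X : Label k → ℂ := fun c => (extChar k c (qOpen β) : ℂ) with hX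
  set g : ℕ → ℂ := fun s => (circleChar k s (qOpen β) : ℂ) with hg
  have hc : ∀ s ≤ k, ((circFields k s).map X).sum = g s := fun s hs =>
    sum_circFields _ g (by simp [hX, extChar, vacChar, hg]; ring) (fun _ => rfl)
      (by simp [hX, hg, extChar, midChar]) hs
  have hp0 : ((parityFields k 0).map X).sum = ∑ s ∈ Finset.Ioo 0 k with Even s, g s := by
    rw [sum_parityFields X g (fun _ => rfl)]; simp only [Nat.even_iff]
  have hp1 : ((parityFields k 1).map X).sum = ∑ s ∈ Finset.Ioo 0 k with Odd s, g s := by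
    rw [sum_parityFields X g (fun _ => rfl)]; simp only [Nat.odd_iff]
  have hd : ∀ m n : Finset.Ioo 0 k, ((m : ℤ) - (n : ℤ)).natAbs ≤ k := fun m n => by
    have := Finset.mem_Ioo.mp m.2
    have := Finset.mem_Ioo.mp n.2
    omega
  have hs : ∀ m n : Finset.Ioo 0 k, (if (m : ℕ) + n ≤ k then (m + n : ℕ) else 2 * k - (m + n)) ≤ k :=
    fun m n => by split_ifs <;> omega
  have hk' : ∀ m : Finset.Ioo 0 k, k - (m : ℕ) ≤ k := fun m => Nat.sub_le _ _
  have hgd : ∀ m n : Finset.Ioo 0 k, g ((m : ℤ) - (n : ℤ)).natAbs =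
      (circleChar k ((m : ℕ) - (n : ℕ)) (qOpen β) : ℂ) := fun m n => by
    simp only [hg]
    rcases Int.natAbs_eq ((m : ℤ) - (n : ℤ)) with h | h
    · rw [← h]
    · rw [← circleChar_neg hk _ hβ, ← h]
  have hgs : ∀ m n : Finset.Ioo 0 k, g (if (m : ℕ) + n ≤ k then m + n else 2 * k - (m + n)) =
      (circleChar k ((m : ℕ) + (n : ℕ)) (qOpen β) : ℂ) := fun m n => by
    have := Finset.mem_Ioo.mp m.2
    have := Finset.mem_Ioo.mp n.2
    simp only [hg]
    split_ifs with h
    · push_cast; rfl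
    · rw [← circleChar_neg hk ((m : ℕ) + (n : ℕ)) hβ,
        ← circleChar_add hk (-((m : ℕ) + (n : ℕ))) hβ]
      congr 2
      push_cast [Nat.cast_sub (by omega : (m : ℕ) + n ≤ 2 * k)]
      ring
  have hgk : ∀ m : Finset.Ioo 0 k, g (k - m) =
      (circleChar k (k - (m : ℕ)) (qOpen β) : ℂ) := fun m => by
    have := Finset.mem_Ioo.mp m.2
    simp only [hg, Nat.cast_sub this.2.le]
  have hN : ∀ m, X (.N m) = (circleChar k (m : ℕ) (qOpen β) : ℂ) := fun _ => rfl
  have hN0 : ∀ e, X (.N0 e) = (vacChar k e (qOpen β) : ℂ) := fun _ => rfl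
  have hNk : ∀ e, X (.Nk e) = (midChar k (qOpen β) : ℂ) := fun _ => rfl
  have hD0 : ∀ e, X (.D0 e) = (twChar e (qOpen β) : ℂ) := fun _ => rfl
  have hDk : ∀ e, X (.Dk e) = (twChar e (qOpen β) : ℂ) := fun _ => rfl
  clear_value X
  have r1 : ∀ m d, _ := fun m d => (Z_comm hk hβ (.N m) (.N0 d)).trans (Z_N0_N hk hβ d m)
  have r2 : ∀ d e, _ := fun d e => (Z_comm hk hβ (.Nk d) (.N0 e)).trans (Z_N0_Nk hk hβ e d)
  have r3 : ∀ d m, _ := fun d m => (Z_comm hk hβ (.Nk d) (.N m)).trans (Z_N_Nk hk hβ m d)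
  have r4 : ∀ d e, _ := fun d e => (Z_comm hk hβ (.D0 d) (.N0 e)).trans (Z_N0_D0 hk hβ e d)
  have r5 : ∀ d m, _ := fun d m => (Z_comm hk hβ (.D0 d) (.N m)).trans (Z_N_D0 hk hβ m d)
  have r6 : ∀ d e, _ := fun d e => (Z_comm hk hβ (.D0 d) (.Nk e)).trans (Z_Nk_D0 hk hβ e d)
  have r7 : ∀ d e, _ := fun d e => (Z_comm hk hβ (.Dk d) (.N0 e)).trans (Z_N0_Dk hk hβ e d)
  have r8 : ∀ d m, _ := fun d m => (Z_comm hk hβ (.Dk d) (.N m)).trans (Z_N_Dk hk hβ m d)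
  have r9 : ∀ d e, _ := fun d e => (Z_comm hk hβ (.Dk d) (.Nk e)).trans (Z_Nk_Dk hk hβ e d)
  have r10 : ∀ d e, _ := fun d e => (Z_comm hk hβ (.Dk d) (.D0 e)).trans (Z_D0_Dk hk hβ e d)
  by_cases he : Even k <;>
    rcases a with d | m | d | d | d <;> rcases b with e | n | e | e | e <;>
    simp only [fusionFields, dual, he, if_true, if_false, Multiset.map_add, Multiset.sum_add,
      hc _ (hd _ _), hc _ (hs _ _), hc _ (hk' _), hgd, hgs, hgk, hp0, hp1, Multiset.map_singleton,
      Multiset.sum_singleton, Multiset.insert_eq_cons, Multiset.map_cons, Multiset.sum_cons,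
      hN, hN0, hNk, hD0, hDk, r1, r2, r3, r4, r5, r6, r7, r8, r9, r10, Z_N0_N0 hk hβ,
      Z_N0_N hk hβ, Z_N0_Nk hk hβ, Z_N_N hk hβ, Z_N_Nk hk hβ, Z_Nk_Nk hk hβ, Z_N0_D0 hk hβ,
      Z_N0_Dk hk hβ, Z_Nk_D0 hk hβ, Z_Nk_Dk hk hβ, Z_N_D0 hk hβ, Z_N_Dk hk hβ, Z_D0_D0 hk hβ,
      Z_Dk_Dk hk hβ, Z_D0_Dk hk hβ, mul_neg, neg_neg, add_zero,
      ← Nat.not_even_iff_odd, not_true_eq_false, not_false_eq_true, mul_comm (_ : ℤˣ)]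
  all_goals try split_ifs
  all_goals try simp only [Multiset.map_cons, Multiset.map_singleton, Multiset.sum_cons,
    Multiset.sum_singleton, hD0, hDk]
  all_goals ring

end OrbifoldBoundary

namespace OrbifoldBoundary

/-! ## Cardy's construction -/

variable {k : ℕ} {β : ℝ}

/-! ### Positivity of the characters -/

lemma circleChar_pos (hk : 1 ≤ k) (s : ℤ) (hβ : 0 < β) : 0 < circleChar k s (qOpen β) := by
  rw [circleChar_eq]
  exact div_pos (theta_pos hk s hβ) (eta_pos (qOpen_pos β) (qOpen_lt_one hβ))

lemma twChar_pos (e : ℤˣ) (hβ : 0 < β) : 0 < twChar e (qOpen β) := by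
  rw [twChar_eq]
  split_ifs <;> exact circleChar_pos (by norm_num) _ hβ

lemma one_le_theta_zero (hk : 1 ≤ k) (hβ : 0 < β) : 1 ≤ theta k 0 β := by
  have h := (hasSum_theta hk 0 hβ).summable.le_tsum 0
    (fun n _ => (Real.rpow_pos_of_pos (qOpen_pos β) _).le)
  simpa [theta] using h

/-- The series alternates, but its modular transform is a sum of positive twisted characters. -/
lemma chiC_pos (hβ : 0 < β) : 0 < chiC (qOpen β) := by
  have h := chiC_qClosed (one_div_pos.mpr hβ)
  rw [qClosed_eq, one_div_one_div] at h
  rw [h]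
  have := twChar_pos 1 (one_div_pos.mpr hβ)
  have := twChar_pos (-1) (one_div_pos.mpr hβ)
  positivity

/-- Up to the common factor `q^(1/24)` the left side is `∏ (1 + q^n)⁻¹ ≤ 1`, while the right side is
at least `∏ (1 - q^n)⁻¹ > 1`. It makes `χ*_-` positive. -/
lemma chiC_lt_circleChar (hk : 1 ≤ k) (hβ : 0 < β) :
    chiC (qOpen β) < circleChar k 0 (qOpen β) := by
  have h0 := qOpen_pos β
  have h1 := qOpen_lt_one hβ
  have hx := Real.rpow_pos_of_pos h0 (1 / 24 : ℝ)
  have e : ∀ n : ℕ, qOpen β ^ omU n = qOpen β ^ (n + 1) := fun n => by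
    rw [← Real.rpow_natCast, omU]; push_cast; rfl
  have hc := tprod_omU_neg hβ
  have hE := tprod_omU hβ
  simp only [e] at hc hE
  have hP : ∏' n : ℕ, (1 - qOpen β ^ (n + 1)) < 1 :=
    lt_of_le_of_lt (tprod_one_sub_le_qPoch h0.le h1 1) (by simp [qPoch, h0])
  have hPpos := tprod_one_sub_pos h0.le h1
  rw [circleChar_eq, ← mul_lt_mul_iff_right₀ hx, ← hc, mul_div_left_comm, ← hE]
  calc _ ≤ (1 : ℝ) := inv_le_one_of_one_le₀ (one_le_tprod_one_add h0.le h1)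
    _ < (∏' n : ℕ, (1 - qOpen β ^ (n + 1)))⁻¹ := (one_lt_inv₀ hPpos).mpr hP
    _ ≤ _ := le_mul_of_one_le_left (inv_pos.mpr hPpos).le (one_le_theta_zero hk hβ)

lemma extChar_pos (hk : 1 ≤ k) (hβ : 0 < β) (a : Label k) : 0 < extChar k a (qOpen β) := by
  rcases a with e | m | e | e | e
  · have h1 := chiC_pos hβ
    have h2 := chiC_lt_circleChar hk hβ
    simp only [extChar, vacChar]
    rcases Int.units_eq_one_or e with rfl | rfl
    · simp; linarith
    · simp; linarith
  · exact circleChar_pos hk _ hβ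
  · exact half_pos (circleChar_pos hk _ hβ)
  · exact twChar_pos e hβ
  · exact twChar_pos e hβ

lemma reflect_boundaryState (hk : 1 ≤ k) (a : Label k) :
    reflect (boundaryState k a) = boundaryState k a := by
  rw [boundaryState_eq hk]
  have hN : ∀ (A : ℝ) (s : ℕ) (m w : ℤ), nGlue k A s (-m) (-w) = nGlue k A s m w := fun A s m w => by
    simp only [nGlue, neg_eq_zero, Int.cast_neg, cos_mul_neg_div]
  have hD : ∀ (A : ℝ) (s : ℕ) (m w : ℤ), dGlue A s (-m) (-w) = dGlue A s m w := fun A s m w => by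
    simp only [dGlue, neg_eq_zero, Int.cast_neg, mul_neg, Real.cos_neg]
  refine reflect_glued _ (fun m w => ?_) _
  rcases a with e | n | e | e | e
  exacts [hN _ _ _ _, hN _ _ _ _, hN _ _ _ _, hD _ _ _ _, hD _ _ _ _]

lemma isIshibashi_boundaryState (hk : 1 ≤ k) (a : Label k) :
    IsIshibashi k (boundaryState k a) := by
  rw [boundaryState_eq hk]
  have hN : ∀ (A : ℝ) (s : ℕ) (m w : ℤ), nGlue k A s m w ≠ 0 →
      pL k m w = ((-1 : ℤˣ) : ℤ) * pR k m w := fun A s m w h => by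
    have hm : m = 0 := by
      by_contra hm
      exact h (if_neg hm)
    simp [pL, pR, hm]
  have hD : ∀ (A : ℝ) (s : ℕ) (m w : ℤ), dGlue A s m w ≠ 0 →
      pL k m w = ((1 : ℤˣ) : ℤ) * pR k m w := fun A s m w h => by
    have hw : w = 0 := by
      by_contra hw
      exact h (if_neg hw)
    simp [pL, pR, hw]
  rcases a with e | n | e | e | e
  exacts [isIshibashi_glued (hN _ _) _, isIshibashi_glued (hN _ _) _,
    isIshibashi_glued (hN _ _) _, isIshibashi_glued (hD _ _) _, isIshibashi_glued (hD _ _) _]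

lemma IsIshibashi.sum {ι : Type*} (s : Finset ι) {x : ι → State}
    (h : ∀ i ∈ s, IsIshibashi k (x i)) : IsIshibashi k (∑ i ∈ s, x i) :=
  Finset.sum_induction _ _ (fun _ _ => IsIshibashi.add) (isIshibashi_zero k) h

lemma reflect_sum {ι : Type*} (s : Finset ι) {x : ι → State}
    (h : ∀ i ∈ s, reflect (x i) = x i) : reflect (∑ i ∈ s, x i) = ∑ i ∈ s, x i :=
  Finset.sum_induction _ (fun x => reflect x = x) (fun _ _ hx hy => by rw [reflect_add, hx, hy])
    (by simpa using reflect_smul 0 0) h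

/-- The cylinder amplitude of linear combinations. -/
lemma hasSum_cylTerm_sum {ι ι' : Type*} [Fintype ι] [Fintype ι'] (u : ι → ℂ) (u' : ι' → ℂ)
    {x : ι → State} {y : ι' → State} (h : ∀ a b, Summable (cylTerm k β (x a) (y b))) :
    HasSum (cylTerm k β (∑ a, u a • x a) (∑ b, u' b • y b))
      (∑ a, ∑ b, starRingEnd ℂ (u a) * u' b * cylinder k β (x a) (y b)) := by
  refine hasSum_congr' (hasSum_sum fun a _ => hasSum_sum fun b _ =>
    (h a b).hasSum.mul_left (starRingEnd ℂ (u a) * u' b)) (fun v => ?_) rfl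
  simp only [cylTerm, Finset.sum_apply, Pi.smul_apply, smul_eq_mul, map_sum, map_mul,
    Finset.sum_mul]
  refine Finset.sum_congr rfl fun a _ => ?_
  rw [mul_assoc, Finset.sum_mul, Finset.mul_sum]
  exact Finset.sum_congr rfl fun b _ => by ring

lemma extChar_qOpen (hk : 1 ≤ k) (hβ : 0 < β) (a : Label k) :
    (extChar k a (qOpen β) : ℂ) = ∑ b, modularS k a b * (extChar k b (qClosed β) : ℂ) := by
  have h := extChar_qClosed hk (one_div_pos.mpr hβ) a
  rwa [qClosed_eq, one_div_one_div, ← qClosed_eq] at h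

/-- The closed channel: the characters are transformed to `\tilde q`, and Cardy's condition
factorizes their coefficients. -/
lemma Z_eq_sum_cardyCoeff (hk : 1 ≤ k) (hβ : 0 < β) (a b : Label k) :
    Z k β a b = ∑ j, starRingEnd ℂ (cardyCoeff k a j) * cardyCoeff k b j *
      (extChar k j (qClosed β) : ℂ) := by
  rw [Z_eq_sum_fusionMult hk hβ]
  simp only [extChar_qOpen hk hβ, ← sum_modularS_mul_fusionMult_dual hk, Finset.mul_sum,
    Finset.sum_mul]
  rw [Finset.sum_comm]
  exact Finset.sum_congr rfl fun j _ => Finset.sum_congr rfl fun c _ => by ring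

/-- The positive square root of `S_{0j}`. -/
noncomputable def sqrtVac (k : ℕ) (j : Label k) : ℂ := ((√(modularS k (vac k) j).re : ℝ) : ℂ)

lemma sqrtVac_ne_zero (hk : 1 ≤ k) (j : Label k) : sqrtVac k j ≠ 0 := by
  obtain ⟨r, hr, hr'⟩ := modularS_vac_pos hk j
  rw [sqrtVac, hr', Complex.ofReal_re]
  exact Complex.ofReal_ne_zero.mpr (Real.sqrt_pos.mpr hr).ne'

lemma cardyCoeff_eq_div (a j : Label k) : cardyCoeff k a j = modularS k a j / sqrtVac k j := rfl

lemma conj_sqrtVac (j : Label k) : starRingEnd ℂ (sqrtVac k j) = sqrtVac k j :=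
  Complex.conj_ofReal _

/-- The Ishibashi state of an extended representation. -/
noncomputable def extIshibashi (k : ℕ) (j : Label k) : State :=
  ∑ a, (starRingEnd ℂ (modularS k a j) * sqrtVac k j) • boundaryState k a

lemma sum_modularS_mul_conj_left (hk : 1 ≤ k) (i j : Label k) :
    ∑ a, modularS k a i * starRingEnd ℂ (modularS k a j) = if i = j then 1 else 0 := by
  rw [← sum_modularS_mul_conj hk]
  exact Finset.sum_congr rfl fun a _ => by rw [modularS_symm a i, modularS_symm a j]

/-- The factor `sqrtVac` in `extIshibashi` cancels the denominator of `cardyCoeff`, and unitarity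
does the rest. -/
lemma boundaryState_eq_sum (hk : 1 ≤ k) (a : Label k) :
    boundaryState k a = ∑ j, cardyCoeff k a j • extIshibashi k j := by
  have h : ∀ j b, cardyCoeff k a j * (starRingEnd ℂ (modularS k b j) * sqrtVac k j) =
      modularS k a j * starRingEnd ℂ (modularS k b j) := fun j b => by
    have := sqrtVac_ne_zero hk j
    rw [cardyCoeff_eq_div]
    field_simp
  simp only [extIshibashi, Finset.smul_sum, smul_smul, h]
  rw [Finset.sum_comm]
  simp only [← Finset.sum_smul, sum_modularS_mul_conj hk]
  simp

lemma isIshibashi_extIshibashi (hk : 1 ≤ k) (j : Label k) : IsIshibashi k (extIshibashi k j) :=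
  IsIshibashi.sum _ fun a _ => (isIshibashi_boundaryState hk a).smul _

lemma reflect_extIshibashi (hk : 1 ≤ k) (j : Label k) :
    reflect (extIshibashi k j) = extIshibashi k j :=
  reflect_sum _ fun a _ => by rw [reflect_smul, reflect_boundaryState hk]

/-- In the closed channel each amplitude is a sum over `l` of products of a function of `a` and one
of `b`. Orthogonality of the columns of `S` in both labels leaves only `l = i = j`, where the square
roots cancel. -/
lemma hasSum_cylTerm_extIshibashi (hk : 1 ≤ k) (hβ : 0 < β) (i j : Label k) :
    HasSum (cylTerm k β (extIshibashi k i) (extIshibashi k j))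
      (if i = j then (extChar k j (qClosed β) : ℂ) else 0) := by
  refine hasSum_congr' (hasSum_cylTerm_sum _ _ (summable_cylTerm_boundaryState hk hβ))
    (fun _ => rfl) ?_
  have h : ∀ a b, starRingEnd ℂ (starRingEnd ℂ (modularS k a i) * sqrtVac k i) *
      (starRingEnd ℂ (modularS k b j) * sqrtVac k j) *
      cylinder k β (boundaryState k a) (boundaryState k b) =
      ∑ l, sqrtVac k i * sqrtVac k j / (sqrtVac k l * sqrtVac k l) *
        (extChar k l (qClosed β) : ℂ) * (modularS k a i * starRingEnd ℂ (modularS k a l)) *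
        (modularS k b l * starRingEnd ℂ (modularS k b j)) := fun a b => by
    rw [← Z, Z_eq_sum_cardyCoeff hk hβ, Finset.mul_sum]
    refine Finset.sum_congr rfl fun l _ => ?_
    simp only [cardyCoeff_eq_div, map_mul, map_div₀, Complex.conj_conj, conj_sqrtVac]
    ring
  have h2 : ∀ a, ∑ b, ∑ l, sqrtVac k i * sqrtVac k j / (sqrtVac k l * sqrtVac k l) *
        (extChar k l (qClosed β) : ℂ) * (modularS k a i * starRingEnd ℂ (modularS k a l)) *
        (modularS k b l * starRingEnd ℂ (modularS k b j)) =
      (extChar k j (qClosed β) : ℂ) * sqrtVac k i / sqrtVac k j *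
        (modularS k a i * starRingEnd ℂ (modularS k a j)) := fun a => by
    have := sqrtVac_ne_zero hk j
    rw [Finset.sum_comm]
    simp only [← Finset.mul_sum, sum_modularS_mul_conj_left hk, mul_ite, mul_one, mul_zero,
      Finset.sum_ite_eq', Finset.mem_univ, if_true]
    field_simp
  simp only [h, h2]
  rw [← Finset.mul_sum, sum_modularS_mul_conj_left hk]
  have := sqrtVac_ne_zero hk j
  split_ifs with hij
  · subst hij; field_simp
  · rw [mul_zero]

/-- Pairing a relation with the state `j` gives its coefficient along `extIshibashi k j` times a
positive character, at `β = 1` where `\tilde q = q`. So the coefficient vector is annihilated by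
`S`, which is invertible. -/
lemma linearIndependent_boundaryState (hk : 1 ≤ k) : LinearIndependent ℂ (boundaryState k) := by
  rw [Fintype.linearIndependent_iff]
  intro c hc
  have hβ : (0 : ℝ) < 1 := one_pos
  have h : ∀ j, ∑ a, c a * modularS k a j = 0 := fun j => by
    have hX : ∑ a, c a • boundaryState k a =
        ∑ l, (∑ a, c a * cardyCoeff k a l) • extIshibashi k l := by
      simp only [boundaryState_eq_sum hk, Finset.smul_sum, smul_smul, Finset.sum_smul]
      exact Finset.sum_comm
    have h1 := hasSum_cylTerm_sum (k := k) (β := 1) (fun _ : Unit => 1)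
      (fun l => ∑ a, c a * cardyCoeff k a l) (x := fun _ => extIshibashi k j)
      (y := extIshibashi k) (fun _ l => (hasSum_cylTerm_extIshibashi hk hβ j l).summable)
    rw [← hX, hc] at h1
    have h2 : ∀ l, cylinder k 1 (extIshibashi k j) (extIshibashi k l) = _ := fun l =>
      (hasSum_cylTerm_extIshibashi hk hβ j l).tsum_eq
    have h3 := h1.unique (hasSum_congr' hasSum_zero (fun v => by simp [cylTerm]) rfl)
    simp only [h2, Finset.univ_unique, Finset.sum_singleton, map_one, one_mul, mul_ite, mul_zero,
      Finset.sum_ite_eq, Finset.mem_univ, if_true] at h3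
    rw [qClosed_eq, one_div_one] at h3
    have h4 := (mul_eq_zero.mp h3).resolve_right
      (Complex.ofReal_ne_zero.mpr (extChar_pos hk hβ j).ne')
    have hj := sqrtVac_ne_zero hk j
    simp only [cardyCoeff_eq_div, mul_div_assoc', ← Finset.sum_div] at h4
    exact (div_eq_zero_iff.mp h4).resolve_right hj
  intro b
  have h5 : ∑ j, (∑ a, c a * modularS k a j) * starRingEnd ℂ (modularS k b j) = c b := by
    simp only [Finset.sum_mul, mul_assoc]
    rw [Finset.sum_comm]
    simp only [← Finset.mul_sum, sum_modularS_mul_conj hk]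
    simp
  rw [← h5]
  simp [h]

lemma Z_vac (hk : 1 ≤ k) (hβ : 0 < β) (a : Label k) :
    Z k β (vac k) a = (extChar k a (qOpen β) : ℂ) := by
  rcases a with e | m | e | e | e
  · simpa [vac, extChar] using Z_N0_N0 hk hβ 1 e
  · exact Z_N0_N hk hβ 1 m
  · exact Z_N0_Nk hk hβ 1 e
  · simpa [vac, extChar] using Z_N0_D0 hk hβ 1 e
  · simpa [vac, extChar] using Z_N0_Dk hk hβ 1 e

end OrbifoldBoundary

theorem mainTheorem2 (k : ℕ) (hk : 1 ≤ k) :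
    -- the states are invariant under the orbifold group and satisfy the Ishibashi condition
    (∀ a : Label k, reflect (boundaryState k a) = boundaryState k a ∧
      IsIshibashi k (boundaryState k a)) ∧
    -- completeness: as many independent states as labels of characters
    (Fintype.card (Label k) = k + 7 ∧ LinearIndependent ℂ (boundaryState k)) ∧
    -- convergence of all the cylinder amplitudes
    (∀ β : ℝ, 0 < β → ∀ a b : Label k,
      Summable (cylTerm k β (boundaryState k a) (boundaryState k b))) ∧
    -- the vacuum state
    (∀ β : ℝ, 0 < β → Z k β (vac k) (vac k) = (vacChar k 1 (qOpen β) : ℂ) ∧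
      ∀ a : Label k, Z k β (vac k) a = (extChar k a (qOpen β) : ℂ)) ∧
    -- the list of all amplitudes
    (∀ β : ℝ, 0 < β →
      (∀ a b, Z k β a b = Z k β b a) ∧
      (∀ d e, Z k β (.N0 d) (.N0 e) = (vacChar k (d * e) (qOpen β) : ℂ)) ∧
      (∀ d m, Z k β (.N0 d) (.N m) = (circleChar k (m : ℕ) (qOpen β) : ℂ)) ∧
      (∀ d e, Z k β (.N0 d) (.Nk e) = (midChar k (qOpen β) : ℂ)) ∧
      (∀ d e, Z k β (.N0 d) (.D0 e) = (twChar (d * e) (qOpen β) : ℂ)) ∧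
      (∀ d e, Z k β (.N0 d) (.Dk e) = (twChar (d * e) (qOpen β) : ℂ)) ∧
      (∀ m n, Z k β (.N m) (.N n) = (circleChar k ((m : ℕ) - (n : ℕ)) (qOpen β) : ℂ) +
        (circleChar k ((m : ℕ) + (n : ℕ)) (qOpen β) : ℂ)) ∧
      (∀ m e, Z k β (.N m) (.Nk e) = (circleChar k (k - (m : ℕ)) (qOpen β) : ℂ)) ∧
      (∀ m e, Z k β (.N m) (.D0 e) = (twChar 1 (qOpen β) : ℂ) + (twChar (-1) (qOpen β) : ℂ)) ∧
      (∀ m e, Z k β (.N m) (.Dk e) = (twChar 1 (qOpen β) : ℂ) + (twChar (-1) (qOpen β) : ℂ)) ∧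
      (∀ d e, Z k β (.Nk d) (.Nk e) = (vacChar k (d * e) (qOpen β) : ℂ)) ∧
      (∀ d e, Z k β (.Nk d) (.D0 e) = (twChar (d * e) (qOpen β) : ℂ)) ∧
      (∀ d e, Z k β (.Nk d) (.Dk e) = (twChar (-(d * e)) (qOpen β) : ℂ)) ∧
      (∀ d e, Z k β (.D0 d) (.D0 e) = (vacChar k (d * e) (qOpen β) : ℂ) +
        (∑ s ∈ Finset.Ioo 0 k with Even s, (circleChar k (s : ℕ) (qOpen β) : ℂ)) +
        (if Even k then (midChar k (qOpen β) : ℂ) else 0)) ∧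
      (∀ d e, Z k β (.Dk d) (.Dk e) = (vacChar k (d * e) (qOpen β) : ℂ) +
        (∑ s ∈ Finset.Ioo 0 k with Even s, (circleChar k (s : ℕ) (qOpen β) : ℂ)) +
        (if Even k then (midChar k (qOpen β) : ℂ) else 0)) ∧
      (∀ d e, Z k β (.D0 d) (.Dk e) =
        (∑ s ∈ Finset.Ioo 0 k with Odd s, (circleChar k (s : ℕ) (qOpen β) : ℂ)) +
        (if Odd k then (midChar k (qOpen β) : ℂ) else 0))) ∧
    -- the modular matrix of the characters
    ((modularS k).IsSymm ∧ modularS k ∈ Matrix.unitaryGroup (Label k) ℂ ∧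
      modularS k * modularS k = Matrix.of (fun a b => if b = dual k a then 1 else 0) ∧
      (∀ j, 0 < (modularS k (vac k) j).re ∧ (modularS k (vac k) j).im = 0) ∧
      (∀ β : ℝ, 0 < β → ∀ a : Label k, (extChar k a (qClosed β) : ℂ) =
        ∑ b, modularS k a b * (extChar k b (qOpen β) : ℂ))) ∧
    -- nonnegative integrality, fusion rules and Cardy condition
    (∃ n : Label k → Label k → Label k → ℕ,
      (∀ a b c, (n a b c : ℂ) = fusion k a b c) ∧
      (∀ b c, n (vac k) b c = if b = c then 1 else 0) ∧
      (∀ β : ℝ, 0 < β → ∀ a b : Label k,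
        Z k β a b = ∑ c, (n (dual k a) b c : ℂ) * (extChar k c (qOpen β) : ℂ)) ∧
      (∀ a b j, ∑ c, modularS k c j * (n (dual k a) b c : ℂ) =
        starRingEnd ℂ (cardyCoeff k a j) * cardyCoeff k b j)) ∧
    -- the states are Cardy's solution
    (∃ I : Label k → State,
      (∀ j, reflect (I j) = I j ∧ IsIshibashi k (I j)) ∧
      (∀ β : ℝ, 0 < β → ∀ i j, Summable (cylTerm k β (I i) (I j)) ∧
        cylinder k β (I i) (I j) = if i = j then (extChar k j (qClosed β) : ℂ) else 0) ∧
      (∀ a, boundaryState k a = ∑ j, cardyCoeff k a j • I j)) := by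
  have hvac : ∀ j, 0 < (modularS k (vac k) j).re ∧ (modularS k (vac k) j).im = 0 := fun j => by
    obtain ⟨r, hr, hr'⟩ := modularS_vac_pos hk j
    rw [hr']
    exact ⟨hr, rfl⟩
  exact ⟨fun a => ⟨reflect_boundaryState hk a, isIshibashi_boundaryState hk a⟩,
    ⟨card_label hk, linearIndependent_boundaryState hk⟩,
    fun β hβ => summable_cylTerm_boundaryState hk hβ,
    fun β hβ => ⟨Z_vac hk hβ (vac k), Z_vac hk hβ⟩,
    fun β hβ => ⟨Z_comm hk hβ, Z_N0_N0 hk hβ, Z_N0_N hk hβ, Z_N0_Nk hk hβ, Z_N0_D0 hk hβ,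
      Z_N0_Dk hk hβ, Z_N_N hk hβ, Z_N_Nk hk hβ, Z_N_D0 hk hβ, Z_N_Dk hk hβ, Z_Nk_Nk hk hβ,
      Z_Nk_D0 hk hβ, Z_Nk_Dk hk hβ, Z_D0_D0 hk hβ, Z_Dk_Dk hk hβ, Z_D0_Dk hk hβ⟩,
    ⟨isSymm_modularS k, modularS_mem_unitaryGroup hk, modularS_mul_self hk, hvac,
      fun β hβ => extChar_qClosed hk hβ⟩,
    ⟨fusionMult k, fusionMult_eq_fusion hk, fusionMult_vac, fun β hβ => Z_eq_sum_fusionMult hk hβ,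
      sum_modularS_mul_fusionMult_dual hk⟩,
    ⟨extIshibashi k, fun j => ⟨reflect_extIshibashi hk j, isIshibashi_extIshibashi hk j⟩,
      fun β hβ i j => ⟨(hasSum_cylTerm_extIshibashi hk hβ i j).summable,
        (hasSum_cylTerm_extIshibashi hk hβ i j).tsum_eq⟩, boundaryState_eq_sum hk⟩⟩
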